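/- **Setting.** On a probability space $(\Omega,\mathcal F,\mathbb P)$ let $T_1,\dots,T_n$ be i.i.d. with law $F$ and $C_1,\dots,C_n$ be i.i.d. with law $G$, where $F$ and $G$ are arbitrary probability laws on $(0,\infty)$ (atoms, also common ones, are allowed) and $(T_i)_{i}$ is independent of $(C_i)_{i}$. Put $X_i=\min(T_i,C_i)$, $\Delta_i=\mathbf 1_{\{T_i\le C_i\}}$, $N(t)=\sum_i \mathbf 1_{\{X_i\le t\}}\Delta_i$, $Y(t)=\sum_i\mathbf 1_{\{X_i\ge t\}}$, $S(t)=F((t,\infty))$, $S(t-)=F([t,\infty))$, $d\Lambda(t)=S(t-)^{-1}dF(t)$, and $M(t)=N(t)-\int_{(0,t]}Y(s)\,d\Lambda(s)$. Let $\mathcal F_t$ be the $\sigma$-algebra generated by the events $\{X_i\le s,\Delta_i=1\}$, $\{X_i\le s,\Delta_i=0\}$ ($s\le t$, $1\le i\le n$) and the $\mathbb P$-null sets of $\mathcal F$. Almost every path of $M$ has finite total variation; $dM$ denotes its signed Stieltjes measure, $|dM|$ the total variation measure of $dM$, and $|dM(x)dM(y)|=|dM|(dx)\,|dM|(dy)$.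 Recall that $M$ is a square-integrable $(\mathcal F_t)$-martingale with predictable variation $d\langle M\rangle(t)=(1-\Delta\Lambda(t))Y(t)\,d\Lambda(t)$, where $\Delta\Lambda(t)=\Lambda(\{t\})$. The two-time predictable $\sigma$-algebra $\mathcal P$ is generated by the sets $(a_1,b_1]\times(a_2,b_2]\times A$ with $0\le a_1\le b_1<a_2\le b_2$, $A\in\mathcal F_{a_2}$, and $\{0\}\times\{0\}\times A$ with $A\in\mathcal F_0$. A real process $h=(h(x,y):0<x<y<\infty)$ is $\mathcal P$-measurable if it is measurable for the trace of $\mathcal P$ on $\{0<x<y\}\times\Omega$. Put $C_t=\{(x,y):0<x<y\le t\}$. A process $W$ is a square-integrable martingale if it is a martingale with $\mathbb E\,W(t)^2<\infty$ for every $t\ge 0$; its predictable variation process $\langle W\rangle$ is the predictable, increasing, right-continuous process started at $0$ (these path properties holding almost surely) for which $W^2-\langle W\rangle$ is a martingale. **Theorem.** Let $h$ be $\mathcal P$-measurable and suppose that for all $t\ge0$ $$\mathbb E\Big(\int_{C_t}|h(x,y)|\,|dM(x)dM(y)|\Big)<\infty .$$ Then $$W(t)=\int_{C_t}h(x,y)\,dM(x)\,dM(y),\qquad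 t\ge 0,$$ is a martingale with respect to $(\mathcal F_t)_{t\ge0}$. If moreover, for all $t\ge0$, $$\mathbb E\Big(\int_{(0,t]}\Big(\int_{(0,y)}|h(x,y)|\,|dM(x)|\Big)^2 d\langle M\rangle(y)\Big)<\infty ,$$ then $W$ is a square-integrable $(\mathcal F_t)$-martingale, with predictable variation process $$\langle W\rangle(t)=\int_{(0,t]}\Big(\int_{(0,y)}h(x,y)\,dM(x)\Big)^2\frac{Y(y)\,S(y)}{S(y-)^2}\,dF(y).$$ -/

import Mathlib

open MeasureTheory ProbabilityTheory Set
open scoped NNReal ENNReal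

noncomputable section

namespace Censored

/-! ### Filtrations, predictability in two times, predictable variation -/

section General

variable {Ω : Type*} {mΩ : MeasurableSpace Ω}

/-- The two-time predictable σ-algebra on `[0,∞) × [0,∞) × Ω`, generated by the sets
`(a₁, b₁] × (a₂, b₂] × A` with `a₁ ≤ b₁ < a₂ ≤ b₂` and `A ∈ 𝓕 a₂`, and the sets `{0} × {0} × A` with
`A ∈ 𝓕 0`. -/
@[reducible]
def twoTimePredictable (𝓕 : Filtration ℝ≥0 mΩ) : MeasurableSpace (ℝ≥0 × ℝ≥0 × Ω) :=
  MeasurableSpace.generateFrom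
    ({s | ∃ (a₁ b₁ a₂ b₂ : ℝ≥0) (A : Set Ω), a₁ ≤ b₁ ∧ b₁ < a₂ ∧ a₂ ≤ b₂ ∧
        MeasurableSet[𝓕 a₂] A ∧ s = Ioc a₁ b₁ ×ˢ (Ioc a₂ b₂ ×ˢ A)} ∪
      {s | ∃ A : Set Ω, MeasurableSet[𝓕 0] A ∧ s = {0} ×ˢ ({0} ×ˢ A)})

/-- A process `h(x, y)`, indexed by the pairs with `0 < x < y`, is two-time predictable if it is
measurable for the trace of the two-time predictable σ-algebra on `{0 < x < y} × Ω`. The values of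
`h` at the other pairs play no role. -/
def IsTwoTimePredictable (𝓕 : Filtration ℝ≥0 mΩ) (h : ℝ≥0 → ℝ≥0 → Ω → ℝ) : Prop :=
  Measurable[(twoTimePredictable 𝓕).comap Subtype.val]
    fun q : {q : ℝ≥0 × ℝ≥0 × Ω // 0 < q.1 ∧ q.1 < q.2.1} => h q.1.1 q.1.2.1 q.1.2.2

/-- `V` is (a version of) the predictable variation process of `W`: it is predictable, almost all
its paths start at `0`, are increasing and right-continuous, and `W² - V` is a martingale. -/
structure IsPredictableVariation (𝓕 : Filtration ℝ≥0 mΩ) (P : Measure Ω)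
    (W V : ℝ≥0 → Ω → ℝ) : Prop where
  predictable : IsStronglyPredictable 𝓕 V
  zero : ∀ᵐ ω ∂P, V 0 ω = 0
  mono : ∀ᵐ ω ∂P, Monotone fun t => V t ω
  rightCont : ∀ᵐ ω ∂P, ∀ t, ContinuousWithinAt (fun s => V s ω) (Ici t) t
  martingale : Martingale (fun t ω => W t ω ^ 2 - V t ω) 𝓕 P

/-- `W` is a square-integrable martingale: a martingale with `E W(t)² < ∞` for every `t`. -/
def IsSquareIntegrableMartingale (𝓕 : Filtration ℝ≥0 mΩ) (P : Measure Ω)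
    (W : ℝ≥0 → Ω → ℝ) : Prop :=
  Martingale W 𝓕 P ∧ ∀ t, MemLp (W t) 2 P

end General

/-! ### The law of the survival times -/

/-- The survival function `S(x) = 1 - F(x)`. -/
def survival (F : Measure ℝ≥0) (x : ℝ≥0) : ℝ := F.real (Ioi x)

/-- The left limit `S(x-)` of the survival function. -/
def survivalLeft (F : Measure ℝ≥0) (x : ℝ≥0) : ℝ := F.real (Ici x)

/-- The cumulative hazard measure `dΛ(t) = S(t-)⁻¹ dF(t)` on `(0, ∞)`. -/
def hazard (F : Measure ℝ≥0) : Measure ℝ≥0 :=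
  (F.restrict (Ioi 0)).withDensity fun t => (F (Ici t))⁻¹

/-! ### Right-censored observations -/

section Data

variable {Ω : Type*} {mΩ : MeasurableSpace Ω} {n : ℕ}

/-- The observed time `Xᵢ = min(Tᵢ, Cᵢ)`. The observation is uncensored if `Tᵢ ≤ Cᵢ`. -/
def obsTime (T C : Fin n → Ω → ℝ≥0) (i : Fin n) (ω : Ω) : ℝ≥0 := min (T i ω) (C i ω)

/-- The filtration generated by the observed events `{Xᵢ ≤ s, Δᵢ = 1}` and `{Xᵢ ≤ s, Δᵢ = 0}`,
`s ≤ t`, together with the null sets of the underlying σ-algebra. -/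
def obsFiltration (P : Measure Ω) (T C : Fin n → Ω → ℝ≥0)
    (hT : ∀ i, Measurable (T i)) (hC : ∀ i, Measurable (C i)) : Filtration ℝ≥0 mΩ where
  seq t := MeasurableSpace.generateFrom
    ({A | ∃ i, ∃ s ≤ t, A = {ω | obsTime T C i ω ≤ s ∧ T i ω ≤ C i ω}} ∪
      {A | ∃ i, ∃ s ≤ t, A = {ω | obsTime T C i ω ≤ s ∧ ¬ T i ω ≤ C i ω}} ∪
      {A | MeasurableSet A ∧ P A = 0})
  mono' := by
    intro s t hst
    refine MeasurableSpace.generateFrom_mono ?_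
    refine union_subset_union (union_subset_union ?_ ?_) subset_rfl
    · rintro A ⟨i, r, hr, rfl⟩
      exact ⟨i, r, hr.trans hst, rfl⟩
    · rintro A ⟨i, r, hr, rfl⟩
      exact ⟨i, r, hr.trans hst, rfl⟩
  le' := by
    intro t
    refine MeasurableSpace.generateFrom_le ?_
    have hX : ∀ i r, MeasurableSet {ω | obsTime T C i ω ≤ r} := fun i r =>
      measurableSet_le ((hT i).min (hC i)) measurable_const
    have hD : ∀ i, MeasurableSet {ω | T i ω ≤ C i ω} := fun i => measurableSet_le (hT i) (hC i)
    rintro A ((⟨i, r, -, rfl⟩ | ⟨i, r, -, rfl⟩) | ⟨hA, -⟩)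
    · exact (hX i r).inter (hD i)
    · exact (hX i r).inter (hD i).compl
    · exact hA

/-- The pooled risk function `Y(t) = #{i : Xᵢ ≥ t}`. -/
def atRisk (T C : Fin n → Ω → ℝ≥0) (t : ℝ≥0) (ω : Ω) : ℕ :=
  ∑ i, if t ≤ obsTime T C i ω then 1 else 0

/-- The pooled counting process `N(t) = #{i : Xᵢ ≤ t, Δᵢ = 1}`. -/
def counting (T C : Fin n → Ω → ℝ≥0) (t : ℝ≥0) (ω : Ω) : ℕ :=
  ∑ i, if obsTime T C i ω ≤ t ∧ T i ω ≤ C i ω then 1 else 0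

/-- The pooled martingale `M(t) = N(t) - ∫_{(0,t]} Y(s) dΛ(s)`. -/
def pooledM (F : Measure ℝ≥0) (T C : Fin n → Ω → ℝ≥0) (t : ℝ≥0) (ω : Ω) : ℝ :=
  counting T C t ω - ∫ s in Ioc 0 t, (atRisk T C s ω : ℝ) ∂(hazard F)

/-- The measure `dN` along a path: a unit mass at every uncensored observation. -/
def countingMeasure (T C : Fin n → Ω → ℝ≥0) (ω : Ω) : Measure ℝ≥0 :=
  ∑ i, if T i ω ≤ C i ω then Measure.dirac (obsTime T C i ω) else 0

instance (T C : Fin n → Ω → ℝ≥0) (ω : Ω) : IsFiniteMeasure (countingMeasure T C ω) := by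
  constructor
  simp only [countingMeasure, Measure.coe_finsetSum, Finset.sum_apply]
  refine ENNReal.sum_lt_top.2 fun i _ => ?_
  split_ifs <;> simp

/-- The measure `Y dΛ` along a path. It is finite for almost every path. -/
def compensatorMeasure (F : Measure ℝ≥0) (T C : Fin n → Ω → ℝ≥0) (ω : Ω) : Measure ℝ≥0 :=
  (hazard F).withDensity fun s => (atRisk T C s ω : ℝ≥0∞)

open Classical in
/-- The signed measure `dM = dN - Y dΛ` along a path, `0` by convention on the null set of paths
for which `Y dΛ` has infinite mass. -/
def dM (F : Measure ℝ≥0) (T C : Fin n → Ω → ℝ≥0) (ω : Ω) : SignedMeasure ℝ≥0 :=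
  if h : IsFiniteMeasure (compensatorMeasure F T C ω) then
    (countingMeasure T C ω).toSignedMeasure -
      @Measure.toSignedMeasure _ _ (compensatorMeasure F T C ω) h
  else 0

/-- `dM` is the Stieltjes measure of the path of `M`. -/
theorem dM_Iic (F : Measure ℝ≥0) (T C : Fin n → Ω → ℝ≥0) (ω : Ω)
    (hA : IsFiniteMeasure (compensatorMeasure F T C ω)) (t : ℝ≥0) :
    dM F T C ω (Iic t) = pooledM F T C t ω := by
  classical
  have hY : Measurable fun s => (atRisk T C s ω : ℝ≥0∞) := by
    simp only [atRisk, Nat.cast_sum]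
    refine Finset.measurable_sum _ fun i _ => ?_
    refine (measurable_from_top (f := fun k : ℕ => (k : ℝ≥0∞))).comp ?_
    exact Measurable.ite (measurableSet_le measurable_id measurable_const)
      measurable_const measurable_const
  have h0 : hazard F {0} = 0 := by
    refine withDensity_absolutelyContinuous _ _ ?_
    simp
  have hI : compensatorMeasure F T C ω (Iic t) = compensatorMeasure F T C ω (Ioc 0 t) := by
    have hc : compensatorMeasure F T C ω {0} = 0 := withDensity_absolutelyContinuous _ _ h0
    refine le_antisymm ?_ (measure_mono Ioc_subset_Iic_self)
    calc compensatorMeasure F T C ω (Iic t)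
        ≤ compensatorMeasure F T C ω ({0} ∪ Ioc 0 t) := by
          refine measure_mono fun s hs => ?_
          rcases eq_or_ne s 0 with h | h
          · exact Or.inl h
          · exact Or.inr ⟨pos_iff_ne_zero.2 h, hs⟩
      _ ≤ _ := (measure_union_le _ _).trans (by simp [hc])
  have hN : (countingMeasure T C ω).real (Iic t) = counting T C t ω := by
    have : countingMeasure T C ω (Iic t) = (counting T C t ω : ℝ≥0∞) := by
      simp only [countingMeasure, counting, Measure.coe_finsetSum, Finset.sum_apply, Nat.cast_sum]
      refine Finset.sum_congr rfl fun i _ => ?_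
      by_cases h1 : T i ω ≤ C i ω <;> by_cases h2 : obsTime T C i ω ≤ t <;> simp [h1, h2]
    simp [Measure.real, this]
  have hC : (compensatorMeasure F T C ω).real (Iic t)
      = ∫ s in Ioc 0 t, (atRisk T C s ω : ℝ) ∂(hazard F) := by
    rw [Measure.real, hI, compensatorMeasure, withDensity_apply _ measurableSet_Ioc,
      ← integral_toReal hY.aemeasurable (by simp)]
    simp
  rw [dM, dif_pos hA, pooledM, ← hN, ← hC]
  simp [Measure.toSignedMeasure_apply_measurable measurableSet_Iic]

/-- The measure `d⟨M⟩ = (1 - ΔΛ) Y dΛ` along a path. -/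
def varM (F : Measure ℝ≥0) (T C : Fin n → Ω → ℝ≥0) (ω : Ω) : Measure ℝ≥0 :=
  (hazard F).withDensity fun y => (1 - hazard F {y}) * (atRisk T C y ω : ℝ≥0∞)

/-- The domain `C_t = {(x, y) : 0 < x < y ≤ t}`. -/
def domC (t : ℝ≥0) : Set (ℝ≥0 × ℝ≥0) := {p | 0 < p.1 ∧ p.1 < p.2 ∧ p.2 ≤ t}

/-- The double integral `W(t) = ∫_{C_t} h(x, y) dM(x) dM(y)`, taken path by path with respect to
the product of the signed measure `dM` with itself. -/
def doubleIntegral (F : Measure ℝ≥0) (T C : Fin n → Ω → ℝ≥0) (h : ℝ≥0 → ℝ≥0 → Ω → ℝ)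
    (t : ℝ≥0) (ω : Ω) : ℝ :=
  ∫ᵛ p in domC t, h p.1 p.2 ω
    ∂•((dM F T C ω).prod (dM F T C ω) (ContinuousLinearMap.mul ℝ ℝ))

/-- The process `∫_{(0,t]} (∫_{(0,y)} h(x, y) dM(x))² Y(y) S(y) / S(y-)² dF(y)`. -/
def doubleVariation (F : Measure ℝ≥0) (T C : Fin n → Ω → ℝ≥0) (h : ℝ≥0 → ℝ≥0 → Ω → ℝ)
    (t : ℝ≥0) (ω : Ω) : ℝ :=
  ∫ y in Ioc 0 t, (∫ᵛ x in Ioo 0 y, h x y ω ∂•(dM F T C ω)) ^ 2 *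
    ((atRisk T C y ω : ℝ) * survival F y / survivalLeft F y ^ 2) ∂F

end Data

end Censored

end

/-! By Fubini along a path, W(t) = ∫_{(0,t]} H(y) dM(y) with H(y) = ∫_{(0,y)} h(x,y) dM(x). The
inner integral only uses what is known strictly before y, so H is predictable, and the theorem
reduces to one about integrals of predictable processes against M. Neither a general stochastic
integral nor a known martingale property of M is used: the facts on M and ⟨M⟩ come out as the case H
= 1.

Paths: dM has a density with values in [-1, 1] with respect to the finite kernel dN + Y dΛ
(`dM_eq`). Every integral thus becomes a Bochner integral, jointly measurable in ω.

Centring: on {y ≤ X_j} a predictable process depends only on y and the observations other than the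
j-th (`isFreeOf_of_predictable`). With these frozen, (T_j, C_j) has law F ⊗ G, and E[k(T); T ≤ C] =
∫ k(t) G([t,∞)) dF(t) = E ∫_{(0,X]} k dΛ. This is `IsSample.lintegral_compensation`; summation over
j and truncation give E ∫ K dM = 0. Applied to 1_{(s,t]×A} K with A in the past of s, it is the
martingale property.

Isometry: split (∫ K dM)² along the diagonal (`sq_integral_eq`). The two triangles give 2 ∫ (K(y)
∫_{(0,y)} K dM) dM(y), whose integrand is predictable, so the term is centred. The diagonal gives ∫
K² ΔM dM with ΔM the sum of the individual jumps. By independence only equal indices contribute,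
even at common atoms, and they produce E ∫ K² (1 - ΔΛ) Y dΛ
(`IsSample.integral_stochIntegral_jumpAt`). Localised to 1_{(s,t]×A} H, the isometry says that W² -
∫ H² d⟨M⟩ is a martingale. Finally (1 - ΔΛ) dΛ = S(y) S(y-)⁻² dF.

Predictability of H is checked on generators of the two-time σ-algebra, separately for the counting
part and the compensator (`measurable_inner_predictable`). -/

noncomputable section

namespace Censored

/-! ### Signed measures with a density -/

section SignedDensity

variable {X : Type*} {mX : MeasurableSpace X}

/-- The pairing by scalar multiplication on `ℝ` is symmetric. -/
lemma lsmul_flip_real :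
    (ContinuousLinearMap.lsmul ℝ ℝ : ℝ →L[ℝ] ℝ →L[ℝ] ℝ).flip = ContinuousLinearMap.lsmul ℝ ℝ := by
  ext; simp

lemma integral_lsmul_toSignedMeasure {μ : Measure X} [IsFiniteMeasure μ] (f : X → ℝ) :
    ∫ᵛ x, f x ∂•μ.toSignedMeasure = ∫ x, f x ∂μ := by
  rw [← VectorMeasure.integral_toSignedMeasure, lsmul_flip_real]

/-- `‖ρ‖ₑ` is the density of the total variation of the signed measure ρμ, so the left side is
integrability against that signed measure. -/
lemma integrable_withDensity_enorm_iff {μ : Measure X} {ρ f : X → ℝ} (hρ : Measurable ρ)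
    (hf : Measurable f) :
    Integrable f (μ.withDensity fun x => ‖ρ x‖ₑ) ↔ Integrable (fun x => f x * ρ x) μ := by
  have h1 : ∫⁻ x, ‖f x‖ₑ ∂(μ.withDensity fun x => ‖ρ x‖ₑ) = ∫⁻ x, ‖f x * ρ x‖ₑ ∂μ := by
    rw [lintegral_withDensity_eq_lintegral_mul _ hρ.enorm hf.enorm]
    simp [enorm_mul, mul_comm]
  constructor
  · intro h
    refine ⟨(hf.mul hρ).aestronglyMeasurable, ?_⟩
    rw [hasFiniteIntegral_iff_enorm, ← h1]
    exact h.2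
  · intro h
    refine ⟨hf.aestronglyMeasurable, ?_⟩
    rw [hasFiniteIntegral_iff_enorm, h1]
    exact h.2

/-- Integration with respect to a signed measure with density `ρ`. -/
lemma integral_lsmul_withDensityᵥ {μ : Measure X} {ρ f : X → ℝ} (hρ : Measurable ρ)
    (hρi : Integrable ρ μ) (hf : Measurable f) :
    ∫ᵛ x, f x ∂•(μ.withDensityᵥ ρ) = ∫ x, f x * ρ x ∂μ := by
  -- Without integrability of `f * ρ` both integrals are 0 by convention. Otherwise `ρ` is split
  -- into its positive and negative parts, both dominated by |ρ|.
  by_cases hfi : Integrable (fun x => f x * ρ x) μ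
  · have hρn : Measurable fun x => -ρ x := hρ.neg
    have hfp : ∫⁻ x, ENNReal.ofReal (ρ x) ∂μ ≠ ∞ :=
      ne_top_of_le_ne_top hρi.2.ne (lintegral_mono fun x => by
        simpa using ENNReal.ofReal_le_ofReal (le_abs_self (ρ x)) |>.trans
          (by rw [← Real.enorm_eq_ofReal_abs]))
    have hfn : ∫⁻ x, ENNReal.ofReal (-ρ x) ∂μ ≠ ∞ :=
      ne_top_of_le_ne_top hρi.2.ne (lintegral_mono fun x => by
        simpa using ENNReal.ofReal_le_ofReal (neg_le_abs (ρ x)) |>.trans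
          (by rw [← Real.enorm_eq_ofReal_abs]))
    have : IsFiniteMeasure (μ.withDensity fun x => ENNReal.ofReal (ρ x)) :=
      isFiniteMeasure_withDensity hfp
    have : IsFiniteMeasure (μ.withDensity fun x => ENNReal.ofReal (-ρ x)) :=
      isFiniteMeasure_withDensity hfn
    have hint (σ : X → ℝ) (hσ : Measurable σ) (hle : ∀ x, |σ x| ≤ |ρ x|) :
        Integrable (fun x => f x * σ x) μ :=
      hfi.mono (hf.mul hσ).aestronglyMeasurable (ae_of_all _ fun x => by
        simp only [norm_mul, Real.norm_eq_abs]
        exact mul_le_mul_of_nonneg_left (hle x) (abs_nonneg _))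
    have hwd (σ : X → ℝ) (hσ : Measurable σ) (hσ0 : ∀ x, 0 ≤ σ x) :
        (μ.withDensity fun x => ENNReal.ofReal (σ x)) = μ.withDensity fun x => ‖σ x‖ₑ := by
      congr with x
      rw [Real.enorm_eq_ofReal (hσ0 x)]
    have hmax : ∀ x, ENNReal.ofReal (ρ x) = ENNReal.ofReal (max (ρ x) 0) := fun x => by simp
    have hmin : ∀ x, ENNReal.ofReal (-ρ x) = ENNReal.ofReal (max (-ρ x) 0) := fun x => by simp
    have hip : Integrable f (μ.withDensity fun x => ENNReal.ofReal (ρ x)) := by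
      simp_rw [hmax]
      rw [hwd _ (hρ.max measurable_const) fun x => le_max_right _ _]
      rw [integrable_withDensity_enorm_iff (hρ.max measurable_const) hf]
      refine hint _ (hρ.max measurable_const) fun x => ?_
      rw [abs_of_nonneg (le_max_right _ _)]
      exact max_le (le_abs_self _) (abs_nonneg _)
    have hin : Integrable f (μ.withDensity fun x => ENNReal.ofReal (-ρ x)) := by
      simp_rw [hmin]
      rw [hwd _ (hρn.max measurable_const) fun x => le_max_right _ _]
      rw [integrable_withDensity_enorm_iff (hρn.max measurable_const) hf]
      refine hint _ (hρn.max measurable_const) fun x => ?_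
      rw [abs_of_nonneg (le_max_right _ _)]
      exact max_le (neg_le_abs _) (abs_nonneg _)
    rw [withDensityᵥ_eq_withDensity_pos_part_sub_withDensity_neg_part hρi,
      VectorMeasure.integral_sub_vectorMeasure, integral_lsmul_toSignedMeasure,
      integral_lsmul_toSignedMeasure, integral_withDensity_eq_integral_toReal_smul
        hρ.ennreal_ofReal (by simp), integral_withDensity_eq_integral_toReal_smul
        hρn.ennreal_ofReal (by simp), ← integral_sub]
    · refine integral_congr_ae (ae_of_all _ fun x => ?_)
      simp only [smul_eq_mul, ENNReal.toReal_ofReal']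
      rw [← sub_mul, max_comm (ρ x), max_comm (-ρ x), mul_comm]
      congr 1
      rcases le_total 0 (ρ x) with h | h <;> simp [h]
    · simp only [smul_eq_mul, ENNReal.toReal_ofReal', mul_comm _ (f _)]
      refine hint _ (hρ.max measurable_const) fun x => ?_
      rw [abs_of_nonneg (le_max_right _ _)]
      exact max_le (le_abs_self _) (abs_nonneg _)
    · simp only [smul_eq_mul, ENNReal.toReal_ofReal', mul_comm _ (f _)]
      refine hint _ (hρn.max measurable_const) fun x => ?_
      rw [abs_of_nonneg (le_max_right _ _)]
      exact max_le (neg_le_abs _) (abs_nonneg _)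
    · rwa [VectorMeasure.Integrable, Measure.variation_toSignedMeasure]
    · rwa [VectorMeasure.Integrable, Measure.variation_toSignedMeasure]
  · rw [integral_undef hfi, VectorMeasure.integral_undef]
    rwa [VectorMeasure.Integrable, Measure.variation_withDensityᵥ hρi,
      integrable_withDensity_enorm_iff hρ hf]

/-- The product is determined by its values on rectangles. This moves dM ⊗ dM to a product of
positive measures, where Fubini is at hand. -/
lemma prod_withDensityᵥ {μ : Measure X} [IsFiniteMeasure μ] {ρ : X → ℝ} (hρi : Integrable ρ μ) :
    (μ.withDensityᵥ ρ).prod (μ.withDensityᵥ ρ) (ContinuousLinearMap.mul ℝ ℝ) =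
      (μ.prod μ).withDensityᵥ fun p => ρ p.1 * ρ p.2 := by
  refine VectorMeasure.prod_eq_of_forall_apply_prod fun s t hs ht => ?_
  rw [withDensityᵥ_apply (hρi.mul_prod hρi) (hs.prod ht), withDensityᵥ_apply hρi hs,
    withDensityᵥ_apply hρi ht, setIntegral_prod_mul]
  rfl

end SignedDensity

/-! ### Martingales and distribution functions -/

section General

variable {Ω : Type*} {mΩ : MeasurableSpace Ω} {P : Measure Ω} {𝓕 : Filtration ℝ≥0 mΩ}

/-- A process is a martingale if its increments integrate to `0` over the events of the past. -/
lemma martingale_of_setIntegral_eq [IsFiniteMeasure P] {W : ℝ≥0 → Ω → ℝ}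
    (hW : ∀ t, StronglyMeasurable[𝓕 t] (W t)) (hWi : ∀ t, Integrable (W t) P)
    (h : ∀ s t, s ≤ t → ∀ A, MeasurableSet[𝓕 s] A → ∫ ω in A, (W t ω - W s ω) ∂P = 0) :
    Martingale W 𝓕 P := by
  refine ⟨hW, fun s t hst => ?_⟩
  refine (ae_eq_condExp_of_forall_setIntegral_eq (𝓕.le s) (hWi t)
    (fun A _ _ => (hWi s).integrableOn) (fun A hA _ => ?_) (hW s).aestronglyMeasurable).symm
  have := h s t hst A hA
  rw [integral_sub (hWi t).integrableOn (hWi s).integrableOn] at this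
  linarith

/-- The known factor is pulled out of the conditional expectation. This removes the cross term
W(s)(W(t) - W(s)) when squares are compared. -/
lemma Martingale.integral_mul_sub_eq_zero [IsFiniteMeasure P] {W : ℝ≥0 → Ω → ℝ}
    (hW : Martingale W 𝓕 P) {s t : ℝ≥0} (hst : s ≤ t) {f : Ω → ℝ}
    (hf : StronglyMeasurable[𝓕 s] f) (hi : Integrable (fun ω => f ω * (W t ω - W s ω)) P) :
    ∫ ω, f ω * (W t ω - W s ω) ∂P = 0 := by
  have hd : Integrable (W t - W s) P := (hW.integrable t).sub (hW.integrable s)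
  have h1 : P[f * (W t - W s)|𝓕 s] =ᵐ[P] f * P[W t - W s|𝓕 s] :=
    condExp_mul_of_stronglyMeasurable_left hf hi hd
  have h2 : P[W t - W s|𝓕 s] =ᵐ[P] 0 := by
    refine (condExp_sub (hW.integrable t) (hW.integrable s) _).trans ?_
    filter_upwards [hW.condExp_ae_eq hst, hW.condExp_ae_eq (le_refl s)] with ω h1 h2
    simp [h1, h2]
  have h3 := integral_condExp (μ := P) (𝓕.le s) (f := f * (W t - W s))
  rw [show (∫ ω, f ω * (W t ω - W s ω) ∂P) = ∫ ω, (f * (W t - W s)) ω ∂P from rfl, ← h3]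
  refine integral_eq_zero_of_ae ?_
  filter_upwards [h1, h2] with ω h1 h2
  simp [h1, h2]

/-- The distribution function of a locally finite measure is increasing and right-continuous. -/
lemma measure_Ioc_monotone {ν : Measure ℝ≥0} (hν : ∀ t, ν (Ioc 0 t) ≠ ∞) :
    Monotone fun t => (ν (Ioc 0 t)).toReal := fun _ t hst =>
  ENNReal.toReal_mono (hν t) (measure_mono (Ioc_subset_Ioc_right hst))

lemma measure_Ioc_rightCont {ν : Measure ℝ≥0} (hν : ∀ t, ν (Ioc 0 t) ≠ ∞) (t : ℝ≥0) :
    ContinuousWithinAt (fun t => (ν (Ioc 0 t)).toReal) (Ici t) t := by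
  rw [← continuousWithinAt_Ioi_iff_Ici]
  have h := tendsto_measure_biInter_gt (μ := ν) (s := fun r => Ioc 0 r) (a := t)
    (fun r _ => measurableSet_Ioc.nullMeasurableSet)
    (fun i j _ hij => Ioc_subset_Ioc_right hij) ⟨t + 1, by simp, hν _⟩
  have h2 : (⋂ r, ⋂ (_ : r > t), Ioc 0 r) = Ioc 0 t := by
    ext x
    simp only [mem_iInter, mem_Ioc]
    constructor
    · intro h
      exact ⟨(h (t + 1) (by simp)).1, le_of_forall_gt_imp_ge_of_dense fun r hr => (h r hr).2⟩
    · rintro ⟨h1, h2⟩ r hr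
      exact ⟨h1, h2.trans hr.le⟩
  rw [h2] at h
  exact (ENNReal.tendsto_toReal (hν t)).comp h

end General

/-! ### The predictable σ-algebras -/

section Predictable

variable {Ω : Type*} {mΩ : MeasurableSpace Ω} {𝓕 : Filtration ℝ≥0 mΩ}

/-- Used to write events defined by a strict inequality between times as countable unions of
rectangles. -/
lemma exists_denseSeq_between {x y : ℝ≥0} (h : x < y) :
    ∃ m, x < TopologicalSpace.denseSeq ℝ≥0 m ∧ TopologicalSpace.denseSeq ℝ≥0 m < y := by
  obtain ⟨z, ⟨m, rfl⟩, hz⟩ := (TopologicalSpace.denseRange_denseSeq ℝ≥0).exists_between h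
  exact ⟨m, hz⟩

lemma predictable_le_prod : 𝓕.predictable ≤ (inferInstance : MeasurableSpace (ℝ≥0 × Ω)) := by
  refine measurableSpace_le_predictable_of_measurableSet ?_ ?_
  · intro A hA
    exact (measurableSet_singleton _).prod (𝓕.le _ _ hA)
  · intro a A hA
    exact measurableSet_Ioi.prod (𝓕.le _ _ hA)

lemma measurable_fst_predictable :
    Measurable[𝓕.predictable] (Prod.fst : ℝ≥0 × Ω → ℝ≥0) := by
  refine measurable_of_Ioi fun a => ?_
  have := measurableSet_predictable_Ioi_prod (𝓕 := 𝓕) (i := a) (s := univ) MeasurableSet.univ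
  rwa [prod_univ] at this

/-- The time `⊥` lies in no interval `Ioi i`, so generators of different type never meet. -/
lemma isPiSystem_predictable :
    IsPiSystem ({s | ∃ A, MeasurableSet[𝓕 ⊥] A ∧ s = {⊥} ×ˢ A} ∪
      {s | ∃ i A, MeasurableSet[𝓕 i] A ∧ s = Ioi i ×ˢ A} : Set (Set (ℝ≥0 × Ω))) := by
  rintro _ (⟨A, hA, rfl⟩ | ⟨i, A, hA, rfl⟩) _ (⟨B, hB, rfl⟩ | ⟨j, B, hB, rfl⟩) hne
  · exact Or.inl ⟨A ∩ B, hA.inter hB, by rw [prod_inter_prod, inter_self]⟩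
  · obtain ⟨p, hp⟩ := hne
    simp only [mem_inter_iff, mem_prod, mem_singleton_iff, mem_Ioi] at hp
    rw [hp.1.1] at hp
    exact absurd hp.2.1 not_lt_bot
  · obtain ⟨p, hp⟩ := hne
    simp only [mem_inter_iff, mem_prod, mem_singleton_iff, mem_Ioi] at hp
    rw [hp.2.1] at hp
    exact absurd hp.1.1 not_lt_bot
  · refine Or.inr ⟨max i j, A ∩ B, ?_, by rw [prod_inter_prod, Ioi_inter_Ioi]⟩
    exact (𝓕.mono (le_max_left i j) _ hA).inter (𝓕.mono (le_max_right i j) _ hB)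

/-- Integrals against a family of finite measures are measurable in the parameter if the masses of
the sets of a generating π-system are. -/
lemma measurable_lintegral_of_isPiSystem {α β : Type*} {mα : MeasurableSpace α}
    {mβ : MeasurableSpace β} (κ : α → Measure β) [∀ a, IsFiniteMeasure (κ a)] {S : Set (Set β)}
    (hgen : mβ = MeasurableSpace.generateFrom S) (hpi : IsPiSystem S)
    (hbasic : ∀ s ∈ S, Measurable fun a => κ a s) (huniv : Measurable fun a => κ a univ)
    {f : β → ℝ≥0∞} (hf : Measurable f) : Measurable fun a => ∫⁻ b, f b ∂(κ a) :=
  (Measure.measurable_lintegral hf).comp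
    (Measurable.measure_of_isPiSystem hgen hpi hbasic huniv)

lemma measurable_prodMk_predictable (ω : Ω) :
    @Measurable _ _ _ 𝓕.predictable fun y : ℝ≥0 => (y, ω) :=
  measurable_prodMk_right.mono le_rfl predictable_le_prod

/-- The running integral of a predictable process against a deterministic measure is predictable. -/
lemma measurable_lintegral_Ioc_predictable (μ : Measure ℝ≥0) [IsFiniteMeasure μ]
    {g : ℝ≥0 × Ω → ℝ≥0∞} (hg : Measurable[𝓕.predictable] g) :
    Measurable[𝓕.predictable] fun p : ℝ≥0 × Ω => ∫⁻ y in Ioc 0 p.1, g (y, p.2) ∂μ := by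
  let mβ : MeasurableSpace (ℝ≥0 × Ω) := 𝓕.predictable
  -- The running integral at `p` is ∫ g dκ_p, where κ_p carries μ on (0, p.1] to the section over
  -- `p.2`. Measurability in `p` need then only be tested on generators: on (a,∞) × A the mass is
  -- 1_{(a,∞)×A}(p) μ((a, p.1]).
  let κ : ℝ≥0 × Ω → @Measure (ℝ≥0 × Ω) 𝓕.predictable := fun p =>
    @Measure.map _ _ _ 𝓕.predictable (fun y => (y, p.2)) (μ.restrict (Ioc 0 p.1))
  have hκf : ∀ p, @IsFiniteMeasure _ 𝓕.predictable (κ p) := fun p =>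
    @Measure.isFiniteMeasure_map _ _ 𝓕.predictable _ _ _ _
  have hκ : ∀ p s, MeasurableSet[𝓕.predictable] s →
      κ p s = μ (Ioc 0 p.1 ∩ {y | (y, p.2) ∈ s}) := by
    intro p s hs
    rw [Measure.map_apply (measurable_prodMk_predictable p.2) hs, Measure.restrict_apply
      (measurable_prodMk_predictable p.2 hs), inter_comm]
    rfl
  have hIoc : ∀ a, Measurable[𝓕.predictable] fun p : ℝ≥0 × Ω => μ (Ioc a p.1) := by
    intro a
    have : Measurable fun t => μ (Ioc a t) :=
      Monotone.measurable fun s t hst => measure_mono (Ioc_subset_Ioc_right hst)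
    exact this.comp measurable_fst_predictable
  have key := @measurable_lintegral_of_isPiSystem _ _ 𝓕.predictable 𝓕.predictable κ hκf _ rfl
    isPiSystem_predictable ?_ ?_ g hg
  · convert key using 2 with p
    exact (lintegral_map hg (measurable_prodMk_predictable p.2)).symm
  · rintro s (⟨A, hA, rfl⟩ | ⟨a, A, hA, rfl⟩)
    · have : (fun p => κ p ({⊥} ×ˢ A)) = fun _ => 0 := by
        ext p
        rw [hκ p _ (measurableSet_predictable_singleton_bot_prod hA)]
        convert measure_empty (μ := μ)
        ext y
        simp only [mem_inter_iff, mem_Ioc, mem_ofPred_eq, mem_prod, mem_singleton_iff,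
          mem_empty_iff_false, iff_false, not_and]
        rintro ⟨h, -⟩ rfl
        exact absurd h not_lt_bot
      rw [this]
      exact measurable_const
    · have : (fun p => κ p (Ioi a ×ˢ A)) =
          (Ioi a ×ˢ A).indicator fun p : ℝ≥0 × Ω => μ (Ioc a p.1) := by
        ext p
        rw [hκ p _ (measurableSet_predictable_Ioi_prod hA)]
        by_cases hp : p ∈ Ioi a ×ˢ A
        · rw [indicator_of_mem hp]
          congr 1
          ext y
          simp only [mem_inter_iff, mem_Ioc, mem_ofPred_eq, mem_prod, mem_Ioi]
          exact ⟨fun h => ⟨h.2.1, h.1.2⟩, fun h => ⟨⟨zero_le.trans_lt h.1, h.2⟩, h.1, hp.2⟩⟩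
        · rw [indicator_of_notMem hp]
          convert measure_empty (μ := μ)
          ext y
          simp only [mem_inter_iff, mem_Ioc, mem_ofPred_eq, mem_prod, mem_Ioi,
            mem_empty_iff_false, iff_false]
          exact fun h => hp ⟨h.2.1.trans_le h.1.2, h.2.2⟩
      rw [this]
      exact (hIoc a).indicator (measurableSet_predictable_Ioi_prod hA)
  · have : (fun p => κ p univ) = fun p => μ (Ioc 0 p.1) := by
      ext p
      rw [hκ p _ MeasurableSet.univ]
      simp
    rw [this]
    exact hIoc 0

/-- The index domain `{0 < x < y}`. -/
def orderedPairs (Ω : Type*) : Set (ℝ≥0 × ℝ≥0 × Ω) := {q | 0 < q.1 ∧ q.1 < q.2.1}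

lemma measurableSet_twoTimePredictable_Ioc_prod {a₁ b₁ a₂ b₂ : ℝ≥0} (h : b₁ < a₂) {A : Set Ω}
    (hA : MeasurableSet[𝓕 a₂] A) :
    MeasurableSet[twoTimePredictable 𝓕] (Ioc a₁ b₁ ×ˢ (Ioc a₂ b₂ ×ˢ A)) := by
  rcases le_total b₁ a₁ with h1 | h1
  · simp [Ioc_eq_empty_of_le h1]
  rcases le_total b₂ a₂ with h2 | h2
  · simp [Ioc_eq_empty_of_le h2]
  exact MeasurableSpace.measurableSet_generateFrom (Or.inl ⟨a₁, b₁, a₂, b₂, A, h1, h, h2, hA, rfl⟩)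

lemma twoTimePredictable_le_prod :
    twoTimePredictable 𝓕 ≤ (inferInstance : MeasurableSpace (ℝ≥0 × ℝ≥0 × Ω)) := by
  refine MeasurableSpace.generateFrom_le ?_
  rintro _ (⟨a₁, b₁, a₂, b₂, A, -, -, -, hA, rfl⟩ | ⟨A, hA, rfl⟩)
  · exact measurableSet_Ioc.prod (measurableSet_Ioc.prod (𝓕.le _ _ hA))
  · exact (measurableSet_singleton _).prod ((measurableSet_singleton _).prod (𝓕.le _ _ hA))

/-- The sets `{a < x < y, b < y} × A` with `A` in the past of `max a b`. -/
lemma measurableSet_twoTimePredictable_lt {a b : ℝ≥0} {A : Set Ω}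
    (hA : MeasurableSet[𝓕 (max a b)] A) :
    MeasurableSet[twoTimePredictable 𝓕]
      {q : ℝ≥0 × ℝ≥0 × Ω | a < q.1 ∧ q.1 < q.2.1 ∧ b < q.2.1 ∧ q.2.2 ∈ A} := by
  let d := TopologicalSpace.denseSeq ℝ≥0
  -- Two dense points d m < d k between x and y separate the times: one ends the first interval, the
  -- other starts the second, which leaves the gap that the generators require. As a ≤ d m < d k,
  -- the event `A` belongs to the past at the start of the second interval.
  have : {q : ℝ≥0 × ℝ≥0 × Ω | a < q.1 ∧ q.1 < q.2.1 ∧ b < q.2.1 ∧ q.2.2 ∈ A} =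
      ⋃ (m : ℕ) (k : ℕ) (l : ℕ) (_ : a ≤ d m) (_ : d m < d k),
        Ioc a (d m) ×ˢ (Ioc (max (d k) b) (d k + l) ×ˢ A) := by
    ext ⟨x, y, ω⟩
    simp only [mem_ofPred_eq, mem_iUnion, mem_prod, mem_Ioc, exists_prop, max_lt_iff]
    constructor
    · rintro ⟨h1, h2, h3, h4⟩
      obtain ⟨m, hm1, hm2⟩ := exists_denseSeq_between h2
      obtain ⟨k, hk1, hk2⟩ := exists_denseSeq_between hm2
      obtain ⟨l, hl⟩ := exists_nat_ge y
      exact ⟨m, k, l, (h1.trans hm1).le, hk1, ⟨h1, hm1.le⟩, ⟨⟨hk2, h3⟩,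
        hl.trans le_add_self⟩, h4⟩
    · rintro ⟨m, k, l, h1, h2, h3, h4, h5⟩
      exact ⟨h3.1, h3.2.trans_lt (h2.trans h4.1.1), h4.1.2, h5⟩
  rw [this]
  refine MeasurableSet.iUnion fun m => MeasurableSet.iUnion fun k => MeasurableSet.iUnion fun l =>
    MeasurableSet.iUnion fun hm => MeasurableSet.iUnion fun hk => ?_
  refine measurableSet_twoTimePredictable_Ioc_prod (hk.trans_le (le_max_left _ _)) ?_
  exact 𝓕.mono (max_le_max (hm.trans hk.le) le_rfl) _ hA

lemma measurableSet_orderedPairs :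
    MeasurableSet[twoTimePredictable 𝓕] (orderedPairs Ω) := by
  have := measurableSet_twoTimePredictable_lt (𝓕 := 𝓕) (a := 0) (b := 0) (A := univ)
    MeasurableSet.univ
  convert this using 1
  ext q
  simp only [orderedPairs, mem_ofPred_eq, mem_univ, and_true]
  exact ⟨fun h => ⟨h.1, h.2, h.1.trans h.2⟩, fun h => ⟨h.1, h.2.1⟩⟩

/-- What is predictable at the earlier time x is known at the later time y. With the companion for
the second time, this makes (x, y) ↦ K(x) K(y) two-time predictable on x < y, as the isometry
requires. -/
lemma measurableSet_orderedPairs_fst {S : Set (ℝ≥0 × Ω)} (hS : MeasurableSet[𝓕.predictable] S) :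
    MeasurableSet[twoTimePredictable 𝓕] (orderedPairs Ω ∩ {q | (q.1, q.2.2) ∈ S}) := by
  induction S, hS using MeasurableSpace.generateFrom_induction with
  | hC S hS _ =>
    obtain ⟨A, hA, rfl⟩ | ⟨a, A, hA, rfl⟩ := hS
    · convert @MeasurableSet.empty _ (twoTimePredictable 𝓕)
      ext q
      simp only [orderedPairs, mem_inter_iff, mem_ofPred_eq, mem_prod, mem_singleton_iff,
        mem_empty_iff_false, iff_false]
      rintro ⟨⟨h, -⟩, h', -⟩
      rw [h'] at h
      exact absurd h not_lt_bot
    · convert measurableSet_twoTimePredictable_lt (𝓕 := 𝓕) (a := a) (b := 0) (A := A)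
        (𝓕.mono (le_max_left _ _) _ hA) using 1
      ext q
      simp only [orderedPairs, mem_inter_iff, mem_ofPred_eq, mem_prod, mem_Ioi]
      exact ⟨fun h => ⟨h.2.1, h.1.2, h.1.1.trans h.1.2, h.2.2⟩,
        fun h => ⟨⟨zero_le.trans_lt h.1, h.2.1⟩, h.1, h.2.2.2⟩⟩
  | empty => simp
  | compl S _ ih =>
    convert MeasurableSet.diff (measurableSet_orderedPairs (𝓕 := 𝓕)) ih using 1
    ext q
    simp only [mem_inter_iff, mem_ofPred_eq, mem_compl_iff, mem_sdiff]
    tauto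
  | iUnion s _ ih =>
    convert MeasurableSet.iUnion ih using 1
    ext q
    simp

lemma measurableSet_orderedPairs_snd {S : Set (ℝ≥0 × Ω)} (hS : MeasurableSet[𝓕.predictable] S) :
    MeasurableSet[twoTimePredictable 𝓕] (orderedPairs Ω ∩ {q | q.2 ∈ S}) := by
  induction S, hS using MeasurableSpace.generateFrom_induction with
  | hC S hS _ =>
    obtain ⟨A, hA, rfl⟩ | ⟨a, A, hA, rfl⟩ := hS
    · convert @MeasurableSet.empty _ (twoTimePredictable 𝓕)
      ext q
      simp only [orderedPairs, mem_inter_iff, mem_ofPred_eq, mem_prod, mem_singleton_iff,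
        mem_empty_iff_false, iff_false]
      rintro ⟨⟨h, h1⟩, h', -⟩
      rw [h'] at h1
      exact absurd h1 not_lt_bot
    · convert measurableSet_twoTimePredictable_lt (𝓕 := 𝓕) (a := 0) (b := a) (A := A)
        (𝓕.mono (le_max_right _ _) _ hA) using 1
      ext q
      simp only [orderedPairs, mem_inter_iff, mem_ofPred_eq, mem_prod, mem_Ioi]
      tauto
  | empty => simp
  | compl S _ ih =>
    convert MeasurableSet.diff (measurableSet_orderedPairs (𝓕 := 𝓕)) ih using 1
    ext q
    simp only [mem_inter_iff, mem_ofPred_eq, mem_compl_iff, mem_sdiff]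
    tauto
  | iUnion s _ ih =>
    convert MeasurableSet.iUnion ih using 1
    ext q
    simp

/-- A function on `orderedPairs`, extended by a constant, is measurable as soon as the preimages of
measurable sets are. -/
lemma measurable_indicator_of_inter {α β : Type*} {mα : MeasurableSpace α} [MeasurableSpace β]
    [Zero β] {D : Set α} (hD : MeasurableSet D) {f : α → β}
    (hf : ∀ s, MeasurableSet s → MeasurableSet (D ∩ f ⁻¹' s)) : Measurable (D.indicator f) := by
  classical
  intro s hs
  have : D.indicator f ⁻¹' s = (D ∩ f ⁻¹' s) ∪ (Dᶜ ∩ {_x | (0 : β) ∈ s}) := by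
    ext x
    by_cases hx : x ∈ D <;> simp [hx]
  rw [this]
  exact (hf s hs).union (hD.compl.inter (MeasurableSet.const _))

lemma measurable_orderedPairs_fst {β : Type*} [MeasurableSpace β] [Zero β] {f : ℝ≥0 × Ω → β}
    (hf : Measurable[𝓕.predictable] f) :
    Measurable[twoTimePredictable 𝓕] ((orderedPairs Ω).indicator fun q => f (q.1, q.2.2)) :=
  measurable_indicator_of_inter measurableSet_orderedPairs fun _ hs =>
    measurableSet_orderedPairs_fst (hf hs)

lemma measurable_orderedPairs_snd {β : Type*} [MeasurableSpace β] [Zero β] {f : ℝ≥0 × Ω → β}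
    (hf : Measurable[𝓕.predictable] f) :
    Measurable[twoTimePredictable 𝓕] ((orderedPairs Ω).indicator fun q => f q.2) :=
  measurable_indicator_of_inter measurableSet_orderedPairs fun _ hs =>
    measurableSet_orderedPairs_snd (hf hs)

/-- A two-time predictable process, extended by `0` off its index domain. -/
lemma IsTwoTimePredictable.measurable_indicator {h : ℝ≥0 → ℝ≥0 → Ω → ℝ}
    (hh : IsTwoTimePredictable 𝓕 h) :
    Measurable[twoTimePredictable 𝓕]
      ((orderedPairs Ω).indicator fun q => h q.1 q.2.1 q.2.2) := by
  refine measurable_indicator_of_inter measurableSet_orderedPairs fun s hs => ?_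
  obtain ⟨U, hU, hUs⟩ := hh hs
  convert (measurableSet_orderedPairs (𝓕 := 𝓕)).inter hU using 1
  ext q
  simp only [mem_inter_iff, mem_preimage, and_congr_right_iff]
  intro hq
  have := congrArg (fun V => (⟨q, hq⟩ : {q : ℝ≥0 × ℝ≥0 × Ω // 0 < q.1 ∧ q.1 < q.2.1}) ∈ V) hUs
  simpa using this.symm

lemma isPiSystem_twoTimePredictable :
    IsPiSystem ({s | ∃ (a₁ b₁ a₂ b₂ : ℝ≥0) (A : Set Ω), a₁ ≤ b₁ ∧ b₁ < a₂ ∧ a₂ ≤ b₂ ∧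
        MeasurableSet[𝓕 a₂] A ∧ s = Ioc a₁ b₁ ×ˢ (Ioc a₂ b₂ ×ˢ A)} ∪
      {s | ∃ A : Set Ω, MeasurableSet[𝓕 0] A ∧ s = {0} ×ˢ ({0} ×ˢ A)} :
      Set (Set (ℝ≥0 × ℝ≥0 × Ω))) := by
  rintro _ (⟨a₁, b₁, a₂, b₂, A, h1, h2, h3, hA, rfl⟩ | ⟨A, hA, rfl⟩) _
    (⟨c₁, d₁, c₂, d₂, B, k1, k2, k3, hB, rfl⟩ | ⟨B, hB, rfl⟩) ⟨⟨x, y, ω⟩, hp⟩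
  · simp only [mem_inter_iff, mem_prod, mem_Ioc] at hp
    refine Or.inl ⟨max a₁ c₁, min b₁ d₁, max a₂ c₂, min b₂ d₂, A ∩ B, ?_, ?_, ?_, ?_, ?_⟩
    · exact (max_lt hp.1.1.1 hp.2.1.1).le.trans (le_min hp.1.1.2 hp.2.1.2)
    · exact (min_le_left _ _).trans_lt (h2.trans_le (le_max_left _ _))
    · exact (max_lt hp.1.2.1.1 hp.2.2.1.1).le.trans (le_min hp.1.2.1.2 hp.2.2.1.2)
    · exact (𝓕.mono (le_max_left _ _) _ hA).inter (𝓕.mono (le_max_right _ _) _ hB)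
    · rw [prod_inter_prod, prod_inter_prod, Ioc_inter_Ioc, Ioc_inter_Ioc]
  · simp only [mem_inter_iff, mem_prod, mem_Ioc, mem_singleton_iff] at hp
    exact absurd (hp.2.1 ▸ hp.1.1.1) not_lt_bot
  · simp only [mem_inter_iff, mem_prod, mem_Ioc, mem_singleton_iff] at hp
    exact absurd (hp.1.1 ▸ hp.2.1.1) not_lt_bot
  · exact Or.inr ⟨A ∩ B, hA.inter hB, by simp only [prod_inter_prod, inter_self]⟩

lemma measurable_prodMk_twoTimePredictable (p : ℝ≥0 × Ω) :
    @Measurable _ _ _ (twoTimePredictable 𝓕) fun x : ℝ≥0 => (x, p) :=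
  measurable_prodMk_right.mono le_rfl twoTimePredictable_le_prod

/-- Integrating out the first time of a two-time predictable process against a deterministic
measure gives a predictable process. -/
lemma measurable_lintegral_Ioo_predictable (μ : Measure ℝ≥0) [IsFiniteMeasure μ]
    {f : ℝ≥0 × ℝ≥0 × Ω → ℝ≥0∞} (hf : Measurable[twoTimePredictable 𝓕] f) :
    Measurable[𝓕.predictable] fun p : ℝ≥0 × Ω => ∫⁻ x in Ioo 0 p.1, f (x, p) ∂μ := by
  let κ : ℝ≥0 × Ω → @Measure (ℝ≥0 × ℝ≥0 × Ω) (twoTimePredictable 𝓕) := fun p =>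
    @Measure.map _ _ _ (twoTimePredictable 𝓕) (fun x => (x, p)) (μ.restrict (Ioo 0 p.1))
  have hκf : ∀ p, @IsFiniteMeasure _ (twoTimePredictable 𝓕) (κ p) := fun p =>
    @Measure.isFiniteMeasure_map _ _ (twoTimePredictable 𝓕) _ _ _ _
  have hκ : ∀ p s, MeasurableSet[twoTimePredictable 𝓕] s →
      κ p s = μ (Ioo 0 p.1 ∩ {x | (x, p) ∈ s}) := by
    intro p s hs
    rw [Measure.map_apply (measurable_prodMk_twoTimePredictable p) hs, Measure.restrict_apply
      (measurable_prodMk_twoTimePredictable p hs), inter_comm]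
    rfl
  have key := @measurable_lintegral_of_isPiSystem _ _ 𝓕.predictable (twoTimePredictable 𝓕) κ hκf
    _ rfl isPiSystem_twoTimePredictable ?_ ?_ f hf
  · have heq : ∀ p, @lintegral _ (twoTimePredictable 𝓕) (κ p) f =
        ∫⁻ x in Ioo 0 p.1, f (x, p) ∂μ := fun p =>
      @lintegral_map _ _ _ (twoTimePredictable 𝓕) _ _ _ hf (measurable_prodMk_twoTimePredictable p)
    simp only [heq] at key
    exact key
  · rintro s (⟨a₁, b₁, a₂, b₂, A, h1, h2, h3, hA, rfl⟩ | ⟨A, hA, rfl⟩)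
    -- The gap b₁ < a₂ makes the constraint x < y automatic, so the mass is constant on the
    -- predictable rectangle (a₂, b₂] × A and 0 off it.
    · have : (fun p => κ p (Ioc a₁ b₁ ×ˢ (Ioc a₂ b₂ ×ˢ A))) =
          (Ioc a₂ b₂ ×ˢ A).indicator fun _ => μ (Ioc a₁ b₁) := by
        ext p
        rw [hκ p _ (measurableSet_twoTimePredictable_Ioc_prod h2 hA)]
        by_cases hp : p ∈ Ioc a₂ b₂ ×ˢ A
        · rw [indicator_of_mem hp]
          congr 1
          ext x
          simp only [mem_inter_iff, mem_Ioc, mem_Ioo, mem_ofPred_eq, mem_prod]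
          exact ⟨fun h => h.2.1, fun h => ⟨⟨zero_le.trans_lt h.1,
            h.2.trans_lt (h2.trans hp.1.1)⟩, h, hp⟩⟩
        · rw [indicator_of_notMem hp]
          convert measure_empty (μ := μ)
          ext x
          simp only [mem_inter_iff, mem_Ioo, mem_ofPred_eq, mem_prod, mem_Ioc,
            mem_empty_iff_false, iff_false]
          exact fun h => hp h.2.2
      rw [this]
      exact measurable_const.indicator (measurableSet_predictable_Ioc_prod _ _ hA)
    · have : (fun p => κ p ({0} ×ˢ ({0} ×ˢ A))) = fun _ => 0 := by
        ext p
        rw [hκ p _ (MeasurableSpace.measurableSet_generateFrom (Or.inr ⟨A, hA, rfl⟩))]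
        convert measure_empty (μ := μ)
        ext x
        simp only [mem_inter_iff, mem_Ioo, mem_ofPred_eq, mem_prod, mem_singleton_iff,
          mem_empty_iff_false, iff_false, not_and]
        rintro ⟨h, -⟩ rfl
        exact absurd h not_lt_bot
      rw [this]
      exact measurable_const
  · have : (fun p => κ p univ) = fun p => μ (Ioo 0 p.1) := by
      ext p
      rw [hκ p _ MeasurableSet.univ]
      simp
    rw [this]
    have : Measurable fun t => μ (Ioo 0 t) :=
      Monotone.measurable fun s t hst => measure_mono (Ioo_subset_Ioo_right hst)
    exact this.comp measurable_fst_predictable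

/-- The event that a time `τ`, observed on `E`, has been observed strictly before the current
time, is predictable. -/
lemma measurableSet_predictable_lt {τ : Ω → ℝ≥0} {E : Set Ω}
    (hτ : ∀ s, MeasurableSet[𝓕 s] {ω | τ ω ≤ s ∧ ω ∈ E}) :
    MeasurableSet[𝓕.predictable] {p : ℝ≥0 × Ω | τ p.2 < p.1 ∧ p.2 ∈ E} := by
  let d := TopologicalSpace.denseSeq ℝ≥0
  have : {p : ℝ≥0 × Ω | τ p.2 < p.1 ∧ p.2 ∈ E} =
      ⋃ m : ℕ, Ioi (d m) ×ˢ {ω | τ ω ≤ d m ∧ ω ∈ E} := by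
    ext ⟨y, ω⟩
    simp only [mem_ofPred_eq, mem_iUnion, mem_prod, mem_Ioi]
    constructor
    · rintro ⟨h1, h2⟩
      obtain ⟨m, hm1, hm2⟩ := exists_denseSeq_between h1
      exact ⟨m, hm2, hm1.le, h2⟩
    · rintro ⟨m, h1, h2, h3⟩
      exact ⟨h2.trans_lt h1, h3⟩
  rw [this]
  exact MeasurableSet.iUnion fun m => measurableSet_predictable_Ioi_prod (hτ _)

/-- Evaluating the first time of a two-time predictable process at an observed time. -/
lemma measurable_eval_predictable {τ : Ω → ℝ≥0} {E : Set Ω}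
    (hτ : ∀ s, MeasurableSet[𝓕 s] {ω | τ ω ≤ s ∧ ω ∈ E})
    {f : ℝ≥0 × ℝ≥0 × Ω → ℝ} (hf : Measurable[twoTimePredictable 𝓕] f) :
    Measurable[𝓕.predictable] ({p : ℝ≥0 × Ω | τ p.2 < p.1 ∧ p.2 ∈ E}.indicator
      fun p => (orderedPairs Ω).indicator f (τ p.2, p)) := by
  have hE := measurableSet_predictable_lt hτ
  have hfi : Measurable[twoTimePredictable 𝓕] ((orderedPairs Ω).indicator f) :=
    hf.indicator measurableSet_orderedPairs
  refine measurable_indicator_of_inter hE fun s hs => ?_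
  have key : ∀ S, MeasurableSet[twoTimePredictable 𝓕] S → MeasurableSet[𝓕.predictable]
      ({p : ℝ≥0 × Ω | τ p.2 < p.1 ∧ p.2 ∈ E} ∩ {p | (τ p.2, p) ∈ S}) := by
    intro S hS
    induction S, hS using MeasurableSpace.generateFrom_induction with
    | hC S hS _ =>
      obtain ⟨a₁, b₁, a₂, b₂, A, h1, h2, h3, hA, rfl⟩ | ⟨A, hA, rfl⟩ := hS
      -- On a generator the condition on τ is {a₁ < τ ≤ b₁} ∩ E, which lies in 𝓕 b₁ and hence in 𝓕
      -- a₂. The inequality τ < y is implied by τ ≤ b₁ < a₂ < y.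
      · have : ({p : ℝ≥0 × Ω | τ p.2 < p.1 ∧ p.2 ∈ E} ∩
            {p | (τ p.2, p) ∈ Ioc a₁ b₁ ×ˢ (Ioc a₂ b₂ ×ˢ A)}) =
            Ioc a₂ b₂ ×ˢ (A ∩ ({ω | τ ω ≤ b₁ ∧ ω ∈ E} \ {ω | τ ω ≤ a₁ ∧ ω ∈ E})) := by
          ext ⟨y, ω⟩
          simp only [mem_inter_iff, mem_ofPred_eq, mem_prod, mem_Ioc, mem_sdiff, not_and]
          constructor
          · rintro ⟨⟨k1, k2⟩, k3, k4, k5⟩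
            exact ⟨k4, k5, ⟨k3.2, k2⟩, fun h => absurd k3.1 (not_lt.2 h)⟩
          · rintro ⟨k1, k2, ⟨k3, k4⟩, k5⟩
            exact ⟨⟨k3.trans_lt (h2.trans k1.1), k4⟩, ⟨not_le.1 fun h => k5 h k4, k3⟩, k1, k2⟩
        rw [this]
        refine measurableSet_predictable_Ioc_prod _ _ (hA.inter ?_)
        exact (𝓕.mono h2.le _ (hτ _)).diff (𝓕.mono (h1.trans h2.le) _ (hτ _))
      · convert @MeasurableSet.empty _ 𝓕.predictable
        ext ⟨y, ω⟩
        simp only [mem_inter_iff, mem_ofPred_eq, mem_prod, mem_singleton_iff,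
          mem_empty_iff_false, iff_false]
        rintro ⟨⟨k1, -⟩, k2, k3, -⟩
        rw [k2, k3] at k1
        exact lt_irrefl _ k1
    | empty => simp
    | compl S _ ih =>
      convert MeasurableSet.diff hE ih using 1
      ext p
      simp only [mem_inter_iff, mem_ofPred_eq, mem_compl_iff, mem_sdiff]
      tauto
    | iUnion s _ ih =>
      convert MeasurableSet.iUnion ih using 1
      ext p
      simp
  exact key _ (hfi hs)

end Predictable

/-! ### The hazard measure -/

section Hazard

variable {F : Measure ℝ≥0}

lemma measurable_measure_Ici (F : Measure ℝ≥0) : Measurable fun y => F (Ici y) :=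
  Antitone.measurable fun _ _ h => measure_mono (Ici_subset_Ici.2 h)

lemma hazard_eq (hF : F {0} = 0) : hazard F = F.withDensity fun t => (F (Ici t))⁻¹ := by
  rw [hazard]
  congr 1
  rw [← Measure.restrict_add_restrict_compl (μ := F) (measurableSet_Ioi (a := (0 : ℝ≥0)))]
  have : (Ioi (0 : ℝ≥0))ᶜ = {0} := by
    ext x; simp
  rw [this, Measure.restrict_zero_set hF]
  simp

instance [IsFiniteMeasure F] : SFinite (hazard F) := by
  rw [hazard]; infer_instance

lemma hazard_zero (F : Measure ℝ≥0) : hazard F {0} = 0 :=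
  withDensity_absolutelyContinuous _ _ (by simp)

lemma lintegral_hazard (hF : F {0} = 0) {g : ℝ≥0 → ℝ≥0∞} (hg : Measurable g) :
    ∫⁻ y, g y ∂(hazard F) = ∫⁻ y, (F (Ici y))⁻¹ * g y ∂F := by
  have h := (measurable_measure_Ici F).inv
  rw [hazard_eq hF]
  exact lintegral_withDensity_eq_lintegral_mul _ h hg

lemma setLIntegral_hazard (hF : F {0} = 0) {g : ℝ≥0 → ℝ≥0∞} (hg : Measurable g) {s : Set ℝ≥0}
    (hs : MeasurableSet s) :
    ∫⁻ y in s, g y ∂(hazard F) = ∫⁻ y in s, (F (Ici y))⁻¹ * g y ∂F := by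
  have h := (measurable_measure_Ici F).inv
  rw [hazard_eq hF]
  exact setLIntegral_withDensity_eq_setLIntegral_mul _ h hg hs

lemma hazard_singleton (hF : F {0} = 0) (y : ℝ≥0) : hazard F {y} = F {y} * (F (Ici y))⁻¹ := by
  rw [hazard_eq hF, withDensity_apply _ (measurableSet_singleton y), lintegral_singleton, mul_comm]

lemma measurable_measure_singleton [IsFiniteMeasure F] : Measurable fun y => F {y} := by
  have : (fun y => F {y}) = fun y => F (Ici y) - F (Ioi y) := by
    ext y
    rw [← measure_sdiff (Ioi_subset_Ici_self) measurableSet_Ioi.nullMeasurableSet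
      (measure_ne_top _ _), Ici_sdiff_Ioi_same]
  rw [this]
  exact (measurable_measure_Ici F).sub
    (Antitone.measurable fun _ _ h => measure_mono (Ioi_subset_Ioi h))

lemma measurable_hazard_singleton [IsFiniteMeasure F] (hF : F {0} = 0) :
    Measurable fun y => hazard F {y} := by
  simp_rw [hazard_singleton hF]
  exact measurable_measure_singleton.mul (measurable_measure_Ici F).inv

lemma hazard_singleton_le_one (hF : F {0} = 0) (y : ℝ≥0) : hazard F {y} ≤ 1 := by
  rw [hazard_singleton hF, ← div_eq_mul_inv]
  exact ENNReal.div_le_of_le_mul (by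
    rw [one_mul]; exact measure_mono (singleton_subset_iff.2 self_mem_Ici))

/-- Almost every time has a positive chance of being survived up to. -/
lemma ae_measure_Ici_ne_zero (F : Measure ℝ≥0) : ∀ᵐ y ∂F, F (Ici y) ≠ 0 := by
  rw [ae_iff]
  simp only [ne_eq, not_not]
  let d := TopologicalSpace.denseSeq ℝ≥0
  -- The times with F([y,∞)) = 0 form an up-set. Countably many null half-lines starting at dense
  -- points cover it, except possibly for its least element, which is handled by its own null
  -- half-line.
  have hsub : {y | F (Ici y) = 0} ⊆
      (⋃ (m : ℕ) (_ : F (Ici (d m)) = 0), Ici (d m)) ∪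
        {y | F (Ici y) = 0 ∧ ∀ z, F (Ici z) = 0 → y ≤ z} := by
    intro y hy
    by_cases h : ∀ z, F (Ici z) = 0 → y ≤ z
    · exact Or.inr ⟨hy, h⟩
    · push Not at h
      obtain ⟨z, hz, hzy⟩ := h
      obtain ⟨m, hm1, hm2⟩ := exists_denseSeq_between hzy
      refine Or.inl ?_
      simp only [mem_iUnion, exists_prop]
      exact ⟨m, measure_mono_null (Ici_subset_Ici.2 hm1.le) hz, hm2.le⟩
  refine measure_mono_null hsub (measure_union_null ?_ ?_)
  · exact measure_iUnion_null fun m => measure_iUnion_null fun hm => hm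
  · by_cases h : ∃ y, F (Ici y) = 0 ∧ ∀ z, F (Ici z) = 0 → y ≤ z
    · obtain ⟨y, hy, hy2⟩ := h
      refine measure_mono_null (fun z hz => ?_) hy
      exact hy2 z hz.1
    · convert measure_empty (μ := F)
      ext y
      simp only [mem_ofPred_eq, mem_empty_iff_false, iff_false]
      exact fun hy => h ⟨y, hy⟩

end Hazard

/-! ### Signed differences of an atomic and a general measure -/

/-- Since μ lives on the finite set `A`, the density of μ - ν with respect to μ + ν is -1 off `A`.
On `A` it is the quotient of difference and sum of the atoms, as ν may have atoms there too; `hon`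
states this without division. -/
lemma setIntegral_add_of_finset {X : Type*} [MeasurableSpace X] [MeasurableSingletonClass X]
    {μ ν : Measure X} [IsFiniteMeasure μ] [IsFiniteMeasure ν] (A : Finset X)
    (hA : μ (A : Set X)ᶜ = 0) {ρ : X → ℝ} (hρi : Integrable ρ (μ + ν))
    (hoff : ∀ x ∉ A, ρ x = -1)
    (hon : ∀ x ∈ A, ρ x * (μ.real {x} + ν.real {x}) = μ.real {x} - ν.real {x})
    {s : Set X} (hs : MeasurableSet s) :
    ∫ x in s, ρ x ∂(μ + ν) = μ.real s - ν.real s := by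
  classical
  have hAm : MeasurableSet (A : Set X) := A.measurableSet
  rw [← integral_inter_add_sdiff hAm hρi.integrableOn]
  have h1 : ∫ x in s \ A, ρ x ∂(μ + ν) = - ν.real (s \ A) := by
    rw [setIntegral_congr_fun (g := fun _ => (-1 : ℝ)) (hs.diff hAm) fun x hx =>
      hoff x (by simpa using hx.2)]
    have : μ (s \ A) = 0 := measure_mono_null (fun x hx => hx.2) hA
    simp [measureReal_def, this]
  have h2 : s ∩ A = ((A.filter (· ∈ s) : Finset X) : Set X) := by
    ext x; simp [and_comm]
  have h3 : ∫ x in s ∩ A, ρ x ∂(μ + ν) = μ.real (s ∩ A) - ν.real (s ∩ A) := by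
    rw [h2, setIntegral_finset _ hρi.integrableOn, ← sum_measureReal_singleton,
      ← sum_measureReal_singleton, ← Finset.sum_sub_distrib]
    refine Finset.sum_congr rfl fun x hx => ?_
    rw [← hon x (Finset.mem_filter.1 hx).1, measureReal_add_apply, smul_eq_mul, mul_comm]
  have h4 : μ.real s = μ.real (s ∩ A) := by
    rw [← measureReal_inter_add_sdiff hAm (s := s)]
    have : μ (s \ A) = 0 := measure_mono_null (fun x hx => hx.2) hA
    simp [measureReal_def, this]
  rw [h1, h3, h4, ← measureReal_inter_add_sdiff (μ := ν) hAm (s := s)]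
  ring

/-! ### The path measures of the data -/

section Data

variable {Ω : Type*} {mΩ : MeasurableSpace Ω} {n : ℕ} {F : Measure ℝ≥0} {T C : Fin n → Ω → ℝ≥0}

lemma measurable_obsTime (hT : ∀ i, Measurable (T i)) (hC : ∀ i, Measurable (C i)) (i : Fin n) :
    Measurable (obsTime T C i) := (hT i).min (hC i)

lemma measurableSet_uncensored (hT : ∀ i, Measurable (T i)) (hC : ∀ i, Measurable (C i))
    (i : Fin n) : MeasurableSet {ω | T i ω ≤ C i ω} := measurableSet_le (hT i) (hC i)

lemma lintegral_countingMeasure (ω : Ω) (g : ℝ≥0 → ℝ≥0∞) :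
    ∫⁻ y, g y ∂(countingMeasure T C ω) =
      ∑ i, if T i ω ≤ C i ω then g (obsTime T C i ω) else 0 := by
  rw [countingMeasure, lintegral_finsetSum_measure]
  refine Finset.sum_congr rfl fun i _ => ?_
  split_ifs <;> simp

/-- Y is the sum of the indicators of [0, X_i]. The split into individual compensators lets the
compensation formula be applied one observation at a time. -/
lemma compensatorMeasure_eq (F : Measure ℝ≥0) (T C : Fin n → Ω → ℝ≥0) (ω : Ω) :
    compensatorMeasure F T C ω = ∑ i, (hazard F).restrict (Iic (obsTime T C i ω)) := by
  ext s hs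
  rw [compensatorMeasure, withDensity_apply _ hs, Measure.finsetSum_apply]
  have : ∀ y, (atRisk T C y ω : ℝ≥0∞) =
      ∑ i, (Iic (obsTime T C i ω)).indicator (fun _ => (1 : ℝ≥0∞)) y := by
    intro y
    simp only [atRisk, Nat.cast_sum]
    refine Finset.sum_congr rfl fun i _ => ?_
    by_cases h : y ≤ obsTime T C i ω <;> simp [h]
  simp_rw [this]
  rw [lintegral_finsetSum _ fun i _ => measurable_const.indicator measurableSet_Iic]
  refine Finset.sum_congr rfl fun i _ => ?_
  rw [lintegral_indicator_const measurableSet_Iic, one_mul, Measure.restrict_apply measurableSet_Iic,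
    Measure.restrict_apply hs, inter_comm]

lemma lintegral_compensatorMeasure (F : Measure ℝ≥0) (T C : Fin n → Ω → ℝ≥0) (ω : Ω)
    (g : ℝ≥0 → ℝ≥0∞) :
    ∫⁻ y, g y ∂(compensatorMeasure F T C ω) =
      ∑ i, ∫⁻ y in Iic (obsTime T C i ω), g y ∂(hazard F) := by
  rw [compensatorMeasure_eq, lintegral_finsetSum_measure]

lemma measurable_atRisk (hT : ∀ i, Measurable (T i)) (hC : ∀ i, Measurable (C i)) :
    Measurable fun p : Ω × ℝ≥0 => atRisk T C p.2 p.1 := by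
  unfold atRisk
  refine Finset.measurable_sum _ fun i _ => Measurable.ite ?_ measurable_const measurable_const
  exact measurableSet_le measurable_snd ((measurable_obsTime hT hC i).comp measurable_fst)

/-- The measures `dN` as a kernel. -/
def countingKernel (hT : ∀ i, Measurable (T i)) (hC : ∀ i, Measurable (C i)) : Kernel Ω ℝ≥0 where
  toFun := countingMeasure T C
  measurable' := by
    refine Measure.measurable_of_measurable_coe _ fun s hs => ?_
    simp_rw [← lintegral_indicator_one hs, lintegral_countingMeasure]
    refine Finset.measurable_sum _ fun i _ => Measurable.ite (measurableSet_uncensored hT hC i) ?_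
      measurable_const
    exact (measurable_one.indicator hs).comp (measurable_obsTime hT hC i)

instance (hT : ∀ i, Measurable (T i)) (hC : ∀ i, Measurable (C i)) :
    IsFiniteKernel (countingKernel hT hC) := by
  refine ⟨n, by simp, fun ω => ?_⟩
  change countingMeasure T C ω univ ≤ n
  rw [← lintegral_one, lintegral_countingMeasure]
  calc _ ≤ ∑ _i : Fin n, (1 : ℝ≥0∞) := Finset.sum_le_sum fun i _ => by split_ifs <;> simp
    _ = n := by simp

lemma countingMeasure_univ_le (T C : Fin n → Ω → ℝ≥0) (ω : Ω) :
    countingMeasure T C ω univ ≤ n := by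
  rw [← lintegral_one, lintegral_countingMeasure]
  calc _ ≤ ∑ _i : Fin n, (1 : ℝ≥0∞) := Finset.sum_le_sum fun i _ => by split_ifs <;> simp
    _ = n := by simp

/-- The measures `Y dΛ` as a kernel. -/
def compensatorKernel (mΩ : MeasurableSpace Ω) (F : Measure ℝ≥0) [IsFiniteMeasure F]
    (T C : Fin n → Ω → ℝ≥0) : Kernel Ω ℝ≥0 :=
  (Kernel.const Ω (hazard F)).withDensity fun ω y => (atRisk T C y ω : ℝ≥0∞)

instance [IsFiniteMeasure F] : IsSFiniteKernel (compensatorKernel mΩ F T C) :=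
  Kernel.IsSFiniteKernel.withDensity _ fun _ _ => ENNReal.natCast_ne_top _

lemma compensatorKernel_apply [IsFiniteMeasure F] (hT : ∀ i, Measurable (T i))
    (hC : ∀ i, Measurable (C i)) (ω : Ω) :
    compensatorKernel mΩ F T C ω = compensatorMeasure F T C ω := by
  rw [compensatorKernel, Kernel.withDensity_apply]
  · rfl
  · exact (measurable_from_top (f := fun k : ℕ => (k : ℝ≥0∞))).comp (measurable_atRisk hT hC)

/-- The paths on which `Y dΛ` is finite. -/
def finitePaths (F : Measure ℝ≥0) (T C : Fin n → Ω → ℝ≥0) : Set Ω :=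
  {ω | IsFiniteMeasure (compensatorMeasure F T C ω)}

lemma measurableSet_finitePaths [IsFiniteMeasure F] (hT : ∀ i, Measurable (T i))
    (hC : ∀ i, Measurable (C i)) : MeasurableSet (finitePaths F T C) := by
  have : finitePaths F T C = {ω | compensatorKernel mΩ F T C ω univ < ∞} := by
    ext ω
    simp only [finitePaths, mem_ofPred_eq, compensatorKernel_apply hT hC]
    exact isFiniteMeasure_iff _
  rw [this]
  exact measurableSet_lt (Kernel.measurable_coe _ MeasurableSet.univ) measurable_const

open Classical in
/-- The dominating measures `dN + Y dΛ` (`0` on the exceptional paths), as a kernel. -/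
def baseKernel (F : Measure ℝ≥0) [IsFiniteMeasure F] (hT : ∀ i, Measurable (T i))
    (hC : ∀ i, Measurable (C i)) : Kernel Ω ℝ≥0 :=
  Kernel.piecewise (measurableSet_finitePaths (F := F) hT hC)
    (countingKernel hT hC + compensatorKernel mΩ F T C) 0

instance [IsFiniteMeasure F] (hT : ∀ i, Measurable (T i)) (hC : ∀ i, Measurable (C i)) :
    IsSFiniteKernel (baseKernel F hT hC) := by
  classical
  unfold baseKernel; infer_instance

lemma baseKernel_of_mem [IsFiniteMeasure F] (hT : ∀ i, Measurable (T i))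
    (hC : ∀ i, Measurable (C i)) {ω : Ω} (hω : ω ∈ finitePaths F T C) :
    baseKernel F hT hC ω = countingMeasure T C ω + compensatorMeasure F T C ω := by
  classical
  rw [baseKernel, Kernel.piecewise_apply, if_pos hω, ← compensatorKernel_apply hT hC]
  rfl

lemma baseKernel_of_notMem [IsFiniteMeasure F] (hT : ∀ i, Measurable (T i))
    (hC : ∀ i, Measurable (C i)) {ω : Ω} (hω : ω ∉ finitePaths F T C) :
    baseKernel F hT hC ω = 0 := by
  classical
  rw [baseKernel, Kernel.piecewise_apply, if_neg hω]
  rfl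

instance [IsFiniteMeasure F] (hT : ∀ i, Measurable (T i)) (hC : ∀ i, Measurable (C i)) (ω : Ω) :
    IsFiniteMeasure (baseKernel F hT hC ω) := by
  by_cases hω : ω ∈ finitePaths F T C
  · rw [baseKernel_of_mem hT hC hω]
    have : IsFiniteMeasure (compensatorMeasure F T C ω) := hω
    infer_instance
  · rw [baseKernel_of_notMem hT hC hω]
    infer_instance

/-- The jump at `y` of the individual martingale with index `i`. -/
def jumpAt (F : Measure ℝ≥0) (T C : Fin n → Ω → ℝ≥0) (i : Fin n) (y : ℝ≥0) (ω : Ω) : ℝ :=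
  (if obsTime T C i ω = y ∧ T i ω ≤ C i ω then 1 else 0) -
    (hazard F {y}).toReal * (if y ≤ obsTime T C i ω then 1 else 0)

/-- The number of uncensored observations at `y`. -/
def atomCount (T C : Fin n → Ω → ℝ≥0) (y : ℝ≥0) (ω : Ω) : ℕ :=
  ∑ i, if obsTime T C i ω = y ∧ T i ω ≤ C i ω then 1 else 0

open Classical in
/-- The density of `dM` with respect to `dN + Y dΛ`. -/
def signDensity (F : Measure ℝ≥0) (T C : Fin n → Ω → ℝ≥0) (y : ℝ≥0) (ω : Ω) : ℝ :=
  -- With no uncensored observation at `y` the quotient below would be 0/0 wherever Y ΔΛ vanishes,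
  -- while the density of dM there is -1.
  if atomCount T C y ω = 0 then -1 else
    (atomCount T C y ω - (hazard F {y}).toReal * atRisk T C y ω) /
      (atomCount T C y ω + (hazard F {y}).toReal * atRisk T C y ω)

lemma measurable_jumpAt [IsFiniteMeasure F] (hF : F {0} = 0) (hT : ∀ i, Measurable (T i))
    (hC : ∀ i, Measurable (C i)) (i : Fin n) :
    Measurable fun p : ℝ≥0 × Ω => jumpAt F T C i p.1 p.2 := by
  unfold jumpAt
  have hX : Measurable fun p : ℝ≥0 × Ω => obsTime T C i p.2 :=
    (measurable_obsTime hT hC i).comp measurable_snd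
  refine (Measurable.ite ?_ measurable_const measurable_const).sub
    (((measurable_hazard_singleton hF).comp measurable_fst).ennreal_toReal.mul
      (Measurable.ite (measurableSet_le measurable_fst hX) measurable_const measurable_const))
  exact (measurableSet_eq_fun hX measurable_fst).inter
    ((measurableSet_uncensored hT hC i).preimage measurable_snd)

lemma measurable_atomCount (hT : ∀ i, Measurable (T i)) (hC : ∀ i, Measurable (C i)) :
    Measurable fun p : ℝ≥0 × Ω => atomCount T C p.1 p.2 := by
  unfold atomCount
  refine Finset.measurable_sum _ fun i _ => Measurable.ite ?_ measurable_const measurable_const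
  have hX : Measurable fun p : ℝ≥0 × Ω => obsTime T C i p.2 :=
    (measurable_obsTime hT hC i).comp measurable_snd
  exact (measurableSet_eq_fun hX measurable_fst).inter
    ((measurableSet_uncensored hT hC i).preimage measurable_snd)

lemma measurable_signDensity [IsFiniteMeasure F] (hF : F {0} = 0) (hT : ∀ i, Measurable (T i))
    (hC : ∀ i, Measurable (C i)) :
    Measurable fun p : ℝ≥0 × Ω => signDensity F T C p.1 p.2 := by
  unfold signDensity
  have hN := measurable_atomCount hT hC
  have hN' : Measurable fun p : ℝ≥0 × Ω => (atomCount T C p.1 p.2 : ℝ) :=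
    (measurable_from_top (f := fun k : ℕ => (k : ℝ))).comp hN
  have hA : Measurable fun p : ℝ≥0 × Ω => (hazard F {p.1}).toReal * (atRisk T C p.1 p.2 : ℝ) :=
    (((measurable_hazard_singleton hF).comp measurable_fst).ennreal_toReal).mul
      ((measurable_from_top (f := fun k : ℕ => (k : ℝ))).comp
        ((measurable_atRisk hT hC).comp measurable_swap))
  exact Measurable.ite (hN (measurableSet_singleton 0)) measurable_const
    ((hN'.sub hA).div (hN'.add hA))

lemma abs_signDensity_le (F : Measure ℝ≥0) (T C : Fin n → Ω → ℝ≥0) (y : ℝ≥0) (ω : Ω) :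
    |signDensity F T C y ω| ≤ 1 := by
  unfold signDensity
  split_ifs
  · simp
  · have h1 : (0 : ℝ) ≤ atomCount T C y ω := Nat.cast_nonneg _
    have h2 : 0 ≤ (hazard F {y}).toReal * (atRisk T C y ω : ℝ) := by positivity
    rw [abs_div, abs_of_nonneg (add_nonneg h1 h2)]
    refine div_le_one_of_le₀ ?_ (add_nonneg h1 h2)
    rw [abs_le]
    constructor <;> linarith

lemma countingMeasure_singleton (ω : Ω) (y : ℝ≥0) :
    (countingMeasure T C ω).real {y} = atomCount T C y ω := by
  have : countingMeasure T C ω {y} = (atomCount T C y ω : ℝ≥0∞) := by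
    rw [← lintegral_indicator_one (measurableSet_singleton y), lintegral_countingMeasure, atomCount,
      Nat.cast_sum]
    refine Finset.sum_congr rfl fun i _ => ?_
    by_cases h1 : T i ω ≤ C i ω <;> by_cases h2 : obsTime T C i ω = y <;> simp [h1, h2]
  simp [measureReal_def, this]

lemma compensatorMeasure_singleton (ω : Ω) (y : ℝ≥0) :
    (compensatorMeasure F T C ω).real {y} = (hazard F {y}).toReal * atRisk T C y ω := by
  rw [measureReal_def, compensatorMeasure, withDensity_apply _ (measurableSet_singleton y),
    lintegral_singleton, ENNReal.toReal_mul, mul_comm]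
  simp

lemma sum_jumpAt (y : ℝ≥0) (ω : Ω) :
    ∑ i, jumpAt F T C i y ω = atomCount T C y ω - (hazard F {y}).toReal * atRisk T C y ω := by
  simp only [jumpAt, Finset.sum_sub_distrib, ← Finset.mul_sum, atomCount, atRisk, Nat.cast_sum]
  congr 1
  · refine Finset.sum_congr rfl fun i _ => ?_
    split_ifs <;> simp
  · congr 1
    refine Finset.sum_congr rfl fun i _ => ?_
    split_ifs <;> simp

lemma integrable_signDensity [IsFiniteMeasure F] (hF : F {0} = 0) (hT : ∀ i, Measurable (T i))
    (hC : ∀ i, Measurable (C i)) (μ : Measure ℝ≥0) [IsFiniteMeasure μ] (ω : Ω) :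
    Integrable (fun y => signDensity F T C y ω) μ :=
  Integrable.of_bound ((measurable_signDensity hF hT hC).comp
    measurable_prodMk_right).aestronglyMeasurable 1
    (ae_of_all _ fun y => abs_signDensity_le F T C y ω)

/-- `dM` has the density `signDensity` with respect to `dN + Y dΛ`. -/
lemma setIntegral_signDensity [IsFiniteMeasure F] (hF : F {0} = 0) (hT : ∀ i, Measurable (T i))
    (hC : ∀ i, Measurable (C i)) {ω : Ω} (hω : ω ∈ finitePaths F T C) {s : Set ℝ≥0}
    (hs : MeasurableSet s) :
    ∫ y in s, signDensity F T C y ω ∂(baseKernel F hT hC ω) =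
      (countingMeasure T C ω).real s - (compensatorMeasure F T C ω).real s := by
  classical
  have : IsFiniteMeasure (compensatorMeasure F T C ω) := hω
  rw [baseKernel_of_mem hT hC hω]
  have hmem : ∀ y, y ∈ (Finset.univ.filter fun i => T i ω ≤ C i ω).image
      (fun i => obsTime T C i ω) ↔ atomCount T C y ω ≠ 0 := by
    intro y
    simp only [atomCount, Finset.mem_image, Finset.mem_filter, Finset.mem_univ, true_and, ne_eq,
      Finset.sum_eq_zero_iff, not_forall]
    refine exists_congr fun i => ?_
    by_cases h1 : T i ω ≤ C i ω <;> by_cases h2 : obsTime T C i ω = y <;> simp [h1, h2]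
  refine setIntegral_add_of_finset
    ((Finset.univ.filter fun i => T i ω ≤ C i ω).image (fun i => obsTime T C i ω)) ?_
    (integrable_signDensity hF hT hC _ ω) ?_ ?_ hs
  · have hm : MeasurableSet (((Finset.univ.filter fun i => T i ω ≤ C i ω).image
        (fun i => obsTime T C i ω) : Finset ℝ≥0) : Set ℝ≥0)ᶜ := (Finset.measurableSet _).compl
    rw [← lintegral_indicator_one hm, lintegral_countingMeasure]
    refine Finset.sum_eq_zero fun i _ => ?_
    split_ifs with h
    · rw [indicator_of_notMem]
      simp only [mem_compl_iff, not_not, Finset.mem_coe]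
      exact Finset.mem_image_of_mem _ (by simpa using h)
    · rfl
  · intro y hy
    rw [hmem, not_not] at hy
    simp [signDensity, hy]
  · intro y hy
    rw [hmem] at hy
    rw [countingMeasure_singleton, compensatorMeasure_singleton, signDensity, if_neg hy]
    refine div_mul_cancel₀ _ (ne_of_gt ?_)
    have : (0 : ℝ) < atomCount T C y ω := Nat.cast_pos.2 (Nat.pos_of_ne_zero hy)
    positivity

/-- On exceptional paths both sides are 0, so the identity holds for every ω. It turns
vector-measure integrals along paths into Bochner integrals against a kernel. -/
lemma dM_eq [IsFiniteMeasure F] (hF : F {0} = 0) (hT : ∀ i, Measurable (T i))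
    (hC : ∀ i, Measurable (C i)) (ω : Ω) :
    dM F T C ω = (baseKernel F hT hC ω).withDensityᵥ fun y => signDensity F T C y ω := by
  by_cases hω : ω ∈ finitePaths F T C
  · ext s hs
    have : IsFiniteMeasure (compensatorMeasure F T C ω) := hω
    rw [withDensityᵥ_apply (integrable_signDensity hF hT hC _ ω) hs,
      setIntegral_signDensity hF hT hC hω hs, dM, dif_pos this]
    simp [Measure.toSignedMeasure_apply_measurable hs]
  · have h : ¬ IsFiniteMeasure (compensatorMeasure F T C ω) := hω
    rw [baseKernel_of_notMem hT hC hω, dM, dif_neg h]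
    ext s hs
    rw [withDensityᵥ_apply (integrable_signDensity hF hT hC _ ω) hs]
    simp

lemma variation_dM [IsFiniteMeasure F] (hF : F {0} = 0) (hT : ∀ i, Measurable (T i))
    (hC : ∀ i, Measurable (C i)) (ω : Ω) :
    (dM F T C ω).variation =
      (baseKernel F hT hC ω).withDensity fun y => ‖signDensity F T C y ω‖ₑ := by
  rw [dM_eq hF hT hC, Measure.variation_withDensityᵥ (integrable_signDensity hF hT hC _ ω)]

end Data

/-! ### Independence and the compensation formula -/

section Compensation

set_option linter.unusedSectionVars false

variable {Ω : Type*} {mΩ : MeasurableSpace Ω} {n : ℕ}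

/-- A sample of survival times with law `F` and censoring times with law `G`. -/
structure IsSample (P : Measure Ω) (F G : Measure ℝ≥0) (T C : Fin n → Ω → ℝ≥0) : Prop where
  hF : F {0} = 0
  hG : G {0} = 0
  hT : ∀ i, Measurable (T i)
  hC : ∀ i, Measurable (C i)
  hTF : ∀ i, P.map (T i) = F
  hCG : ∀ i, P.map (C i) = G
  hTind : iIndepFun T P
  hCind : iIndepFun C P
  hTC : IndepFun (fun ω i => T i ω) (fun ω i => C i ω) P

variable {P : Measure Ω} [IsProbabilityMeasure P] {F G : Measure ℝ≥0} [IsProbabilityMeasure F]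
  [IsProbabilityMeasure G] {T C : Fin n → Ω → ℝ≥0}

lemma IsSample.map_pair (hS : IsSample P F G T C) (j : Fin n) :
    P.map (fun ω => (T j ω, C j ω)) = F.prod G := by
  have h : IndepFun (T j) (C j) P :=
    hS.hTC.comp (measurable_pi_apply j) (measurable_pi_apply j)
  rw [(indepFun_iff_map_prod_eq_prod_map_map (hS.hT j).aemeasurable (hS.hC j).aemeasurable).1 h,
    hS.hTF, hS.hCG]

/-- The three independence hypotheses give the joint law (⊗F) ⊗ (⊗G), and regrouping coordinates
turns it into ⊗(F ⊗ G). -/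
lemma IsSample.iIndepFun_pair (hS : IsSample P F G T C) :
    iIndepFun (fun i ω => (T i ω, C i ω)) P := by
  have hTm : Measurable fun ω i => T i ω := measurable_pi_lambda _ hS.hT
  have hCm : Measurable fun ω i => C i ω := measurable_pi_lambda _ hS.hC
  rw [iIndepFun_iff_map_fun_eq_pi_map fun i => ((hS.hT i).prodMk (hS.hC i)).aemeasurable]
  simp_rw [hS.map_pair]
  have h1 := (indepFun_iff_map_prod_eq_prod_map_map hTm.aemeasurable hCm.aemeasurable).1 hS.hTC
  rw [hS.hTind.map_fun_eq_pi_map fun i => (hS.hT i).aemeasurable,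
    hS.hCind.map_fun_eq_pi_map fun i => (hS.hC i).aemeasurable] at h1
  simp_rw [hS.hTF, hS.hCG] at h1
  have h2 := measurePreserving_arrowProdEquivProdArrow ℝ≥0 ℝ≥0 (Fin n) (fun _ => F) (fun _ => G)
  rw [← h2.symm.map_eq, ← h1, Measure.map_map (MeasurableEquiv.measurable _) (hTm.prodMk hCm)]
  rfl

/-- The observations other than the one with index `j`. -/
def others (T C : Fin n → Ω → ℝ≥0) (j : Fin n) (ω : Ω) (i : ({j}ᶜ : Finset (Fin n))) :
    ℝ≥0 × ℝ≥0 := (T i ω, C i ω)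

lemma IsSample.measurable_others (hS : IsSample P F G T C) (j : Fin n) :
    Measurable (others T C j) :=
  measurable_pi_lambda _ fun i => (hS.hT i).prodMk (hS.hC i)

lemma IsSample.map_pair_others (hS : IsSample P F G T C) (j : Fin n) :
    P.map (fun ω => ((T j ω, C j ω), others T C j ω)) = (F.prod G).prod (P.map (others T C j)) := by
  have h := hS.iIndepFun_pair.indepFun_finset {j} {j}ᶜ disjoint_compl_right
    fun i => (hS.hT i).prodMk (hS.hC i)
  have h2 : IndepFun (fun ω => (T j ω, C j ω)) (others T C j) P :=
    h.comp (φ := fun z => z ⟨j, by simp⟩) (measurable_pi_apply _) measurable_id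
  rw [(indepFun_iff_map_prod_eq_prod_map_map ((hS.hT j).prodMk (hS.hC j)).aemeasurable
    (hS.measurable_others j).aemeasurable).1 h2, hS.map_pair]

lemma IsSample.ae_obsTime_pos (hS : IsSample P F G T C) (j : Fin n) :
    ∀ᵐ ω ∂P, 0 < obsTime T C j ω := by
  have h1 : ∀ᵐ ω ∂P, T j ω ≠ 0 := by
    have : ∀ᵐ t ∂(P.map (T j)), t ≠ 0 := by
      rw [hS.hTF, ae_iff]; simpa using hS.hF
    exact ae_of_ae_map (hS.hT j).aemeasurable this
  have h2 : ∀ᵐ ω ∂P, C j ω ≠ 0 := by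
    have : ∀ᵐ t ∂(P.map (C j)), t ≠ 0 := by
      rw [hS.hCG, ae_iff]; simpa using hS.hG
    exact ae_of_ae_map (hS.hC j).aemeasurable this
  filter_upwards [h1, h2] with ω h1 h2
  exact lt_min (pos_iff_ne_zero.2 h1) (pos_iff_ne_zero.2 h2)

lemma measurableSet_Iic_min :
    MeasurableSet {q : (ℝ≥0 × ℝ≥0) × ℝ≥0 | q.2 ≤ min q.1.1 q.1.2} :=
  measurableSet_le measurable_snd
    ((measurable_fst.comp measurable_fst).min (measurable_snd.comp measurable_fst))

/-- The compensation formula for one observation and a deterministic integrand. -/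
lemma lintegral_prod_compensation (hF : F {0} = 0) {k : ℝ≥0 → ℝ≥0∞} (hk : Measurable k) :
    ∫⁻ p, (if p.1 ≤ p.2 then k p.1 else 0) ∂(F.prod G) =
      ∫⁻ p, ∫⁻ y in Iic (min p.1 p.2), k y ∂(hazard F) ∂(F.prod G) := by
  -- Both sides equal ∫ k(t) G([t,∞)) dF(t). On the right, Tonelli produces the probability F([y,∞))
  -- G([y,∞)) of being at risk at y, and the first factor cancels against the density of Λ.
  have h1 : ∫⁻ p, (if p.1 ≤ p.2 then k p.1 else 0) ∂(F.prod G) =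
      ∫⁻ t, k t * G (Ici t) ∂F := by
    have hm : Measurable fun p : ℝ≥0 × ℝ≥0 => if p.1 ≤ p.2 then k p.1 else 0 :=
      Measurable.ite (measurableSet_le measurable_fst measurable_snd)
        (hk.comp measurable_fst) measurable_const
    rw [lintegral_prod _ hm.aemeasurable]
    refine lintegral_congr fun t => ?_
    rw [← lintegral_indicator_const measurableSet_Ici]
    refine lintegral_congr fun c => ?_
    simp [indicator_apply]
  have h2 : ∀ p : ℝ≥0 × ℝ≥0, ∫⁻ y in Iic (min p.1 p.2), k y ∂(hazard F) =
      ∫⁻ y, {q : (ℝ≥0 × ℝ≥0) × ℝ≥0 | q.2 ≤ min q.1.1 q.1.2}.indicator (fun q => k q.2) (p, y)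
        ∂(hazard F) := by
    intro p
    rw [← lintegral_indicator measurableSet_Iic]
    rfl
  have hm : Measurable ({q : (ℝ≥0 × ℝ≥0) × ℝ≥0 | q.2 ≤ min q.1.1 q.1.2}.indicator
      (fun q => k q.2)) := (hk.comp measurable_snd).indicator measurableSet_Iic_min
  simp_rw [h2]
  rw [h1, lintegral_lintegral_swap (f := fun p y => {q : (ℝ≥0 × ℝ≥0) × ℝ≥0 |
    q.2 ≤ min q.1.1 q.1.2}.indicator (fun q => k q.2) (p, y)) hm.aemeasurable]
  have h3 : ∀ y, ∫⁻ p, {q : (ℝ≥0 × ℝ≥0) × ℝ≥0 | q.2 ≤ min q.1.1 q.1.2}.indicator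
      (fun q => k q.2) (p, y) ∂(F.prod G) = k y * (F (Ici y) * G (Ici y)) := by
    intro y
    rw [← Measure.prod_prod, ← lintegral_indicator_const (measurableSet_Ici.prod measurableSet_Ici)]
    refine lintegral_congr fun p => ?_
    simp [indicator_apply, Prod.le_def]
  simp_rw [h3]
  have hm' : Measurable fun y => k y * (F (Ici y) * G (Ici y)) :=
    hk.mul ((measurable_measure_Ici F).mul (measurable_measure_Ici G))
  rw [lintegral_hazard hF hm']
  refine lintegral_congr_ae ?_
  filter_upwards [ae_measure_Ici_ne_zero F] with y hy
  rw [mul_left_comm, ← mul_assoc (F (Ici y))⁻¹, ENNReal.inv_mul_cancel hy (measure_ne_top _ _),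
    one_mul]

/-- `f` does not look at the observation with index `j` up to the time at which it is made. -/
def IsFreeOf (P : Measure Ω) (T C : Fin n → Ω → ℝ≥0) (j : Fin n) {β : Type*} [MeasurableSpace β]
    (f : ℝ≥0 × Ω → β) : Prop :=
  ∃ k : ℝ≥0 × (({j}ᶜ : Finset (Fin n)) → ℝ≥0 × ℝ≥0) → β, Measurable k ∧
    ∀ᵐ ω ∂P, ∀ y, 0 < y → y ≤ obsTime T C j ω → f (y, ω) = k (y, others T C j ω)

lemma isFreeOf_fst {j : Fin n} {β : Type*} [MeasurableSpace β] {g : ℝ≥0 → β} (hg : Measurable g) :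
    IsFreeOf P T C j fun p => g p.1 :=
  ⟨fun q => g q.1, hg.comp measurable_fst, ae_of_all _ fun _ _ _ _ => rfl⟩

lemma IsFreeOf.comp₂ {j : Fin n} {β γ δ : Type*} [MeasurableSpace β] [MeasurableSpace γ]
    [MeasurableSpace δ] {f : ℝ≥0 × Ω → β} {g : ℝ≥0 × Ω → γ} (hf : IsFreeOf P T C j f)
    (hg : IsFreeOf P T C j g) {u : β × γ → δ} (hu : Measurable u) :
    IsFreeOf P T C j fun p => u (f p, g p) := by
  obtain ⟨k, hk, hkf⟩ := hf
  obtain ⟨l, hl, hlg⟩ := hg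
  refine ⟨fun q => u (k q, l q), hu.comp (hk.prodMk hl), ?_⟩
  filter_upwards [hkf, hlg] with ω h1 h2 y hy hyX
  rw [h1 y hy hyX, h2 y hy hyX]

lemma isFreeOf_jumpAt (hF : F {0} = 0) {i j : Fin n} (hij : i ≠ j) :
    IsFreeOf P T C j fun p => jumpAt F T C i p.1 p.2 := by
  let i' : ({j}ᶜ : Finset (Fin n)) := ⟨i, by simpa using hij⟩
  refine ⟨fun q => (if min (q.2 i').1 (q.2 i').2 = q.1 ∧ (q.2 i').1 ≤ (q.2 i').2 then 1 else 0) -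
    (hazard F {q.1}).toReal * (if q.1 ≤ min (q.2 i').1 (q.2 i').2 then 1 else 0), ?_,
    ae_of_all _ fun _ _ _ _ => rfl⟩
  have hi : Measurable fun q : ℝ≥0 × (({j}ᶜ : Finset (Fin n)) → ℝ≥0 × ℝ≥0) => q.2 i' :=
    (measurable_pi_apply i').comp measurable_snd
  have hm : Measurable fun q : ℝ≥0 × (({j}ᶜ : Finset (Fin n)) → ℝ≥0 × ℝ≥0) =>
      min (q.2 i').1 (q.2 i').2 := hi.fst.min hi.snd
  refine (Measurable.ite ?_ measurable_const measurable_const).sub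
    (((measurable_hazard_singleton hF).comp measurable_fst).ennreal_toReal.mul
      (Measurable.ite (measurableSet_le measurable_fst hm) measurable_const measurable_const))
  have h1 : MeasurableSet {q : ℝ≥0 × (({j}ᶜ : Finset (Fin n)) → ℝ≥0 × ℝ≥0) |
      (q.2 i').1 ≤ (q.2 i').2} := measurableSet_le hi.fst hi.snd
  exact (measurableSet_eq_fun hm measurable_fst).inter h1

/-- The compensation formula `E ∫ f dNⱼ = E ∫ f dAⱼ`. -/
lemma IsSample.lintegral_compensation (hS : IsSample P F G T C) {j : Fin n}
    {f : ℝ≥0 × Ω → ℝ≥0∞} (hf : IsFreeOf P T C j f) :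
    ∫⁻ ω, (if T j ω ≤ C j ω then f (obsTime T C j ω, ω) else 0) ∂P =
      ∫⁻ ω, ∫⁻ y in Iic (obsTime T C j ω), f (y, ω) ∂(hazard F) ∂P := by
  obtain ⟨k, hk, hkf⟩ := hf
  have hZ := hS.measurable_others j
  have hpair : Measurable fun ω => ((T j ω, C j ω), others T C j ω) :=
    ((hS.hT j).prodMk (hS.hC j)).prodMk hZ
  -- φ and ψ are the two integrands as functions of the j-th pair and of the other observations.
  -- Freezing the latter leaves the deterministic formula.
  let φ : (ℝ≥0 × ℝ≥0) × (({j}ᶜ : Finset (Fin n)) → ℝ≥0 × ℝ≥0) → ℝ≥0∞ := fun q =>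
    if q.1.1 ≤ q.1.2 then k (q.1.1, q.2) else 0
  let ψ : (ℝ≥0 × ℝ≥0) × (({j}ᶜ : Finset (Fin n)) → ℝ≥0 × ℝ≥0) → ℝ≥0∞ := fun q =>
    ∫⁻ y in Iic (min q.1.1 q.1.2), k (y, q.2) ∂(hazard F)
  have hφ : Measurable φ := by
    refine Measurable.ite ?_ ?_ measurable_const
    · exact measurableSet_le (measurable_fst.comp measurable_fst)
        (measurable_snd.comp measurable_fst)
    · exact hk.comp ((measurable_fst.comp measurable_fst).prodMk measurable_snd)
  have hψ : Measurable ψ := by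
    have : ψ = fun q => ∫⁻ y, {r : ((ℝ≥0 × ℝ≥0) × (({j}ᶜ : Finset (Fin n)) → ℝ≥0 × ℝ≥0)) × ℝ≥0 |
        r.2 ≤ min r.1.1.1 r.1.1.2}.indicator (fun r => k (r.2, r.1.2)) (q, y) ∂(hazard F) := by
      ext q
      simp only [ψ]
      rw [← lintegral_indicator measurableSet_Iic]
      rfl
    rw [this]
    refine Measurable.lintegral_prod_right' (Measurable.indicator ?_ ?_)
    · exact hk.comp (measurable_snd.prodMk (measurable_snd.comp measurable_fst))
    · exact measurableSet_Iic_min.preimage (f := fun r : ((ℝ≥0 × ℝ≥0) ×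
        (({j}ᶜ : Finset (Fin n)) → ℝ≥0 × ℝ≥0)) × ℝ≥0 => (r.1.1, r.2))
        ((measurable_fst.comp measurable_fst).prodMk measurable_snd)
  have hl : ∫⁻ ω, (if T j ω ≤ C j ω then f (obsTime T C j ω, ω) else 0) ∂P =
      ∫⁻ ω, φ ((T j ω, C j ω), others T C j ω) ∂P := by
    refine lintegral_congr_ae ?_
    -- The representation is used at y = X_j itself, which is why `IsFreeOf` asks for y ≤ X_j and
    -- not only y < X_j.
    filter_upwards [hkf, hS.ae_obsTime_pos j] with ω h1 h2
    simp only [φ]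
    split_ifs with h
    · rw [h1 _ h2 le_rfl, obsTime, min_eq_left h]
    · rfl
  have hr : ∫⁻ ω, ∫⁻ y in Iic (obsTime T C j ω), f (y, ω) ∂(hazard F) ∂P =
      ∫⁻ ω, ψ ((T j ω, C j ω), others T C j ω) ∂P := by
    refine lintegral_congr_ae ?_
    filter_upwards [hkf] with ω h1
    refine setLIntegral_congr_fun_ae measurableSet_Iic ?_
    have : ∀ᵐ y ∂(hazard F), y ≠ 0 := by
      rw [ae_iff]; simpa using hazard_zero F
    filter_upwards [this] with y hy hyX
    exact h1 y (pos_iff_ne_zero.2 hy) hyX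
  rw [hl, hr, ← lintegral_map hφ hpair, ← lintegral_map hψ hpair, hS.map_pair_others,
    lintegral_prod_symm _ hφ.aemeasurable, lintegral_prod_symm _ hψ.aemeasurable]
  refine lintegral_congr fun z => ?_
  exact lintegral_prod_compensation hS.hF (hk.comp measurable_prodMk_right)

/-- The compensation formula for f = 1 gives E Λ([0, X_j]) = P(T_j ≤ C_j). Hence Y dΛ is finite on
almost every path although Λ itself may have infinite mass. -/
lemma IsSample.lintegral_hazard_Iic_le (hS : IsSample P F G T C) (j : Fin n) :
    ∫⁻ ω, hazard F (Iic (obsTime T C j ω)) ∂P ≤ 1 := by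
  have h := hS.lintegral_compensation (j := j) (f := fun _ => 1)
    (isFreeOf_fst (g := fun _ => 1) measurable_const)
  simp only [lintegral_one, Measure.restrict_apply MeasurableSet.univ, univ_inter] at h
  rw [← h]
  calc _ ≤ ∫⁻ _, 1 ∂P := lintegral_mono fun ω => by split_ifs <;> simp
    _ = 1 := by simp

lemma measurable_hazard_Iic (F : Measure ℝ≥0) : Measurable fun y => hazard F (Iic y) :=
  Monotone.measurable fun _ _ h => measure_mono (Iic_subset_Iic.2 h)

/-- The square [0,x]² is covered by two closed triangles, each of Λ ⊗ Λ mass at most ∫_{[0,x]}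
Λ([0,y]) dΛ(y). Atoms on the diagonal are counted twice, hence an inequality. -/
lemma hazard_Iic_sq_le (F : Measure ℝ≥0) [IsFiniteMeasure F] (x : ℝ≥0) :
    hazard F (Iic x) ^ 2 ≤ 2 * ∫⁻ y in Iic x, hazard F (Iic y) ∂(hazard F) := by
  let μ := (hazard F).restrict (Iic x)
  have hm1 : MeasurableSet {p : ℝ≥0 × ℝ≥0 | p.2 ≤ p.1} := measurableSet_le measurable_snd measurable_fst
  have hm2 : MeasurableSet {p : ℝ≥0 × ℝ≥0 | p.1 ≤ p.2} := measurableSet_le measurable_fst measurable_snd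
  have h1 : (μ.prod μ) univ = hazard F (Iic x) ^ 2 := by
    rw [← univ_prod_univ, Measure.prod_prod, Measure.restrict_apply_univ, sq]
  have h2 : (μ.prod μ) {p | p.2 ≤ p.1} ≤ ∫⁻ y in Iic x, hazard F (Iic y) ∂(hazard F) := by
    rw [Measure.prod_apply hm1]
    exact lintegral_mono fun y => Measure.restrict_apply_le _ _
  have h3 : (μ.prod μ) {p | p.1 ≤ p.2} ≤ ∫⁻ y in Iic x, hazard F (Iic y) ∂(hazard F) := by
    rw [Measure.prod_apply_symm hm2]
    exact lintegral_mono fun y => Measure.restrict_apply_le _ _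
  calc hazard F (Iic x) ^ 2 = (μ.prod μ) univ := h1.symm
    _ ≤ (μ.prod μ) ({p | p.2 ≤ p.1} ∪ {p | p.1 ≤ p.2}) :=
        measure_mono fun p _ => le_total p.2 p.1
    _ ≤ _ := (measure_union_le _ _).trans (add_le_add h2 h3)
    _ = _ := (two_mul _).symm

/-- Compensation with f(y) = Λ([0,y]) turns the bound above into 2 E[Λ([0,X_j]); T_j ≤ C_j], which
is at most 2 by the first moment. -/
lemma IsSample.lintegral_hazard_Iic_sq_le (hS : IsSample P F G T C) (j : Fin n) :
    ∫⁻ ω, hazard F (Iic (obsTime T C j ω)) ^ 2 ∂P ≤ 2 := by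
  have h := hS.lintegral_compensation (j := j) (f := fun p => hazard F (Iic p.1))
    (isFreeOf_fst (measurable_hazard_Iic F))
  calc _ ≤ ∫⁻ ω, 2 * ∫⁻ y in Iic (obsTime T C j ω), hazard F (Iic y) ∂(hazard F) ∂P :=
        lintegral_mono fun ω => hazard_Iic_sq_le F _
    _ = 2 * ∫⁻ ω, ∫⁻ y in Iic (obsTime T C j ω), hazard F (Iic y) ∂(hazard F) ∂P :=
        lintegral_const_mul' _ _ (by simp)
    _ ≤ 2 * ∫⁻ ω, hazard F (Iic (obsTime T C j ω)) ∂P := by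
        rw [← h]
        gcongr with ω
        split_ifs <;> simp
    _ ≤ 2 * 1 := by gcongr; exact hS.lintegral_hazard_Iic_le j
    _ = 2 := by simp

lemma IsSample.ae_hazard_Iic_lt_top (hS : IsSample P F G T C) :
    ∀ᵐ ω ∂P, ∀ j, hazard F (Iic (obsTime T C j ω)) < ∞ := by
  rw [ae_all_iff]
  intro j
  refine ae_lt_top ((measurable_hazard_Iic F).comp (measurable_obsTime hS.hT hS.hC j)) ?_
  exact ((hS.lintegral_hazard_Iic_le j).trans_lt ENNReal.one_lt_top).ne

lemma IsSample.ae_finitePaths (hS : IsSample P F G T C) :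
    ∀ᵐ ω ∂P, ω ∈ finitePaths F T C := by
  filter_upwards [hS.ae_hazard_Iic_lt_top] with ω h
  constructor
  rw [compensatorMeasure_eq, Measure.finsetSum_apply]
  exact ENNReal.sum_lt_top.2 fun i _ => by simpa using h i

/-- The compensation formula for bounded nonnegative integrands. -/
lemma IsSample.integral_compensation_of_nonneg (hS : IsSample P F G T C) {j : Fin n}
    {f : ℝ≥0 × Ω → ℝ} (hf : IsFreeOf P T C j f) (hfm : Measurable f) (hf0 : ∀ p, 0 ≤ f p)
    {c : ℝ} (hc : ∀ p, f p ≤ c) :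
    Integrable (fun ω => ∫ y in Iic (obsTime T C j ω), f (y, ω) ∂(hazard F)) P ∧
    Integrable (fun ω => if T j ω ≤ C j ω then f (obsTime T C j ω, ω) else 0) P ∧
    ∫ ω, (if T j ω ≤ C j ω then f (obsTime T C j ω, ω) else 0) ∂P =
      ∫ ω, ∫ y in Iic (obsTime T C j ω), f (y, ω) ∂(hazard F) ∂P := by
  have hX := measurable_obsTime hS.hT hS.hC j
  have hfe : IsFreeOf P T C j fun p => ENNReal.ofReal (f p) :=
    hf.comp₂ hf (u := fun q => ENNReal.ofReal q.1) measurable_fst.ennreal_ofReal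
  have key := hS.lintegral_compensation hfe
  have hm1 : Measurable fun ω => if T j ω ≤ C j ω then f (obsTime T C j ω, ω) else 0 :=
    Measurable.ite (measurableSet_uncensored hS.hT hS.hC j) (hfm.comp (hX.prodMk measurable_id))
      measurable_const
  have hin : ∀ ω, ∫ y in Iic (obsTime T C j ω), f (y, ω) ∂(hazard F) =
      (∫⁻ y in Iic (obsTime T C j ω), ENNReal.ofReal (f (y, ω)) ∂(hazard F)).toReal := fun ω =>
    integral_eq_lintegral_of_nonneg_ae (ae_of_all _ fun y => hf0 _)
      (hfm.comp measurable_prodMk_right).aestronglyMeasurable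
  have hm2 : Measurable fun ω =>
      ∫⁻ y in Iic (obsTime T C j ω), ENNReal.ofReal (f (y, ω)) ∂(hazard F) := by
    have : (fun ω => ∫⁻ y in Iic (obsTime T C j ω), ENNReal.ofReal (f (y, ω)) ∂(hazard F)) =
        fun ω => ∫⁻ y, {r : Ω × ℝ≥0 | r.2 ≤ obsTime T C j r.1}.indicator
          (fun r => ENNReal.ofReal (f (r.2, r.1))) (ω, y) ∂(hazard F) := by
      ext ω
      rw [← lintegral_indicator measurableSet_Iic]
      rfl
    rw [this]
    refine Measurable.lintegral_prod_right' (Measurable.indicator ?_ ?_)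
    · exact (hfm.comp measurable_swap).ennreal_ofReal
    · exact measurableSet_le measurable_snd (hX.comp measurable_fst)
  have hfin : ∫⁻ ω, ∫⁻ y in Iic (obsTime T C j ω), ENNReal.ofReal (f (y, ω)) ∂(hazard F) ∂P ≠ ∞ := by
    rw [← key]
    refine ne_top_of_le_ne_top (b := ENNReal.ofReal c) ENNReal.ofReal_ne_top ?_
    calc _ ≤ ∫⁻ _, ENNReal.ofReal c ∂P := lintegral_mono fun ω => by
            split_ifs
            · exact ENNReal.ofReal_le_ofReal (hc _)
            · simp
      _ = _ := by simp
  refine ⟨?_, ?_, ?_⟩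
  · simp_rw [hin]
    exact integrable_toReal_of_lintegral_ne_top hm2.aemeasurable hfin
  · refine Integrable.of_bound hm1.aestronglyMeasurable |c| (ae_of_all _ fun ω => ?_)
    split_ifs
    · rw [Real.norm_eq_abs, abs_of_nonneg (hf0 _)]
      exact (hc _).trans (le_abs_self _)
    · simp
  · simp_rw [hin]
    rw [integral_toReal hm2.aemeasurable (ae_lt_top hm2 hfin), ← key,
      integral_eq_lintegral_of_nonneg_ae (ae_of_all _ fun ω => ?_) hm1.aestronglyMeasurable]
    · congr 1
      refine lintegral_congr fun ω => ?_
      split_ifs <;> simp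
    · by_cases h : T j ω ≤ C j ω
      · simpa [h] using hf0 _
      · simp [h]

/-- The compensation formula for bounded integrands. -/
lemma IsSample.integral_compensation (hS : IsSample P F G T C) {j : Fin n}
    {f : ℝ≥0 × Ω → ℝ} (hf : IsFreeOf P T C j f) (hfm : Measurable f)
    {c : ℝ} (hc : ∀ p, |f p| ≤ c) :
    Integrable (fun ω => ∫ y in Iic (obsTime T C j ω), f (y, ω) ∂(hazard F)) P ∧
    Integrable (fun ω => if T j ω ≤ C j ω then f (obsTime T C j ω, ω) else 0) P ∧
    ∫ ω, (if T j ω ≤ C j ω then f (obsTime T C j ω, ω) else 0) ∂P =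
      ∫ ω, ∫ y in Iic (obsTime T C j ω), f (y, ω) ∂(hazard F) ∂P := by
  have hc0 : ∀ _ : ℝ≥0 × Ω, 0 ≤ c := fun p => (abs_nonneg _).trans (hc p)
  -- The formula is linear, and `f + c` and `c` are both nonnegative and bounded.
  obtain ⟨a1, a2, a3⟩ := hS.integral_compensation_of_nonneg (f := fun p => f p + c)
    (hf.comp₂ hf (u := fun q => q.1 + c) (measurable_fst.add_const c)) (hfm.add_const c)
    (fun p => by linarith [(abs_le.1 (hc p)).1]) (c := 2 * c)
    (fun p => by linarith [(abs_le.1 (hc p)).2])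
  obtain ⟨b1, b2, b3⟩ := hS.integral_compensation_of_nonneg (j := j) (f := fun _ => c)
    (isFreeOf_fst (g := fun _ => c) measurable_const) measurable_const hc0 (c := c)
    (fun _ => le_rfl)
  have e1 : ∀ ω, (if T j ω ≤ C j ω then f (obsTime T C j ω, ω) else 0) =
      (if T j ω ≤ C j ω then f (obsTime T C j ω, ω) + c else 0) -
        (if T j ω ≤ C j ω then c else 0) := fun ω => by split_ifs <;> simp
  have e2 : (fun ω => ∫ y in Iic (obsTime T C j ω), f (y, ω) ∂(hazard F)) =ᵐ[P] fun ω =>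
      (∫ y in Iic (obsTime T C j ω), (f (y, ω) + c) ∂(hazard F)) -
        ∫ y in Iic (obsTime T C j ω), c ∂(hazard F) := by
    filter_upwards [hS.ae_hazard_Iic_lt_top] with ω hω
    have : IsFiniteMeasure ((hazard F).restrict (Iic (obsTime T C j ω))) :=
      ⟨by simpa using hω j⟩
    have hfi : Integrable (fun y => f (y, ω)) ((hazard F).restrict (Iic (obsTime T C j ω))) :=
      Integrable.of_bound (hfm.comp measurable_prodMk_right).aestronglyMeasurable c
        (ae_of_all _ fun y => hc _)
    have h := integral_add hfi (integrable_const c)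
    linarith
  refine ⟨(a1.sub b1).congr e2.symm, ?_, ?_⟩
  · simp_rw [e1]
    exact a2.sub b2
  · rw [integral_congr_ae e2, integral_sub a1 b1, ← a3, ← b3, ← integral_sub a2 b2]
    simp_rw [e1]

end Compensation

/-! ### Predictable processes of the observed filtration -/

section Observed

set_option linter.unusedSectionVars false

variable {Ω : Type*} {mΩ : MeasurableSpace Ω} {n : ℕ} {P : Measure Ω} [IsProbabilityMeasure P]
  {F G : Measure ℝ≥0} [IsProbabilityMeasure F] [IsProbabilityMeasure G] {T C : Fin n → Ω → ℝ≥0}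
  {hT : ∀ i, Measurable (T i)} {hC : ∀ i, Measurable (C i)}

lemma measurableSet_obsFiltration_of_null {t : ℝ≥0} {A : Set Ω} (hA : MeasurableSet A)
    (hA0 : P A = 0) : MeasurableSet[obsFiltration P T C hT hC t] A :=
  MeasurableSpace.measurableSet_generateFrom (Or.inr ⟨hA, hA0⟩)

lemma measurableSet_obsFiltration_of_ae {t : ℝ≥0} {A : Set Ω} (hA : MeasurableSet A)
    (hA0 : ∀ᵐ ω ∂P, ω ∈ A) : MeasurableSet[obsFiltration P T C hT hC t] A := by
  rw [← compl_compl A]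
  exact (measurableSet_obsFiltration_of_null hA.compl hA0).compl

lemma measurableSet_obsFiltration_uncensored (i : Fin n) (s : ℝ≥0) :
    MeasurableSet[obsFiltration P T C hT hC s]
      {ω | obsTime T C i ω ≤ s ∧ ω ∈ {ω | T i ω ≤ C i ω}} :=
  MeasurableSpace.measurableSet_generateFrom (Or.inl (Or.inl ⟨i, s, le_rfl, rfl⟩))

lemma measurableSet_obsFiltration_obsTime (i : Fin n) (s : ℝ≥0) :
    MeasurableSet[obsFiltration P T C hT hC s] {ω | obsTime T C i ω ≤ s ∧ ω ∈ univ} := by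
  have h1 : MeasurableSet[obsFiltration P T C hT hC s]
      {ω | obsTime T C i ω ≤ s ∧ T i ω ≤ C i ω} :=
    MeasurableSpace.measurableSet_generateFrom (Or.inl (Or.inl ⟨i, s, le_rfl, rfl⟩))
  have h2 : MeasurableSet[obsFiltration P T C hT hC s]
      {ω | obsTime T C i ω ≤ s ∧ ¬ T i ω ≤ C i ω} :=
    MeasurableSpace.measurableSet_generateFrom (Or.inl (Or.inr ⟨i, s, le_rfl, rfl⟩))
  convert h1.union h2 using 1
  ext ω
  simp only [mem_ofPred_eq, mem_union, mem_univ, and_true]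
  tauto

/-- The filtration is complete: modifying an `𝓕 t`-measurable function on a null set does not
affect its measurability. -/
lemma measurable_obsFiltration_congr {t : ℝ≥0} {f g : Ω → ℝ}
    (hf : Measurable[obsFiltration P T C hT hC t] f) (hg : Measurable g) (hfg : f =ᵐ[P] g) :
    Measurable[obsFiltration P T C hT hC t] g := by
  have hf' : Measurable f := hf.mono ((obsFiltration P T C hT hC).le t) le_rfl
  intro s hs
  have hne : MeasurableSet {ω | f ω ≠ g ω} := (measurableSet_eq_fun hf' hg).compl
  have hnull : P {ω | f ω ≠ g ω} = 0 := hfg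
  have : g ⁻¹' s = (f ⁻¹' s \ {ω | f ω ≠ g ω}) ∪ (g ⁻¹' s ∩ {ω | f ω ≠ g ω}) := by
    ext ω
    by_cases h : f ω = g ω <;> simp [h]
  rw [this]
  exact ((hf hs).diff (measurableSet_obsFiltration_of_null hne hnull)).union
    (measurableSet_obsFiltration_of_null ((hg hs).inter hne)
      (measure_mono_null inter_subset_right hnull))

/-- Before the observation with index `j` is made, the past is generated by the others. -/
lemma exists_others_of_past (j : Fin n) {a : ℝ≥0} {A : Set Ω}
    (hA : MeasurableSet[obsFiltration P T C hT hC a] A) :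
    ∃ B : Set (({j}ᶜ : Finset (Fin n)) → ℝ≥0 × ℝ≥0), MeasurableSet B ∧
      ∀ᵐ ω ∂P, a < obsTime T C j ω → (ω ∈ A ↔ others T C j ω ∈ B) := by
  have hbasic : ∀ (i : Fin n) (s : ℝ≥0), s ≤ a → ∀ (V : Set (ℝ≥0 × ℝ≥0)), MeasurableSet V →
      ∃ B : Set (({j}ᶜ : Finset (Fin n)) → ℝ≥0 × ℝ≥0), MeasurableSet B ∧
      ∀ᵐ ω ∂P, a < obsTime T C j ω →
        (ω ∈ {ω | obsTime T C i ω ≤ s ∧ (T i ω, C i ω) ∈ V} ↔ others T C j ω ∈ B) := by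
    intro i s hs V hV
    -- For i = j the event {X_j ≤ s} with s ≤ a cannot occur while X_j > a, so the empty set
    -- represents it.
    by_cases hij : i = j
    · subst hij
      refine ⟨∅, MeasurableSet.empty, ae_of_all _ fun ω hω => ?_⟩
      simp only [mem_ofPred_eq, mem_empty_iff_false, iff_false, not_and]
      exact fun h => absurd (h.trans hs) (not_le.2 hω)
    · let i' : ({j}ᶜ : Finset (Fin n)) := ⟨i, by simpa using hij⟩
      refine ⟨{z | min (z i').1 (z i').2 ≤ s} ∩ {z | z i' ∈ V}, ?_,
        ae_of_all _ fun ω _ => Iff.rfl⟩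
      have hi : Measurable fun z : (({j}ᶜ : Finset (Fin n)) → ℝ≥0 × ℝ≥0) => z i' :=
        measurable_pi_apply i'
      exact (measurableSet_le (hi.fst.min hi.snd) measurable_const).inter (hi hV)
  have hle : MeasurableSet {p : ℝ≥0 × ℝ≥0 | p.1 ≤ p.2} :=
    measurableSet_le measurable_fst measurable_snd
  induction A, hA using MeasurableSpace.generateFrom_induction with
  | hC A hA _ =>
    obtain (⟨i, s, hs, rfl⟩ | ⟨i, s, hs, rfl⟩) | ⟨hA, hA0⟩ := hA
    · exact hbasic i s hs _ hle
    · exact hbasic i s hs _ hle.compl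
    · refine ⟨∅, MeasurableSet.empty, ?_⟩
      have : ∀ᵐ ω ∂P, ω ∉ A := measure_eq_zero_iff_ae_notMem.1 hA0
      filter_upwards [this] with ω h1 _
      simp [h1]
  | empty => exact ⟨∅, MeasurableSet.empty, ae_of_all _ fun _ _ => by simp⟩
  | compl A _ ih =>
    obtain ⟨B, hB, h⟩ := ih
    refine ⟨Bᶜ, hB.compl, ?_⟩
    filter_upwards [h] with ω h hω
    simp [h hω]
  | iUnion s _ ih =>
    choose B hB h using ih
    refine ⟨⋃ k, B k, MeasurableSet.iUnion hB, ?_⟩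
    filter_upwards [ae_all_iff.2 h] with ω h hω
    simp only [mem_iUnion]
    exact exists_congr fun k => h k hω

/-- On a generator (a,∞) × A, a time y with a < y ≤ X_j forces a < X_j, the situation of
`exists_others_of_past`. The exceptional null set does not depend on y, and this survives countable
unions. -/
lemma exists_others_of_predictable (j : Fin n) {S : Set (ℝ≥0 × Ω)}
    (hS : MeasurableSet[(obsFiltration P T C hT hC).predictable] S) :
    ∃ S' : Set (ℝ≥0 × (({j}ᶜ : Finset (Fin n)) → ℝ≥0 × ℝ≥0)), MeasurableSet S' ∧
      ∀ᵐ ω ∂P, ∀ y, 0 < y → y ≤ obsTime T C j ω → ((y, ω) ∈ S ↔ (y, others T C j ω) ∈ S') := by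
  induction S, hS using MeasurableSpace.generateFrom_induction with
  | hC S hS _ =>
    obtain ⟨A, hA, rfl⟩ | ⟨a, A, hA, rfl⟩ := hS
    · refine ⟨∅, MeasurableSet.empty, ae_of_all _ fun ω y hy _ => ?_⟩
      simp only [mem_prod, mem_singleton_iff, mem_empty_iff_false, iff_false, not_and]
      rintro rfl
      exact absurd hy not_lt_bot
    · obtain ⟨B, hB, h⟩ := exists_others_of_past j hA
      refine ⟨Ioi a ×ˢ B, measurableSet_Ioi.prod hB, ?_⟩
      filter_upwards [h] with ω h y _ hyX
      simp only [mem_prod, mem_Ioi, and_congr_right_iff]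
      exact fun hay => h (hay.trans_le hyX)
  | empty => exact ⟨∅, MeasurableSet.empty, ae_of_all _ fun _ _ _ _ => by simp⟩
  | compl A _ ih =>
    obtain ⟨B, hB, h⟩ := ih
    refine ⟨Bᶜ, hB.compl, ?_⟩
    filter_upwards [h] with ω h y hy hyX
    simp [h y hy hyX]
  | iUnion s _ ih =>
    choose B hB h using ih
    refine ⟨⋃ k, B k, MeasurableSet.iUnion hB, ?_⟩
    filter_upwards [ae_all_iff.2 h] with ω h y hy hyX
    simp only [mem_iUnion]
    exact exists_congr fun k => h k y hy hyX

lemma isFreeOf_of_predictable_ennreal (j : Fin n) {f : ℝ≥0 × Ω → ℝ≥0∞}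
    (hf : Measurable[(obsFiltration P T C hT hC).predictable] f) : IsFreeOf P T C j f := by
  refine @Measurable.ennreal_induction _ (obsFiltration P T C hT hC).predictable
    (fun f => IsFreeOf P T C j f) ?_ ?_ ?_ f hf
  · intro c S hS
    obtain ⟨S', hS', h⟩ := exists_others_of_predictable j hS
    refine ⟨S'.indicator fun _ => c, measurable_const.indicator hS', ?_⟩
    filter_upwards [h] with ω h y hy hyX
    by_cases hm : (y, ω) ∈ S
    · rw [indicator_of_mem hm, indicator_of_mem ((h y hy hyX).1 hm)]
    · rw [indicator_of_notMem hm, indicator_of_notMem fun h' => hm ((h y hy hyX).2 h')]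
  · intro f g _ _ _ hf hg
    exact hf.comp₂ hg (u := fun q => q.1 + q.2) (measurable_fst.add measurable_snd)
  · intro f _ _ hf
    choose k hk h using hf
    refine ⟨fun q => ⨆ n, k n q, Measurable.iSup hk, ?_⟩
    filter_upwards [ae_all_iff.2 h] with ω h y hy hyX
    exact iSup_congr fun n => h n y hy hyX

/-- A predictable process does not look at an observation before it is made. -/
lemma isFreeOf_of_predictable (j : Fin n) {f : ℝ≥0 × Ω → ℝ}
    (hf : Measurable[(obsFiltration P T C hT hC).predictable] f) : IsFreeOf P T C j f := by
  have h1 : IsFreeOf P T C j fun p => ENNReal.ofReal (f p) :=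
    isFreeOf_of_predictable_ennreal (hT := hT) (hC := hC) j hf.ennreal_ofReal
  have h2 : IsFreeOf P T C j fun p => ENNReal.ofReal (-f p) :=
    isFreeOf_of_predictable_ennreal (hT := hT) (hC := hC) j hf.neg.ennreal_ofReal
  have h3 := h1.comp₂ h2 (u := fun q => q.1.toReal - q.2.toReal)
    (measurable_fst.ennreal_toReal.sub measurable_snd.ennreal_toReal)
  convert h3 using 2 with p
  rw [ENNReal.toReal_ofReal', ENNReal.toReal_ofReal']
  rcases le_total 0 (f p) with h | h <;> simp [h]

lemma measurableSet_predictable_univ_prod {𝓕 : Filtration ℝ≥0 mΩ} {A : Set Ω}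
    (hA : MeasurableSet[𝓕 0] A) : MeasurableSet[𝓕.predictable] {p : ℝ≥0 × Ω | p.2 ∈ A} := by
  convert (measurableSet_predictable_singleton_bot_prod (𝓕 := 𝓕) hA).union
    (measurableSet_predictable_Ioi_prod (𝓕 := 𝓕) (i := 0) hA) using 1
  ext p
  simp only [mem_ofPred_eq, mem_union, mem_prod, mem_singleton_iff, mem_Ioi]
  rcases eq_or_ne p.1 0 with h | h
  · simp [h]
  · simp [h, pos_iff_ne_zero]

/-- Being at risk at y is the complement of having been observed strictly before y; thus Y is
predictable. -/
lemma measurable_atRisk_predictable (i : Fin n) :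
    Measurable[(obsFiltration P T C hT hC).predictable] fun p : ℝ≥0 × Ω =>
      if p.1 ≤ obsTime T C i p.2 then (1 : ℝ≥0∞) else 0 := by
  have h := measurableSet_predictable_lt
    (measurableSet_obsFiltration_obsTime (P := P) (hT := hT) (hC := hC) i)
  refine Measurable.ite ?_ measurable_const measurable_const
  convert h.compl using 1
  ext p
  simp

/-- The integral of a function against `dM` along a path. -/
lemma integral_signDensity (hF : F {0} = 0) {ω : Ω} (hω : ω ∈ finitePaths F T C) {g : ℝ≥0 → ℝ}
    (hg : Measurable g) (hgi : Integrable g (compensatorMeasure F T C ω)) :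
    ∫ y, g y * signDensity F T C y ω ∂(baseKernel F hT hC ω) =
      (∑ i, if T i ω ≤ C i ω then g (obsTime T C i ω) else 0) -
        ∫ y, g y ∂(compensatorMeasure F T C ω) := by
  have hfin : IsFiniteMeasure (compensatorMeasure F T C ω) := hω
  have hgN : ∀ i, Integrable g
      (if T i ω ≤ C i ω then Measure.dirac (obsTime T C i ω) else 0 : Measure ℝ≥0) := by
    intro i
    split_ifs
    · exact integrable_dirac (by simp)
    · exact integrable_zero_measure
  have hgN' : Integrable g (countingMeasure T C ω) :=
    integrable_finsetSum_measure.2 fun i _ => hgN i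
  have hρ : Measurable fun y => signDensity F T C y ω :=
    (measurable_signDensity hF hT hC).comp measurable_prodMk_right
  rw [← integral_lsmul_withDensityᵥ hρ
    (integrable_signDensity hF hT hC _ ω) hg, ← dM_eq hF hT hC, dM, dif_pos hfin,
    VectorMeasure.integral_sub_vectorMeasure, integral_lsmul_toSignedMeasure,
    integral_lsmul_toSignedMeasure]
  · congr 1
    rw [countingMeasure, integral_finsetSum_measure fun i _ => hgN i]
    refine Finset.sum_congr rfl fun i _ => ?_
    split_ifs <;> simp
  · rwa [VectorMeasure.Integrable, Measure.variation_toSignedMeasure]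
  · rwa [VectorMeasure.Integrable, Measure.variation_toSignedMeasure]

/-- Cancellation of atoms cannot make a function integrable with respect to `dM`. -/
lemma integrable_signDensity_mul_iff (hF : F {0} = 0) {ω : Ω} (hω : ω ∈ finitePaths F T C)
    {g : ℝ≥0 → ℝ} (hg : Measurable g) :
    Integrable (fun y => g y * signDensity F T C y ω) (baseKernel F hT hC ω) ↔
      ∫⁻ y, ‖g y‖ₑ ∂(compensatorMeasure F T C ω) < ∞ := by
  classical
  have hfin : IsFiniteMeasure (compensatorMeasure F T C ω) := hω
  have hρ : Measurable fun y => signDensity F T C y ω :=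
    (measurable_signDensity hF hT hC).comp measurable_prodMk_right
  have hN : ∫⁻ y, ‖g y‖ₑ ∂(countingMeasure T C ω) < ∞ := by
    rw [lintegral_countingMeasure]
    refine ENNReal.sum_lt_top.2 fun i _ => ?_
    split_ifs <;> simp
  rw [baseKernel_of_mem hT hC hω]
  constructor
  · intro h
    -- Off the finite set of observed times the density is -1, so nothing is lost there; over a
    -- finite set every real function has a finite integral.
    let S : Finset ℝ≥0 := Finset.univ.image fun i => obsTime T C i ω
    have hS : ∀ y ∉ (S : Set ℝ≥0), signDensity F T C y ω = -1 := by
      intro y hy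
      rw [signDensity, if_pos]
      rw [atomCount]
      refine Finset.sum_eq_zero fun i _ => if_neg fun h => hy ?_
      rw [← h.1]
      exact Finset.mem_coe.2 (Finset.mem_image_of_mem _ (Finset.mem_univ i))
    rw [← lintegral_add_compl _ (Finset.measurableSet S)]
    refine ENNReal.add_lt_top.2 ⟨?_, ?_⟩
    · rw [lintegral_finset]
      exact ENNReal.sum_lt_top.2 fun y _ => ENNReal.mul_lt_top (by simp) (measure_lt_top _ _)
    · have h2 := h.2
      rw [hasFiniteIntegral_iff_enorm] at h2
      refine lt_of_le_of_lt ?_ h2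
      calc ∫⁻ y in (S : Set ℝ≥0)ᶜ, ‖g y‖ₑ ∂(compensatorMeasure F T C ω)
          = ∫⁻ y in (S : Set ℝ≥0)ᶜ, ‖g y * signDensity F T C y ω‖ₑ
              ∂(compensatorMeasure F T C ω) := by
            refine setLIntegral_congr_fun (Finset.measurableSet S).compl fun y hy => ?_
            simp [hS y hy]
        _ ≤ ∫⁻ y, ‖g y * signDensity F T C y ω‖ₑ ∂(compensatorMeasure F T C ω) :=
            setLIntegral_le_lintegral _ _
        _ ≤ _ := by
            rw [lintegral_add_measure]
            exact le_add_self
  · intro h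
    refine ⟨(hg.mul hρ).aestronglyMeasurable, ?_⟩
    rw [hasFiniteIntegral_iff_enorm]
    refine lt_of_le_of_lt (b := ∫⁻ y, ‖g y‖ₑ ∂(countingMeasure T C ω + compensatorMeasure F T C ω))
      ?_ ?_
    · refine lintegral_mono fun y => ?_
      rw [enorm_mul]
      refine mul_le_of_le_one_right' ?_
      rw [Real.enorm_eq_ofReal_abs]
      exact ENNReal.ofReal_le_one.2 (abs_signDensity_le F T C y ω)
    · rw [lintegral_add_measure]
      exact ENNReal.add_lt_top.2 ⟨hN, h⟩

/-- The integral of a two-time predictable process over its first time against `Y dΛ`. -/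
lemma measurable_lintegral_compensator_predictable (hF : F {0} = 0)
    {f : ℝ≥0 × ℝ≥0 × Ω → ℝ} (hf : Measurable[twoTimePredictable (obsFiltration P T C hT hC)] f)
    (hf0 : ∀ q ∉ orderedPairs Ω, f q = 0) {φ : ℝ → ℝ≥0∞} (hφ : Measurable φ) (hφ0 : φ 0 = 0) :
    Measurable[(obsFiltration P T C hT hC).predictable] fun p : ℝ≥0 × Ω =>
      ∫⁻ x, φ (f (x, p)) ∂(compensatorMeasure F T C p.2) := by
  simp_rw [lintegral_compensatorMeasure]
  refine Finset.measurable_sum _ fun i _ => ?_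
  have hw : Measurable[(obsFiltration P T C hT hC).predictable] fun p : ℝ≥0 × Ω =>
      (F (Ici p.1))⁻¹ * if p.1 ≤ obsTime T C i p.2 then (1 : ℝ≥0∞) else 0 :=
    ((measurable_measure_Ici F).inv.comp measurable_fst_predictable).mul
      (measurable_atRisk_predictable i)
  -- The weight 1_{x ≤ X_i} / F([x,∞)) is moved into the integrand as a two-time predictable factor.
  -- The remaining measure is F, which is deterministic and finite, unlike Λ.
  have hm : Measurable[twoTimePredictable (obsFiltration P T C hT hC)]
      fun q => (orderedPairs Ω).indicator (fun q => (F (Ici q.1))⁻¹ *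
        if q.1 ≤ obsTime T C i q.2.2 then (1 : ℝ≥0∞) else 0) q * φ (f q) :=
    (measurable_orderedPairs_fst hw).mul (hφ.comp hf)
  convert measurable_lintegral_Ioo_predictable F hm using 2 with p
  have hfm : Measurable fun x => φ (f (x, p)) :=
    hφ.comp (hf.comp (measurable_prodMk_twoTimePredictable p))
  rw [setLIntegral_hazard hF hfm measurableSet_Iic, ← lintegral_indicator measurableSet_Iic,
    ← lintegral_indicator measurableSet_Ioo]
  refine lintegral_congr fun x => ?_
  by_cases hx : x ∈ Ioo 0 p.1
  · have hq : ((x, p) : ℝ≥0 × ℝ≥0 × Ω) ∈ orderedPairs Ω := hx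
    rw [indicator_of_mem hx, indicator_of_mem hq]
    by_cases hX : x ≤ obsTime T C i p.2
    · rw [indicator_of_mem (show x ∈ Iic _ from hX)]
      simp [hX]
    · rw [indicator_of_notMem (show x ∉ Iic _ from hX)]
      simp [hX]
  · have hq : ((x, p) : ℝ≥0 × ℝ≥0 × Ω) ∉ orderedPairs Ω := hx
    simp only [indicator_apply, hf0 _ hq, hφ0, mul_zero, ite_self]

/-- The inner integral `∫_{(0,y)} f(x, y) dM(x)` of a two-time predictable process is
predictable. -/
lemma measurable_inner_predictable (hS : IsSample P F G T C)
    {f : ℝ≥0 × ℝ≥0 × Ω → ℝ} (hf : Measurable[twoTimePredictable (obsFiltration P T C hT hC)] f)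
    (hf0 : ∀ q ∉ orderedPairs Ω, f q = 0) :
    Measurable[(obsFiltration P T C hT hC).predictable] fun p : ℝ≥0 × Ω =>
      ∫ x, f (x, p) * signDensity F T C x p.2 ∂(baseKernel F hT hC p.2) := by
  classical
  have hF := hS.hF
  have h1 := measurable_lintegral_compensator_predictable (F := F) hF hf hf0
    (φ := fun r => ‖r‖ₑ) measurable_enorm (by simp)
  have h2 := measurable_lintegral_compensator_predictable (F := F) hF hf hf0
    (φ := fun r => ENNReal.ofReal r) ENNReal.measurable_ofReal (by simp)
  have h3 := measurable_lintegral_compensator_predictable (F := F) hF hf hf0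
    (φ := fun r => ENNReal.ofReal (-r)) measurable_neg.ennreal_ofReal (by simp)
  have hgood : MeasurableSet[(obsFiltration P T C hT hC).predictable]
      {p : ℝ≥0 × Ω | p.2 ∈ finitePaths F T C} :=
    measurableSet_predictable_univ_prod
      (measurableSet_obsFiltration_of_ae (measurableSet_finitePaths hT hC) hS.ae_finitePaths)
  -- `f` vanishes unless 0 < X_i < y, so only observations made strictly before y contribute to the
  -- counting part.
  have hN : Measurable[(obsFiltration P T C hT hC).predictable] fun p : ℝ≥0 × Ω =>
      ∑ i, if T i p.2 ≤ C i p.2 then f (obsTime T C i p.2, p) else 0 := by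
    refine Finset.measurable_sum _ fun i _ => ?_
    convert measurable_eval_predictable
      (measurableSet_obsFiltration_uncensored (P := P) (hT := hT) (hC := hC) i) hf using 2 with p
    by_cases hq : ((obsTime T C i p.2, p) : ℝ≥0 × ℝ≥0 × Ω) ∈ orderedPairs Ω
    · have hlt : obsTime T C i p.2 < p.1 := hq.2
      by_cases hi : T i p.2 ≤ C i p.2
      · simp [indicator_apply, hlt, hi, hq]
      · simp [indicator_apply, hi]
    · rw [hf0 _ hq]
      simp [indicator_apply, hq]
  -- Where the path is good and ∫ |f| Y dΛ is finite, the integral is an explicit predictable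
  -- expression; elsewhere it is 0 by convention. The exceptional paths are a predictable set
  -- because 𝓕 0 contains the null sets.
  have key : (fun p : ℝ≥0 × Ω =>
      ∫ x, f (x, p) * signDensity F T C x p.2 ∂(baseKernel F hT hC p.2)) =
      ({p : ℝ≥0 × Ω | p.2 ∈ finitePaths F T C} ∩
        {p | ∫⁻ x, ‖f (x, p)‖ₑ ∂(compensatorMeasure F T C p.2) < ∞}).indicator fun p =>
        (∑ i, if T i p.2 ≤ C i p.2 then f (obsTime T C i p.2, p) else 0) -
          ((∫⁻ x, ENNReal.ofReal (f (x, p)) ∂(compensatorMeasure F T C p.2)).toReal -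
            (∫⁻ x, ENNReal.ofReal (-f (x, p)) ∂(compensatorMeasure F T C p.2)).toReal) := by
    ext p
    have hfm : Measurable fun x => f (x, p) := hf.comp (measurable_prodMk_twoTimePredictable p)
    by_cases hp : p.2 ∈ finitePaths F T C
    · by_cases hi : ∫⁻ x, ‖f (x, p)‖ₑ ∂(compensatorMeasure F T C p.2) < ∞
      · have hint : Integrable (fun x => f (x, p)) (compensatorMeasure F T C p.2) :=
          ⟨hfm.aestronglyMeasurable, by rwa [hasFiniteIntegral_iff_enorm]⟩
        have hm : p ∈ ({p : ℝ≥0 × Ω | p.2 ∈ finitePaths F T C} ∩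
            {p | ∫⁻ x, ‖f (x, p)‖ₑ ∂(compensatorMeasure F T C p.2) < ∞} : Set _) := ⟨hp, hi⟩
        rw [indicator_of_mem hm, integral_signDensity hF hp hfm hint,
          integral_eq_lintegral_pos_part_sub_lintegral_neg_part hint]
      · rw [indicator_of_notMem fun h => hi h.2, integral_undef]
        rwa [integrable_signDensity_mul_iff hF hp hfm]
    · rw [indicator_of_notMem fun h => hp h.1, baseKernel_of_notMem hT hC hp]
      simp
  rw [key]
  exact (hN.sub (h2.ennreal_toReal.sub h3.ennreal_toReal)).indicator
    (hgood.inter (measurableSet_lt h1 measurable_const))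

end Observed

/-! ### Integrals of predictable processes against `dM` -/

section StochIntegral

set_option linter.unusedSectionVars false

variable {Ω : Type*} {mΩ : MeasurableSpace Ω} {n : ℕ} {P : Measure Ω} [IsProbabilityMeasure P]
  {F G : Measure ℝ≥0} [IsProbabilityMeasure F] [IsProbabilityMeasure G] {T C : Fin n → Ω → ℝ≥0}
  {hT : ∀ i, Measurable (T i)} {hC : ∀ i, Measurable (C i)}

/-- The integral `∫ K dM` along each path. -/
def stochIntegral (F : Measure ℝ≥0) [IsFiniteMeasure F] (hT : ∀ i, Measurable (T i))
    (hC : ∀ i, Measurable (C i)) (K : ℝ≥0 × Ω → ℝ) (ω : Ω) : ℝ :=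
  ∫ y, K (y, ω) * signDensity F T C y ω ∂(baseKernel F hT hC ω)

/-- The expectation of `∫ |K| |dM|`. -/
def absMoment (P : Measure Ω) (F : Measure ℝ≥0) [IsFiniteMeasure F] (hT : ∀ i, Measurable (T i))
    (hC : ∀ i, Measurable (C i)) (K : ℝ≥0 × Ω → ℝ) : ℝ≥0∞ :=
  ∫⁻ ω, ∫⁻ y, ‖K (y, ω) * signDensity F T C y ω‖ₑ ∂(baseKernel F hT hC ω) ∂P

/-- The expectation of `∫ K² d⟨M⟩`. -/
def varMoment (P : Measure Ω) (F : Measure ℝ≥0) (T C : Fin n → Ω → ℝ≥0) (K : ℝ≥0 × Ω → ℝ) :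
    ℝ≥0∞ :=
  ∫⁻ ω, ∫⁻ y, ‖K (y, ω)‖ₑ ^ 2 ∂(varM F T C ω) ∂P

lemma measurable_mul_signDensity (hF : F {0} = 0) (hT : ∀ i, Measurable (T i))
    (hC : ∀ i, Measurable (C i)) {K : ℝ≥0 × Ω → ℝ} (hK : Measurable K) :
    Measurable fun q : Ω × ℝ≥0 => K (q.2, q.1) * signDensity F T C q.2 q.1 := by
  have h1 : Measurable fun q : Ω × ℝ≥0 => K (q.2, q.1) := hK.comp measurable_swap
  have h2 : Measurable fun q : Ω × ℝ≥0 => signDensity F T C q.2 q.1 :=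
    (measurable_signDensity hF hT hC).comp measurable_swap
  exact h1.mul h2

lemma measurable_stochIntegral (hF : F {0} = 0) {K : ℝ≥0 × Ω → ℝ} (hK : Measurable K) :
    Measurable (stochIntegral F hT hC K) :=
  (StronglyMeasurable.integral_kernel_prod_right' (κ := baseKernel F hT hC)
    (measurable_mul_signDensity hF hT hC hK).stronglyMeasurable).measurable

lemma absMoment_eq (hF : F {0} = 0) {K : ℝ≥0 × Ω → ℝ} (hK : Measurable K) :
    absMoment P F hT hC K = ∫⁻ q, ‖K (q.2, q.1) * signDensity F T C q.2 q.1‖ₑ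
      ∂(P ⊗ₘ baseKernel F hT hC) := by
  rw [Measure.lintegral_compProd (measurable_mul_signDensity hF hT hC hK).enorm]
  rfl

lemma integrable_compProd_of_absMoment (hF : F {0} = 0) {K : ℝ≥0 × Ω → ℝ} (hK : Measurable K)
    (hi : absMoment P F hT hC K < ∞) :
    Integrable (fun q : Ω × ℝ≥0 => K (q.2, q.1) * signDensity F T C q.2 q.1)
      (P ⊗ₘ baseKernel F hT hC) := by
  refine ⟨(measurable_mul_signDensity hF hT hC hK).aestronglyMeasurable, ?_⟩
  rwa [hasFiniteIntegral_iff_enorm, ← absMoment_eq hF hK]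

lemma integrable_stochIntegral (hF : F {0} = 0) {K : ℝ≥0 × Ω → ℝ} (hK : Measurable K)
    (hi : absMoment P F hT hC K < ∞) : Integrable (stochIntegral F hT hC K) P := by
  have h := integrable_compProd_of_absMoment hF hK hi
  refine ((Measure.integrable_compProd_iff h.1).1 h).2.mono
    (measurable_stochIntegral hF hK).aestronglyMeasurable (ae_of_all _ fun ω => ?_)
  exact (norm_integral_le_integral_norm _).trans (le_abs_self _)

lemma integral_stochIntegral (hF : F {0} = 0) {K : ℝ≥0 × Ω → ℝ} (hK : Measurable K)
    (hi : absMoment P F hT hC K < ∞) :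
    ∫ ω, stochIntegral F hT hC K ω ∂P =
      ∫ q, K (q.2, q.1) * signDensity F T C q.2 q.1 ∂(P ⊗ₘ baseKernel F hT hC) :=
  (Measure.integral_compProd (integrable_compProd_of_absMoment hF hK hi)).symm

lemma ae_integrable_of_absMoment (hF : F {0} = 0) {K : ℝ≥0 × Ω → ℝ} (hK : Measurable K)
    (hi : absMoment P F hT hC K < ∞) :
    ∀ᵐ ω ∂P, Integrable (fun y => K (y, ω) * signDensity F T C y ω) (baseKernel F hT hC ω) :=
  have h := integrable_compProd_of_absMoment hF hK hi
  ((Measure.integrable_compProd_iff h.1).1 h).1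

lemma sq_add_le_four_mul (a b : ℝ≥0∞) : (a + b) ^ 2 ≤ 4 * (a ^ 2 + b ^ 2) := by
  have h4 : ∀ c : ℝ≥0∞, (c + c) ^ 2 = 4 * c ^ 2 := fun c => by ring
  rcases le_total a b with h | h
  · calc (a + b) ^ 2 ≤ (b + b) ^ 2 := by gcongr
      _ = 4 * b ^ 2 := h4 b
      _ ≤ _ := by gcongr; exact le_add_self
  · calc (a + b) ^ 2 ≤ (a + a) ^ 2 := by gcongr
      _ = 4 * a ^ 2 := h4 a
      _ ≤ _ := by gcongr; exact le_self_add

lemma baseKernel_univ_le (ω : Ω) :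
    baseKernel F hT hC ω univ ≤ n + ∑ j, hazard F (Iic (obsTime T C j ω)) := by
  by_cases hω : ω ∈ finitePaths F T C
  · rw [baseKernel_of_mem hT hC hω, Measure.add_apply]
    gcongr
    · exact countingMeasure_univ_le T C ω
    · rw [compensatorMeasure_eq, Measure.finsetSum_apply]
      simp
  · rw [baseKernel_of_notMem hT hC hω]
    simp

/-- For bounded K the process K(y) ∫_{(0,y)} K dM is only bounded by a multiple of this total mass.
Integrating it against dM once more calls for the second moment. -/
lemma IsSample.lintegral_baseKernel_sq_lt_top (hS : IsSample P F G T C) :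
    ∫⁻ ω, baseKernel F hT hC ω univ ^ 2 ∂P < ∞ := by
  have key : ∀ s : Finset (Fin n),
      ∫⁻ ω, (n + ∑ j ∈ s, hazard F (Iic (obsTime T C j ω))) ^ 2 ∂P < ∞ := by
    intro s
    induction s using Finset.induction_on with
    | empty => simp
    | insert j s hj ih =>
      have hm : Measurable fun ω => hazard F (Iic (obsTime T C j ω)) ^ 2 :=
        ((measurable_hazard_Iic F).comp (measurable_obsTime hS.hT hS.hC j)).pow_const 2
      calc _ ≤ ∫⁻ ω, 4 * (hazard F (Iic (obsTime T C j ω)) ^ 2 +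
            (n + ∑ j ∈ s, hazard F (Iic (obsTime T C j ω))) ^ 2) ∂P := by
            refine lintegral_mono fun ω => ?_
            simp only [Finset.sum_insert hj]
            rw [add_left_comm]
            exact sq_add_le_four_mul _ _
        _ = 4 * (∫⁻ ω, hazard F (Iic (obsTime T C j ω)) ^ 2 ∂P +
            ∫⁻ ω, (n + ∑ j ∈ s, hazard F (Iic (obsTime T C j ω))) ^ 2 ∂P) := by
            rw [lintegral_const_mul' _ _ (by simp), lintegral_add_left hm]
        _ < ∞ := ENNReal.mul_lt_top (by simp) (ENNReal.add_lt_top.2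
            ⟨(hS.lintegral_hazard_Iic_sq_le j).trans_lt (by simp), ih⟩)
  refine lt_of_le_of_lt (lintegral_mono fun ω => ?_) (key Finset.univ)
  gcongr
  exact baseKernel_univ_le ω

lemma measurable_baseKernel_univ : Measurable fun ω => baseKernel F hT hC ω univ :=
  Kernel.measurable_coe _ MeasurableSet.univ

lemma lintegral_mul_signDensity_le {K : ℝ≥0 → ℝ} {c : ℝ≥0∞} (hc : ∀ y, ‖K y‖ₑ ≤ c) (ω : Ω) :
    ∫⁻ y, ‖K y * signDensity F T C y ω‖ₑ ∂(baseKernel F hT hC ω) ≤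
      c * baseKernel F hT hC ω univ := by
  rw [← lintegral_const]
  refine lintegral_mono fun y => ?_
  rw [enorm_mul]
  refine (mul_le_of_le_one_right' ?_).trans (hc y)
  rw [Real.enorm_eq_ofReal_abs]
  exact ENNReal.ofReal_le_one.2 (abs_signDensity_le F T C y ω)

/-- Integrands dominated by the total mass of `dN + Y dΛ` have a finite absolute moment. -/
lemma IsSample.absMoment_lt_top_of_le (hS : IsSample P F G T C) {K : ℝ≥0 × Ω → ℝ} {c : ℝ≥0∞}
    (hc : c ≠ ∞) (hKc : ∀ p, ‖K p‖ₑ ≤ c * (1 + baseKernel F hT hC p.2 univ)) :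
    absMoment P F hT hC K < ∞ := by
  have h2 := hS.lintegral_baseKernel_sq_lt_top (hT := hT) (hC := hC)
  have hB := measurable_baseKernel_univ (F := F) (hT := hT) (hC := hC)
  calc absMoment P F hT hC K
      ≤ ∫⁻ ω, c * (1 + 2 * baseKernel F hT hC ω univ ^ 2) ∂P := by
        refine lintegral_mono fun ω => ?_
        refine (lintegral_mul_signDensity_le (c := c * (1 + baseKernel F hT hC ω univ))
          (fun y => hKc (y, ω)) ω).trans ?_
        rw [mul_assoc]
        gcongr
        generalize baseKernel F hT hC ω univ = b
        rcases le_total b 1 with h | h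
        · calc (1 + b) * b = b + b ^ 2 := by ring
            _ ≤ 1 + 2 * b ^ 2 := by
              gcongr
              calc b ^ 2 = 1 * b ^ 2 := (one_mul _).symm
                _ ≤ 2 * b ^ 2 := by gcongr; norm_num
        · calc (1 + b) * b ≤ (b + b) * b := by gcongr
            _ = 2 * b ^ 2 := by ring
            _ ≤ _ := le_add_self
    _ = c * (1 + 2 * ∫⁻ ω, baseKernel F hT hC ω univ ^ 2 ∂P) := by
        rw [lintegral_const_mul' _ _ hc, lintegral_add_left measurable_const,
          lintegral_const_mul' _ _ (by simp)]
        simp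
    _ < ∞ := ENNReal.mul_lt_top hc.lt_top
        (ENNReal.add_lt_top.2 ⟨by simp, ENNReal.mul_lt_top (by simp) h2⟩)

lemma IsSample.absMoment_lt_top_of_bound (hS : IsSample P F G T C) {K : ℝ≥0 × Ω → ℝ} {c : ℝ}
    (hc : ∀ p, |K p| ≤ c) : absMoment P F hT hC K < ∞ := by
  refine hS.absMoment_lt_top_of_le (c := ENNReal.ofReal c) (by simp) fun p => ?_
  rw [Real.enorm_eq_ofReal_abs]
  exact (ENNReal.ofReal_le_ofReal (hc p)).trans (le_mul_of_one_le_right' le_self_add)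

/-- The integral of a bounded process, written out over the observations. -/
lemma stochIntegral_eq_sum (hF : F {0} = 0) {ω : Ω} (hω : ω ∈ finitePaths F T C)
    {K : ℝ≥0 × Ω → ℝ} (hK : Measurable K) {c : ℝ} (hc : ∀ p, |K p| ≤ c) :
    stochIntegral F hT hC K ω = ∑ j, ((if T j ω ≤ C j ω then K (obsTime T C j ω, ω) else 0) -
      ∫ y in Iic (obsTime T C j ω), K (y, ω) ∂(hazard F)) := by
  have hfin : IsFiniteMeasure (compensatorMeasure F T C ω) := hω
  have hm : Measurable fun y => K (y, ω) := hK.comp measurable_prodMk_right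
  have hi : Integrable (fun y => K (y, ω)) (compensatorMeasure F T C ω) :=
    Integrable.of_bound hm.aestronglyMeasurable c (ae_of_all _ fun y => hc _)
  rw [stochIntegral, integral_signDensity hF hω hm hi, Finset.sum_sub_distrib]
  congr 1
  rw [compensatorMeasure_eq] at hi ⊢
  rw [integral_finsetSum_measure fun j _ => integrable_finsetSum_measure.1 hi j (Finset.mem_univ j)]

/-- A predictable integrand is free of every observation, so the counting and compensator terms
cancel index by index. -/
lemma IsSample.integral_stochIntegral_of_bound (hS : IsSample P F G T C) {K : ℝ≥0 × Ω → ℝ}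
    (hK : Measurable[(obsFiltration P T C hT hC).predictable] K) {c : ℝ} (hc : ∀ p, |K p| ≤ c) :
    ∫ ω, stochIntegral F hT hC K ω ∂P = 0 := by
  have hKm : Measurable K := hK.mono predictable_le_prod le_rfl
  have hj := fun j => hS.integral_compensation (isFreeOf_of_predictable (hT := hT) (hC := hC) j hK)
    hKm hc
  have : stochIntegral F hT hC K =ᵐ[P] fun ω =>
      ∑ j, ((if T j ω ≤ C j ω then K (obsTime T C j ω, ω) else 0) -
        ∫ y in Iic (obsTime T C j ω), K (y, ω) ∂(hazard F)) := by
    filter_upwards [hS.ae_finitePaths] with ω hω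
    exact stochIntegral_eq_sum hS.hF hω hKm hc
  have hi : ∀ j, Integrable (fun ω => (if T j ω ≤ C j ω then K (obsTime T C j ω, ω) else 0) -
      ∫ y in Iic (obsTime T C j ω), K (y, ω) ∂(hazard F)) P := fun j => (hj j).2.1.sub (hj j).1
  rw [integral_congr_ae this, integral_finsetSum _ fun j _ => hi j]
  refine Finset.sum_eq_zero fun j _ => ?_
  rw [integral_sub (hj j).2.1 (hj j).1, (hj j).2.2, sub_self]

/-- A process cut off where it is large. -/
def truncate (k : ℕ) (K : ℝ≥0 × Ω → ℝ) (p : ℝ≥0 × Ω) : ℝ := if |K p| ≤ k then K p else 0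

lemma abs_truncate_le (k : ℕ) (K : ℝ≥0 × Ω → ℝ) (p : ℝ≥0 × Ω) : |truncate k K p| ≤ k := by
  unfold truncate
  split_ifs with h
  · exact h
  · simp

lemma abs_truncate_le_abs (k : ℕ) (K : ℝ≥0 × Ω → ℝ) (p : ℝ≥0 × Ω) : |truncate k K p| ≤ |K p| := by
  unfold truncate
  split_ifs with h
  · exact le_rfl
  · simp

lemma measurable_truncate {m : MeasurableSpace (ℝ≥0 × Ω)} {K : ℝ≥0 × Ω → ℝ} (hK : Measurable[m] K)
    (k : ℕ) : Measurable[m] (truncate k K) :=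
  Measurable.ite (measurableSet_le hK.abs measurable_const) hK measurable_const

lemma eventually_truncate_eq (K : ℝ≥0 × Ω → ℝ) (p : ℝ≥0 × Ω) :
    ∀ᶠ k in Filter.atTop, truncate k K p = K p := by
  obtain ⟨k₀, hk₀⟩ := exists_nat_ge |K p|
  filter_upwards [Filter.eventually_ge_atTop k₀] with k hk
  exact if_pos (hk₀.trans (by exact_mod_cast hk))

/-- The integral of a predictable process against `dM` is centred. -/
lemma IsSample.integral_stochIntegral_eq_zero (hS : IsSample P F G T C) {K : ℝ≥0 × Ω → ℝ}
    (hK : Measurable[(obsFiltration P T C hT hC).predictable] K)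
    (hi : absMoment P F hT hC K < ∞) :
    ∫ ω, stochIntegral F hT hC K ω ∂P = 0 := by
  have hKm : Measurable K := hK.mono predictable_le_prod le_rfl
  rw [integral_stochIntegral hS.hF hKm hi]
  -- The truncations are bounded and predictable, hence centred, and the finite absolute moment
  -- dominates them.
  have hlim := tendsto_integral_of_dominated_convergence (μ := P ⊗ₘ baseKernel F hT hC)
    (F := fun (k : ℕ) (q : Ω × ℝ≥0) => truncate k K (q.2, q.1) * signDensity F T C q.2 q.1)
    (f := fun q : Ω × ℝ≥0 => K (q.2, q.1) * signDensity F T C q.2 q.1)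
    (fun q => ‖K (q.2, q.1) * signDensity F T C q.2 q.1‖)
    (fun k => (measurable_mul_signDensity hS.hF hT hC
      (measurable_truncate hKm k)).aestronglyMeasurable)
    (integrable_compProd_of_absMoment hS.hF hKm hi).norm
    (fun k => ae_of_all _ fun q => by
      rw [norm_mul, norm_mul]
      gcongr
      exact abs_truncate_le_abs k K _)
    (ae_of_all _ fun q => tendsto_const_nhds.congr' (by
      filter_upwards [eventually_truncate_eq K (q.2, q.1)] with k hk
      rw [hk]))
  refine tendsto_nhds_unique hlim (tendsto_const_nhds.congr fun k => ?_)
  have hb : ∀ p, |truncate k K p| ≤ k := abs_truncate_le k K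
  rw [← integral_stochIntegral hS.hF (measurable_truncate hKm k)
    (hS.absMoment_lt_top_of_bound hb), hS.integral_stochIntegral_of_bound
    (measurable_truncate hK k) hb]

end StochIntegral

/-! ### The isometry -/

/-- The square of an integral, split along the diagonal. -/
lemma sq_integral_eq {μ : Measure ℝ≥0} [IsFiniteMeasure μ] {g : ℝ≥0 → ℝ} (hg : Integrable g μ) :
    (∫ y, g y ∂μ) ^ 2 =
      2 * ∫ y, (∫ x in Iio y, g x ∂μ) * g y ∂μ + ∫ y, μ.real {y} * g y * g y ∂μ := by
  have hgg : Integrable (fun p : ℝ≥0 × ℝ≥0 => g p.1 * g p.2) (μ.prod μ) := hg.mul_prod hg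
  have hL : MeasurableSet {p : ℝ≥0 × ℝ≥0 | p.1 < p.2} :=
    measurableSet_lt measurable_fst measurable_snd
  have hU : MeasurableSet {p : ℝ≥0 × ℝ≥0 | p.2 < p.1} :=
    measurableSet_lt measurable_snd measurable_fst
  have hD : MeasurableSet {p : ℝ≥0 × ℝ≥0 | p.1 = p.2} :=
    measurableSet_eq_fun measurable_fst measurable_snd
  have e0 : (∫ y, g y ∂μ) ^ 2 = ∫ p, g p.1 * g p.2 ∂(μ.prod μ) := by
    rw [integral_prod_mul, sq]
  have e1 : ∀ p : ℝ≥0 × ℝ≥0, g p.1 * g p.2 =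
      ({p : ℝ≥0 × ℝ≥0 | p.1 < p.2}.indicator (fun p => g p.1 * g p.2) p +
        {p : ℝ≥0 × ℝ≥0 | p.2 < p.1}.indicator (fun p => g p.1 * g p.2) p) +
        {p : ℝ≥0 × ℝ≥0 | p.1 = p.2}.indicator (fun p => g p.1 * g p.2) p := by
    intro p
    rcases lt_trichotomy p.1 p.2 with h | h | h
    · simp [h, h.ne, h.le]
    · simp [h]
    · simp [h, h.ne', h.le]
  have iL := hgg.indicator hL
  have iU := hgg.indicator hU
  have iD := hgg.indicator hD
  have e2 : ∫ p, {p : ℝ≥0 × ℝ≥0 | p.1 < p.2}.indicator (fun p => g p.1 * g p.2) p ∂(μ.prod μ) =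
      ∫ y, (∫ x in Iio y, g x ∂μ) * g y ∂μ := by
    rw [integral_prod_symm _ iL]
    refine integral_congr_ae (ae_of_all _ fun y => ?_)
    dsimp only
    rw [← integral_mul_const, ← integral_indicator measurableSet_Iio]
    rfl
  have e3 : ∫ p, {p : ℝ≥0 × ℝ≥0 | p.2 < p.1}.indicator (fun p => g p.1 * g p.2) p ∂(μ.prod μ) =
      ∫ y, (∫ x in Iio y, g x ∂μ) * g y ∂μ := by
    rw [integral_prod _ iU]
    refine integral_congr_ae (ae_of_all _ fun y => ?_)
    dsimp only
    rw [← integral_mul_const, ← integral_indicator measurableSet_Iio]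
    refine integral_congr_ae (ae_of_all _ fun x => ?_)
    simp only [indicator_apply, mem_ofPred_eq, mem_Iio, mul_comm]
  have e4 : ∫ p, {p : ℝ≥0 × ℝ≥0 | p.1 = p.2}.indicator (fun p => g p.1 * g p.2) p ∂(μ.prod μ) =
      ∫ y, μ.real {y} * g y * g y ∂μ := by
    rw [integral_prod_symm _ iD]
    refine integral_congr_ae (ae_of_all _ fun y => ?_)
    dsimp only
    have : ∀ x, {p : ℝ≥0 × ℝ≥0 | p.1 = p.2}.indicator (fun p => g p.1 * g p.2) (x, y) =
        ({y} : Set ℝ≥0).indicator (fun x => g x * g y) x := fun x => rfl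
    simp_rw [this]
    rw [integral_indicator (measurableSet_singleton y), integral_singleton, smul_eq_mul, mul_assoc]
  have iLU : Integrable (fun p => {p : ℝ≥0 × ℝ≥0 | p.1 < p.2}.indicator (fun p => g p.1 * g p.2) p +
      {p : ℝ≥0 × ℝ≥0 | p.2 < p.1}.indicator (fun p => g p.1 * g p.2) p) (μ.prod μ) := iL.add iU
  rw [e0, integral_congr_ae (ae_of_all _ e1), integral_add iLU iD, integral_add iL iU, e2, e3, e4]
  ring

section Isometry

set_option linter.unusedSectionVars false

variable {Ω : Type*} {mΩ : MeasurableSpace Ω} {n : ℕ} {P : Measure Ω} [IsProbabilityMeasure P]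
  {F G : Measure ℝ≥0} [IsProbabilityMeasure F] [IsProbabilityMeasure G] {T C : Fin n → Ω → ℝ≥0}
  {hT : ∀ i, Measurable (T i)} {hC : ∀ i, Measurable (C i)}

lemma hazard_singleton_toReal_mem (hF : F {0} = 0) (y : ℝ≥0) :
    0 ≤ (hazard F {y}).toReal ∧ (hazard F {y}).toReal ≤ 1 :=
  ⟨ENNReal.toReal_nonneg, ENNReal.toReal_mono ENNReal.one_ne_top (hazard_singleton_le_one hF y)⟩

lemma abs_jumpAt_le (hF : F {0} = 0) (i : Fin n) (y : ℝ≥0) (ω : Ω) :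
    |jumpAt F T C i y ω| ≤ 1 := by
  obtain ⟨h0, h1⟩ := hazard_singleton_toReal_mem hF y
  unfold jumpAt
  rw [abs_le]
  split_ifs <;> constructor <;> simp <;> linarith

/-- The jump of the martingale, as the sum of the jumps of the individual martingales. -/
lemma baseKernel_singleton_mul (hF : F {0} = 0) {ω : Ω} (hω : ω ∈ finitePaths F T C) (y : ℝ≥0) :
    (baseKernel F hT hC ω).real {y} * signDensity F T C y ω = ∑ i, jumpAt F T C i y ω := by
  have h := setIntegral_signDensity hF hT hC hω (measurableSet_singleton y)
  rw [integral_singleton, smul_eq_mul, countingMeasure_singleton, compensatorMeasure_singleton] at h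
  rw [h, sum_jumpAt]

/-- The contribution of the jumps of one observation to the quadratic variation. -/
lemma IsSample.integral_stochIntegral_jumpAt (hS : IsSample P F G T C) {K : ℝ≥0 × Ω → ℝ}
    (hK : Measurable[(obsFiltration P T C hT hC).predictable] K) {c : ℝ} (hc : ∀ p, |K p| ≤ c)
    (i : Fin n) :
    ∫ ω, stochIntegral F hT hC (fun p => K p ^ 2 * jumpAt F T C i p.1 p.2) ω ∂P =
      ∫ ω, ∫ y in Iic (obsTime T C i ω), K (y, ω) ^ 2 * (1 - (hazard F {y}).toReal)
        ∂(hazard F) ∂P := by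
  have hF := hS.hF
  have hKm : Measurable K := hK.mono predictable_le_prod le_rfl
  have hJm := measurable_jumpAt hF hT hC i
  have hΛ : Measurable fun p : ℝ≥0 × Ω => (hazard F {p.1}).toReal :=
    ((measurable_hazard_singleton hF).comp measurable_fst).ennreal_toReal
  have hΛ1 : ∀ y, 0 ≤ (hazard F {y}).toReal ∧ (hazard F {y}).toReal ≤ 1 :=
    hazard_singleton_toReal_mem hF
  have hc2 : ∀ p, K p ^ 2 ≤ c ^ 2 := fun p => sq_le_sq' (abs_le.1 (hc p)).1 (abs_le.1 (hc p)).2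
  have hb : ∀ p : ℝ≥0 × Ω, |K p ^ 2 * jumpAt F T C i p.1 p.2| ≤ c ^ 2 := fun p => by
    rw [abs_mul, abs_of_nonneg (sq_nonneg _)]
    exact (mul_le_of_le_one_right (sq_nonneg _) (abs_jumpAt_le hF i _ _)).trans (hc2 p)
  have hfree := fun j => isFreeOf_of_predictable (hT := hT) (hC := hC) j hK
  have hm1 : Measurable fun p : ℝ≥0 × Ω => K p ^ 2 * (1 - 2 * (hazard F {p.1}).toReal) :=
    (hKm.pow_const 2).mul (measurable_const.sub (hΛ.const_mul 2))
  have hm2 : Measurable fun p : ℝ≥0 × Ω => K p ^ 2 * (hazard F {p.1}).toReal :=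
    (hKm.pow_const 2).mul hΛ
  have hfr1 : IsFreeOf P T C i fun p => K p ^ 2 * (1 - 2 * (hazard F {p.1}).toReal) :=
    (hfree i).comp₂ (isFreeOf_fst (measurable_hazard_singleton hF).ennreal_toReal)
      (u := fun q => q.1 ^ 2 * (1 - 2 * q.2)) (by fun_prop)
  have hfr2 : IsFreeOf P T C i fun p => K p ^ 2 * (hazard F {p.1}).toReal :=
    (hfree i).comp₂ (isFreeOf_fst (measurable_hazard_singleton hF).ennreal_toReal)
      (u := fun q => q.1 ^ 2 * q.2) (by fun_prop)
  have hc1 : ∀ p : ℝ≥0 × Ω, |K p ^ 2 * (1 - 2 * (hazard F {p.1}).toReal)| ≤ c ^ 2 := fun p => by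
    rw [abs_mul, abs_of_nonneg (sq_nonneg _)]
    refine (mul_le_of_le_one_right (sq_nonneg _) ?_).trans (hc2 p)
    rw [abs_le]
    constructor <;> linarith [(hΛ1 p.1).1, (hΛ1 p.1).2]
  have hc3 : ∀ p : ℝ≥0 × Ω, |K p ^ 2 * (hazard F {p.1}).toReal| ≤ c ^ 2 := fun p => by
    rw [abs_mul, abs_of_nonneg (sq_nonneg _)]
    refine (mul_le_of_le_one_right (sq_nonneg _) ?_).trans (hc2 p)
    rw [abs_of_nonneg (hΛ1 p.1).1]
    exact (hΛ1 p.1).2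
  obtain ⟨a1, a2, a3⟩ := hS.integral_compensation hfr1 hm1 hc1
  obtain ⟨b1, -, -⟩ := hS.integral_compensation hfr2 hm2 hc3
  -- The jump of the i-th martingale is a function of the i-th observation, so it is free of each j
  -- ≠ i. The mixed terms are therefore centred, even when F has atoms.
  have hne := fun (j : Fin n) (hj : i ≠ j) => hS.integral_compensation (j := j)
    ((hfree j).comp₂ (isFreeOf_jumpAt hF hj) (u := fun q => q.1 ^ 2 * q.2) (by fun_prop))
    ((hKm.pow_const 2).mul hJm) hb
  let R : Fin n → Ω → ℝ := fun j ω =>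
    (if T j ω ≤ C j ω then K (obsTime T C j ω, ω) ^ 2 * jumpAt F T C i (obsTime T C j ω) ω else 0) -
      ∫ y in Iic (obsTime T C j ω), K (y, ω) ^ 2 * jumpAt F T C i y ω ∂(hazard F)
  have hsum : stochIntegral F hT hC (fun p => K p ^ 2 * jumpAt F T C i p.1 p.2) =ᵐ[P]
      fun ω => ∑ j, R j ω := by
    filter_upwards [hS.ae_finitePaths] with ω hω
    exact stochIntegral_eq_sum hF hω ((hKm.pow_const 2).mul hJm) hb
  -- For j = i the jump looks at X_i itself. The counting part gives K²(1 - ΔΛ) at an uncensored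
  -- X_i. The compensator subtracts another K² ΔΛ there, from its atom at X_i, and adds ∫ K² ΔΛ dΛ.
  -- Compensating K²(1 - 2ΔΛ) and adding this integral leaves 1 - ΔΛ.
  have hRi : R i =ᵐ[P] fun ω => (if T i ω ≤ C i ω then K (obsTime T C i ω, ω) ^ 2 *
      (1 - 2 * (hazard F {obsTime T C i ω}).toReal) else 0) +
      ∫ y in Iic (obsTime T C i ω), K (y, ω) ^ 2 * (hazard F {y}).toReal ∂(hazard F) := by
    filter_upwards [hS.ae_hazard_Iic_lt_top] with ω hω
    have hfin : IsFiniteMeasure ((hazard F).restrict (Iic (obsTime T C i ω))) :=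
      ⟨by simpa using hω i⟩
    have hi2 : Integrable (fun y => K (y, ω) ^ 2 * (hazard F {y}).toReal)
        ((hazard F).restrict (Iic (obsTime T C i ω))) :=
      Integrable.of_bound (hm2.comp measurable_prodMk_right).aestronglyMeasurable (c ^ 2)
        (ae_of_all _ fun y => hc3 (y, ω))
    let e : ℝ := if T i ω ≤ C i ω then K (obsTime T C i ω, ω) ^ 2 else 0
    have hi3 : Integrable (({obsTime T C i ω} : Set ℝ≥0).indicator fun _ => e)
        ((hazard F).restrict (Iic (obsTime T C i ω))) :=
      (integrable_const e).indicator (measurableSet_singleton _)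
    have hsplit : ∫ y in Iic (obsTime T C i ω), K (y, ω) ^ 2 * jumpAt F T C i y ω ∂(hazard F) =
        (hazard F {obsTime T C i ω}).toReal * e -
        ∫ y in Iic (obsTime T C i ω), K (y, ω) ^ 2 * (hazard F {y}).toReal ∂(hazard F) := by
      have h1 : ∫ y in Iic (obsTime T C i ω), K (y, ω) ^ 2 * jumpAt F T C i y ω ∂(hazard F) =
          ∫ y in Iic (obsTime T C i ω), (({obsTime T C i ω} : Set ℝ≥0).indicator (fun _ => e) y -
            K (y, ω) ^ 2 * (hazard F {y}).toReal) ∂(hazard F) := by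
        refine setIntegral_congr_fun measurableSet_Iic fun y hy => ?_
        have hy' : y ≤ obsTime T C i ω := hy
        simp only [jumpAt, indicator_apply, mem_singleton_iff, e, hy', if_true]
        by_cases hyX : y = obsTime T C i ω
        · subst hyX
          by_cases hΔ : T i ω ≤ C i ω
          · simp only [hΔ, and_self, if_true]
            ring
          · simp [hΔ]
        · simp [hyX, Ne.symm hyX]
      rw [h1, integral_sub hi3 hi2, integral_indicator_const _ (measurableSet_singleton _),
        smul_eq_mul, measureReal_restrict_apply (measurableSet_singleton _),
        inter_eq_left.2 (singleton_subset_iff.2 self_mem_Iic), measureReal_def]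
    simp only [R]
    rw [hsplit]
    simp only [e, jumpAt, le_refl, if_true, true_and]
    split_ifs <;> ring
  have hRint : ∀ j, Integrable (R j) P := by
    intro j
    by_cases hj : i = j
    · subst hj
      exact (a2.add b1).congr hRi.symm
    · exact (hne j hj).2.1.sub (hne j hj).1
  rw [integral_congr_ae hsum, integral_finsetSum _ fun j _ => hRint j,
    Finset.sum_eq_single i, integral_congr_ae hRi, integral_add a2 b1, a3, ← integral_add a1 b1]
  · refine integral_congr_ae ?_
    filter_upwards [hS.ae_hazard_Iic_lt_top] with ω hω
    have hfin : IsFiniteMeasure ((hazard F).restrict (Iic (obsTime T C i ω))) :=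
      ⟨by simpa using hω i⟩
    have i1 : Integrable (fun y => K (y, ω) ^ 2 * (1 - 2 * (hazard F {y}).toReal))
        ((hazard F).restrict (Iic (obsTime T C i ω))) :=
      Integrable.of_bound (hm1.comp measurable_prodMk_right).aestronglyMeasurable (c ^ 2)
        (ae_of_all _ fun y => hc1 (y, ω))
    have i2 : Integrable (fun y => K (y, ω) ^ 2 * (hazard F {y}).toReal)
        ((hazard F).restrict (Iic (obsTime T C i ω))) :=
      Integrable.of_bound (hm2.comp measurable_prodMk_right).aestronglyMeasurable (c ^ 2)
        (ae_of_all _ fun y => hc3 (y, ω))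
    rw [← integral_add i1 i2]
    refine integral_congr_ae (ae_of_all _ fun y => ?_)
    ring
  · intro j _ hj
    have h := hne j hj.symm
    exact (integral_sub h.2.1 h.1).trans (by rw [h.2.2, sub_self])
  · simp

lemma measurable_atRisk_path (ω : Ω) : Measurable fun y => (atRisk T C y ω : ℝ≥0∞) := by
  simp only [atRisk, Nat.cast_sum]
  refine Finset.measurable_sum _ fun i _ => ?_
  simp only [Nat.cast_ite, Nat.cast_one, Nat.cast_zero]
  exact Measurable.ite (measurableSet_le measurable_id measurable_const)
    measurable_const measurable_const

lemma lintegral_varM (hF : F {0} = 0) (ω : Ω) {g : ℝ≥0 → ℝ≥0∞} (hg : Measurable g) :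
    ∫⁻ y, g y ∂(varM F T C ω) = ∫⁻ y, (1 - hazard F {y}) * g y ∂(compensatorMeasure F T C ω) := by
  have h1 : Measurable fun y => 1 - hazard F {y} :=
    measurable_const.sub (measurable_hazard_singleton hF)
  have h2 := measurable_atRisk_path (T := T) (C := C) ω
  have h3 : Measurable fun y => (1 - hazard F {y}) * (atRisk T C y ω : ℝ≥0∞) := h1.mul h2
  have h4 : Measurable fun y => (1 - hazard F {y}) * g y := h1.mul hg
  rw [varM, compensatorMeasure, lintegral_withDensity_eq_lintegral_mul _ h3 hg,
    lintegral_withDensity_eq_lintegral_mul _ h2 h4]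
  refine lintegral_congr fun y => ?_
  simp only [Pi.mul_apply]
  ring

/-- The isometry for bounded integrands. -/
lemma IsSample.lintegral_stochIntegral_sq_of_bound (hS : IsSample P F G T C) {K : ℝ≥0 × Ω → ℝ}
    (hK : Measurable[(obsFiltration P T C hT hC).predictable] K) {c : ℝ} (hc : ∀ p, |K p| ≤ c)
    (h0 : ∀ ω, K (0, ω) = 0) :
    ∫⁻ ω, ‖stochIntegral F hT hC K ω‖ₑ ^ 2 ∂P = varMoment P F T C K := by
  have hF := hS.hF
  have hKm : Measurable K := hK.mono predictable_le_prod le_rfl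
  have hcn : ∀ p, ‖K p‖ₑ ≤ ENNReal.ofReal c := fun p => by
    rw [Real.enorm_eq_ofReal_abs]
    exact ENNReal.ofReal_le_ofReal (hc p)
  -- With f(x,y) = K(x) K(y) on x < y, the process H(y) = K(y) ∫_{(0,y)} K dM is an inner integral
  -- and hence predictable; the off-diagonal part of the square is 2 ∫ H dM.
  let f : ℝ≥0 × ℝ≥0 × Ω → ℝ := fun q => (orderedPairs Ω).indicator (fun q => K (q.1, q.2.2)) q *
    (orderedPairs Ω).indicator (fun q => K q.2) q
  have hf : Measurable[twoTimePredictable (obsFiltration P T C hT hC)] f :=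
    (measurable_orderedPairs_fst hK).mul (measurable_orderedPairs_snd hK)
  have hf0 : ∀ q ∉ orderedPairs Ω, f q = 0 := fun q hq => by simp [f, hq]
  let H : ℝ≥0 × Ω → ℝ := fun p =>
    ∫ x, f (x, p) * signDensity F T C x p.2 ∂(baseKernel F hT hC p.2)
  have hH : Measurable[(obsFiltration P T C hT hC).predictable] H :=
    measurable_inner_predictable hS hf hf0
  have hHm : Measurable H := hH.mono predictable_le_prod le_rfl
  have hfc : ∀ q, ‖f q‖ₑ ≤ ENNReal.ofReal c * ENNReal.ofReal c := fun q => by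
    by_cases hq : q ∈ orderedPairs Ω
    · simp only [f, indicator_of_mem hq, enorm_mul]
      gcongr
      · exact hcn _
      · exact hcn _
    · simp [hf0 q hq]
  have hHi : absMoment P F hT hC H < ∞ := by
    refine hS.absMoment_lt_top_of_le (c := ENNReal.ofReal c * ENNReal.ofReal c)
      (ENNReal.mul_ne_top (by simp) (by simp)) fun p => ?_
    refine (enorm_integral_le_lintegral_enorm _).trans ?_
    refine (lintegral_mul_signDensity_le (fun x => hfc (x, p)) p.2).trans ?_
    gcongr
    exact le_add_self
  have hJ : ∀ i, Measurable fun p : ℝ≥0 × Ω => K p ^ 2 * jumpAt F T C i p.1 p.2 := fun i =>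
    (hKm.pow_const 2).mul (measurable_jumpAt hF hT hC i)
  have hJb : ∀ i, ∀ p : ℝ≥0 × Ω, |K p ^ 2 * jumpAt F T C i p.1 p.2| ≤ c ^ 2 := fun i p => by
    rw [abs_mul, abs_of_nonneg (sq_nonneg _)]
    exact (mul_le_of_le_one_right (sq_nonneg _) (abs_jumpAt_le hF i _ _)).trans
      (sq_le_sq' (abs_le.1 (hc p)).1 (abs_le.1 (hc p)).2)
  have hJi : ∀ i, absMoment P F hT hC (fun p => K p ^ 2 * jumpAt F T C i p.1 p.2) < ∞ := fun i =>
    hS.absMoment_lt_top_of_bound (hJb i)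
  have hsq : (fun ω => stochIntegral F hT hC K ω ^ 2) =ᵐ[P] fun ω =>
      2 * stochIntegral F hT hC H ω +
        ∑ i, stochIntegral F hT hC (fun p => K p ^ 2 * jumpAt F T C i p.1 p.2) ω := by
    filter_upwards [hS.ae_finitePaths, ae_all_iff.2 fun i =>
      ae_integrable_of_absMoment hF (hJ i) (hJi i), ae_integrable_of_absMoment hF hKm
      (hS.absMoment_lt_top_of_bound (hT := hT) (hC := hC) hc)] with ω hω hi hg
    rw [stochIntegral, sq_integral_eq hg]
    congr 2
    · refine integral_congr_ae (ae_of_all _ fun y => ?_)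
      dsimp only
      rw [← mul_assoc]
      congr 1
      rw [← integral_mul_const, ← integral_indicator measurableSet_Iio]
      refine integral_congr_ae (ae_of_all _ fun x => ?_)
      dsimp only
      by_cases hxy : x < y
      · rw [indicator_of_mem (show x ∈ Iio y from hxy)]
        -- The off-diagonal term integrates over [0,y), while `f` vanishes at x = 0; `h0` makes the
        -- two agree.
        rcases eq_or_ne x 0 with rfl | hx
        · have : ((0, y, ω) : ℝ≥0 × ℝ≥0 × Ω) ∉ orderedPairs Ω := fun h => lt_irrefl _ h.1
          rw [hf0 _ this, h0]
          simp
        · have : ((x, y, ω) : ℝ≥0 × ℝ≥0 × Ω) ∈ orderedPairs Ω := ⟨pos_iff_ne_zero.2 hx, hxy⟩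
          simp only [f, indicator_of_mem this]
          ring
      · rw [indicator_of_notMem (show x ∉ Iio y from hxy),
          hf0 (x, y, ω) fun h => hxy h.2, zero_mul]
    · simp only [stochIntegral]
      rw [← integral_finsetSum _ fun i _ => hi i]
      refine integral_congr_ae (ae_of_all _ fun y => ?_)
      have hB := baseKernel_singleton_mul (hT := hT) (hC := hC) hF hω y
      dsimp only
      rw [← Finset.sum_mul, ← Finset.mul_sum, ← hB]
      ring
  have hIJ := fun i => integrable_stochIntegral hF (hJ i) (hJi i)
  have hIH := integrable_stochIntegral hF hHm hHi
  have hsumi : Integrable (fun ω =>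
      ∑ i, stochIntegral F hT hC (fun p => K p ^ 2 * jumpAt F T C i p.1 p.2) ω) P :=
    integrable_finsetSum _ fun i _ => hIJ i
  have hsqi : Integrable (fun ω => stochIntegral F hT hC K ω ^ 2) P :=
    ((hIH.const_mul 2).add hsumi).congr hsq.symm
  have hΛ : Measurable fun y : ℝ≥0 => (hazard F {y}).toReal :=
    (measurable_hazard_singleton hF).ennreal_toReal
  have hΛ1 : ∀ y, 0 ≤ (hazard F {y}).toReal ∧ (hazard F {y}).toReal ≤ 1 :=
    hazard_singleton_toReal_mem hF
  have hLm : Measurable fun p : ℝ≥0 × Ω => K p ^ 2 * (1 - (hazard F {p.1}).toReal) :=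
    (hKm.pow_const 2).mul (measurable_const.sub (hΛ.comp measurable_fst))
  have hLb : ∀ p : ℝ≥0 × Ω, |K p ^ 2 * (1 - (hazard F {p.1}).toReal)| ≤ c ^ 2 := fun p => by
    rw [abs_mul, abs_of_nonneg (sq_nonneg _), abs_of_nonneg (by linarith [(hΛ1 p.1).2])]
    exact (mul_le_of_le_one_right (sq_nonneg _) (by linarith [(hΛ1 p.1).1])).trans
      (sq_le_sq' (abs_le.1 (hc p)).1 (abs_le.1 (hc p)).2)
  have hL0 : ∀ p : ℝ≥0 × Ω, 0 ≤ K p ^ 2 * (1 - (hazard F {p.1}).toReal) := fun p =>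
    mul_nonneg (sq_nonneg _) (by linarith [(hΛ1 p.1).2])
  have hLi := fun i => (hS.integral_compensation (j := i)
    ((isFreeOf_of_predictable (hT := hT) (hC := hC) i hK).comp₂
      (isFreeOf_fst hΛ) (u := fun q => q.1 ^ 2 * (1 - q.2)) (by fun_prop)) hLm hLb).1
  have hint : ∫ ω, stochIntegral F hT hC K ω ^ 2 ∂P =
      ∑ i, ∫ ω, ∫ y in Iic (obsTime T C i ω), K (y, ω) ^ 2 * (1 - (hazard F {y}).toReal)
        ∂(hazard F) ∂P := by
    rw [integral_congr_ae hsq, integral_add (hIH.const_mul 2) hsumi, integral_const_mul,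
      hS.integral_stochIntegral_eq_zero hH hHi, mul_zero, zero_add,
      integral_finsetSum _ fun i _ => hIJ i]
    exact Finset.sum_congr rfl fun i _ => hS.integral_stochIntegral_jumpAt hK hc i
  have hnorm : ∀ a : ℝ, ‖a‖ₑ ^ 2 = ENNReal.ofReal (a ^ 2) := fun a => by
    rw [Real.enorm_eq_ofReal_abs, ← ENNReal.ofReal_pow (abs_nonneg _), sq_abs]
  have hterm : ∀ i, Measurable fun ω => ∫⁻ y in Iic (obsTime T C i ω),
      ENNReal.ofReal (K (y, ω) ^ 2 * (1 - (hazard F {y}).toReal)) ∂(hazard F) := by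
    intro i
    have hset : MeasurableSet {q : Ω × ℝ≥0 | q.2 ≤ obsTime T C i q.1} :=
      measurableSet_le measurable_snd ((measurable_obsTime hT hC i).comp measurable_fst)
    have := (((hLm.comp measurable_swap).ennreal_ofReal).indicator hset).lintegral_prod_right'
      (ν := hazard F)
    convert this using 2 with ω
    rw [← lintegral_indicator measurableSet_Iic]
    rfl
  simp_rw [hnorm]
  rw [← ofReal_integral_eq_lintegral_ofReal hsqi (ae_of_all _ fun ω => sq_nonneg _), hint,
    ENNReal.ofReal_sum_of_nonneg fun i _ => integral_nonneg fun ω => integral_nonneg fun y =>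
      hL0 (y, ω), varMoment]
  have hR : ∀ ω, ∫⁻ y, ‖K (y, ω)‖ₑ ^ 2 ∂(varM F T C ω) = ∑ i, ∫⁻ y in Iic (obsTime T C i ω),
      ENNReal.ofReal (K (y, ω) ^ 2 * (1 - (hazard F {y}).toReal)) ∂(hazard F) := by
    intro ω
    have hm : Measurable fun y => ‖K (y, ω)‖ₑ ^ 2 :=
      ((hKm.comp measurable_prodMk_right).enorm).pow_const 2
    rw [lintegral_varM hF ω hm, lintegral_compensatorMeasure]
    refine Finset.sum_congr rfl fun i _ => lintegral_congr fun y => ?_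
    rw [hnorm, ENNReal.ofReal_mul (sq_nonneg _), ENNReal.ofReal_sub _ (hΛ1 y).1,
      ENNReal.ofReal_one, ENNReal.ofReal_toReal, mul_comm]
    exact ne_top_of_le_ne_top ENNReal.one_ne_top (hazard_singleton_le_one hF y)
  simp_rw [hR]
  rw [lintegral_finsetSum _ fun i _ => hterm i]
  refine Finset.sum_congr rfl fun i _ => ?_
  rw [ofReal_integral_eq_lintegral_ofReal (hLi i)
    (ae_of_all _ fun ω => integral_nonneg fun y => hL0 (y, ω))]
  refine lintegral_congr_ae ?_
  filter_upwards [hS.ae_hazard_Iic_lt_top] with ω hω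
  have hfin : IsFiniteMeasure ((hazard F).restrict (Iic (obsTime T C i ω))) :=
    ⟨by simpa using hω i⟩
  refine ofReal_integral_eq_lintegral_ofReal ?_ (ae_of_all _ fun y => hL0 (y, ω))
  exact Integrable.of_bound (hLm.comp measurable_prodMk_right).aestronglyMeasurable (c ^ 2)
    (ae_of_all _ fun y => hLb (y, ω))

end Isometry

/-! ### Predictable processes at fixed times and over past events. -/

section General

variable {Ω : Type*} {mΩ : MeasurableSpace Ω} {𝓕 : Filtration ℝ≥0 mΩ}

/-- A predictable process is adapted: the section at time t factors through [0,t] × Ω, where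
predictable sets are measurable for 𝓕 t. -/
lemma measurable_prodMk_left_predictable (t : ℝ≥0) :
    @Measurable Ω (ℝ≥0 × Ω) (𝓕 t) 𝓕.predictable fun ω => (t, ω) := by
  have h1 : @Measurable Ω (Set.Iic t × Ω) (𝓕 t) (Subtype.instMeasurableSpace.prod (𝓕 t))
      fun ω => (⟨t, self_mem_Iic⟩, ω) := by
    let _ : MeasurableSpace Ω := 𝓕 t
    exact measurable_const.prodMk measurable_id
  exact (measurable_inclusion_predictable (𝓕 := 𝓕) (i := t)).comp h1

lemma measurable_indicator_Ioc_predictable {s t : ℝ≥0} {A : Set Ω} (hA : MeasurableSet[𝓕 s] A)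
    {K : ℝ≥0 × Ω → ℝ} (hK : Measurable[𝓕.predictable] K) :
    Measurable[𝓕.predictable] ((Ioc s t ×ˢ A).indicator K) :=
  hK.indicator (measurableSet_predictable_Ioc_prod s t hA)

lemma enorm_le_of_abs_le {a b : ℝ} (h : |a| ≤ |b|) : ‖a‖ₑ ≤ ‖b‖ₑ := by
  rw [Real.enorm_eq_ofReal_abs, Real.enorm_eq_ofReal_abs]
  exact ENNReal.ofReal_le_ofReal h

lemma eLpNorm_two_eq {P : Measure Ω} (g : Ω → ℝ) :
    eLpNorm g 2 P = (∫⁻ ω, ‖g ω‖ₑ ^ 2 ∂P) ^ (1 / 2 : ℝ) := by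
  rw [eLpNorm_eq_lintegral_rpow_enorm_toReal (by simp) (by simp)]
  simp

end General

/-! ### The isometry for unbounded integrands and the adaptedness of running integrals. -/

section Isometry

set_option linter.unusedSectionVars false

variable {Ω : Type*} {mΩ : MeasurableSpace Ω} {n : ℕ} {P : Measure Ω} [IsProbabilityMeasure P]
  {F G : Measure ℝ≥0} [IsProbabilityMeasure F] [IsProbabilityMeasure G] {T C : Fin n → Ω → ℝ≥0}
  {hT : ∀ i, Measurable (T i)} {hC : ∀ i, Measurable (C i)}

lemma absMoment_mono {K L : ℝ≥0 × Ω → ℝ} (h : ∀ p, |K p| ≤ |L p|) :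
    absMoment P F hT hC K ≤ absMoment P F hT hC L := by
  refine lintegral_mono fun ω => lintegral_mono fun y => ?_
  rw [enorm_mul, enorm_mul]
  gcongr
  exact enorm_le_of_abs_le (h _)

lemma varMoment_mono {K L : ℝ≥0 × Ω → ℝ} (h : ∀ p, |K p| ≤ |L p|) :
    varMoment P F T C K ≤ varMoment P F T C L := by
  refine lintegral_mono fun ω => lintegral_mono fun y => ?_
  gcongr
  exact enorm_le_of_abs_le (h _)

lemma varMoment_eq (hF : F {0} = 0) (hT : ∀ i, Measurable (T i)) (hC : ∀ i, Measurable (C i))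
    {K : ℝ≥0 × Ω → ℝ} (hK : Measurable K) :
    varMoment P F T C K = ∫⁻ q, (1 - hazard F {q.2}) * ‖K (q.2, q.1)‖ₑ ^ 2
      ∂(P ⊗ₘ compensatorKernel mΩ F T C) := by
  have hm : Measurable fun q : Ω × ℝ≥0 => (1 - hazard F {q.2}) * ‖K (q.2, q.1)‖ₑ ^ 2 :=
    (measurable_const.sub ((measurable_hazard_singleton hF).comp measurable_snd)).mul
      ((hK.comp measurable_swap).enorm.pow_const 2)
  rw [Measure.lintegral_compProd hm]
  refine lintegral_congr fun ω => ?_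
  have hg : Measurable fun y => ‖K (y, ω)‖ₑ ^ 2 :=
    ((hK.comp measurable_prodMk_right).enorm).pow_const 2
  rw [lintegral_varM hF ω hg, compensatorKernel_apply hT hC]

/-- Dominated convergence for `E ∫ K² d⟨M⟩`. -/
lemma tendsto_varMoment (hF : F {0} = 0) (hT : ∀ i, Measurable (T i)) (hC : ∀ i, Measurable (C i))
    {L : ℕ → ℝ≥0 × Ω → ℝ} {K D : ℝ≥0 × Ω → ℝ}
    (hL : ∀ k, Measurable (L k)) (hK : Measurable K) (hD : Measurable D)
    (hbound : ∀ k p, |L k p| ≤ |D p|) (hfin : varMoment P F T C D < ∞)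
    (hlim : ∀ p, ∀ᶠ k in Filter.atTop, L k p = K p) :
    Filter.Tendsto (fun k => varMoment P F T C (L k)) Filter.atTop
      (nhds (varMoment P F T C K)) := by
  rw [varMoment_eq hF hT hC hD] at hfin
  simp_rw [varMoment_eq hF hT hC (hL _), varMoment_eq hF hT hC hK]
  refine tendsto_lintegral_of_dominated_convergence
    (fun q => (1 - hazard F {q.2}) * ‖D (q.2, q.1)‖ₑ ^ 2) (fun k => ?_)
    (fun k => ae_of_all _ fun q => ?_) hfin.ne (ae_of_all _ fun q => ?_)
  · exact (measurable_const.sub ((measurable_hazard_singleton hF).comp measurable_snd)).mul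
      (((hL k).comp measurable_swap).enorm.pow_const 2)
  · dsimp only
    gcongr
    exact enorm_le_of_abs_le (hbound _ _)
  · refine tendsto_const_nhds.congr' ?_
    filter_upwards [hlim (q.2, q.1)] with k hk
    rw [hk]

/-- One half of the isometry, for integrands with a finite absolute moment. -/
lemma IsSample.lintegral_stochIntegral_sq_le (hS : IsSample P F G T C) {K : ℝ≥0 × Ω → ℝ}
    (hK : Measurable[(obsFiltration P T C hT hC).predictable] K) (h0 : ∀ ω, K (0, ω) = 0)
    (hi : absMoment P F hT hC K < ∞) :
    ∫⁻ ω, ‖stochIntegral F hT hC K ω‖ₑ ^ 2 ∂P ≤ varMoment P F T C K := by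
  have hKm : Measurable K := hK.mono predictable_le_prod le_rfl
  have hlim : ∀ᵐ ω ∂P, Filter.Tendsto (fun k => ‖stochIntegral F hT hC (truncate k K) ω‖ₑ ^ 2)
      Filter.atTop (nhds (‖stochIntegral F hT hC K ω‖ₑ ^ 2)) := by
    filter_upwards [ae_integrable_of_absMoment hS.hF hKm hi] with ω hω
    have : Filter.Tendsto (fun k => stochIntegral F hT hC (truncate k K) ω) Filter.atTop
        (nhds (stochIntegral F hT hC K ω)) := by
      refine tendsto_integral_of_dominated_convergence
        (fun y => ‖K (y, ω) * signDensity F T C y ω‖) (fun k => ?_) hω.norm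
        (fun k => ae_of_all _ fun y => ?_) (ae_of_all _ fun y => ?_)
      · exact ((measurable_mul_signDensity hS.hF hT hC
          (measurable_truncate hKm k)).comp measurable_prodMk_left).aestronglyMeasurable
      · rw [norm_mul, norm_mul]
        gcongr
        exact abs_truncate_le_abs k K _
      · refine tendsto_const_nhds.congr' ?_
        filter_upwards [eventually_truncate_eq K (y, ω)] with k hk
        rw [hk]
    exact ((ENNReal.continuous_pow 2).tendsto _).comp
      ((continuous_enorm.tendsto _).comp this)
  -- Fatou along the truncations, whose second moments are given by the bounded isometry.
  calc ∫⁻ ω, ‖stochIntegral F hT hC K ω‖ₑ ^ 2 ∂P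
      = ∫⁻ ω, Filter.liminf (fun k => ‖stochIntegral F hT hC (truncate k K) ω‖ₑ ^ 2)
          Filter.atTop ∂P := by
        refine lintegral_congr_ae ?_
        filter_upwards [hlim] with ω hω
        exact hω.liminf_eq.symm
    _ ≤ Filter.liminf (fun k => ∫⁻ ω, ‖stochIntegral F hT hC (truncate k K) ω‖ₑ ^ 2 ∂P)
          Filter.atTop := lintegral_liminf_le fun k =>
        (measurable_stochIntegral hS.hF (measurable_truncate hKm k)).enorm.pow_const 2
    _ ≤ varMoment P F T C K := by
        refine Filter.liminf_le_of_frequently_le' (Filter.Frequently.of_forall fun k => ?_)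
        rw [hS.lintegral_stochIntegral_sq_of_bound (measurable_truncate hK k)
          (abs_truncate_le k K) (fun ω => by simp [truncate, h0])]
        exact varMoment_mono (abs_truncate_le_abs k K)

/-- The isometry `E (∫ K dM)² = E ∫ K² d⟨M⟩`. -/
lemma IsSample.lintegral_stochIntegral_sq (hS : IsSample P F G T C) {K : ℝ≥0 × Ω → ℝ}
    (hK : Measurable[(obsFiltration P T C hT hC).predictable] K) (h0 : ∀ ω, K (0, ω) = 0)
    (hi : absMoment P F hT hC K < ∞) (hv : varMoment P F T C K < ∞) :
    ∫⁻ ω, ‖stochIntegral F hT hC K ω‖ₑ ^ 2 ∂P = varMoment P F T C K := by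
  have hF := hS.hF
  have hKm : Measurable K := hK.mono predictable_le_prod le_rfl
  refine le_antisymm (hS.lintegral_stochIntegral_sq_le hK h0 hi) ?_
  -- For the converse, the triangle inequality in L² bounds the norm of the truncated integral by
  -- that of ∫ K dM plus that of ∫ D_k dM. The last is controlled by the half already proved, and E
  -- ∫ D_k² d⟨M⟩ → 0.
  let D : ℕ → ℝ≥0 × Ω → ℝ := fun k p => K p - truncate k K p
  have hD : ∀ k, Measurable[(obsFiltration P T C hT hC).predictable] (D k) := fun k =>
    hK.sub (measurable_truncate hK k)
  have hDm : ∀ k, Measurable (D k) := fun k => (hD k).mono predictable_le_prod le_rfl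
  have hDle : ∀ k p, |D k p| ≤ |K p| := fun k p => by
    simp only [D, truncate]
    split_ifs <;> simp
  have hDi : ∀ k, absMoment P F hT hC (D k) < ∞ := fun k => (absMoment_mono (hDle k)).trans_lt hi
  have hTi : ∀ k, absMoment P F hT hC (truncate k K) < ∞ := fun k =>
    (absMoment_mono (abs_truncate_le_abs k K)).trans_lt hi
  have hD0 : Filter.Tendsto (fun k => varMoment P F T C (D k)) Filter.atTop (nhds 0) := by
    have h := tendsto_varMoment (P := P) (F := F) (K := fun _ => 0) hF hT hC hDm measurable_const
      hKm hDle hv fun p => by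
        filter_upwards [eventually_truncate_eq K p] with k hk
        simp [D, hk]
    simpa [varMoment] using h
  have hVk := tendsto_varMoment (P := P) (F := F) hF hT hC (fun k => measurable_truncate hKm k)
    hKm hKm (abs_truncate_le_abs · K) hv (eventually_truncate_eq K)
  have hle : ∀ k, varMoment P F T C (truncate k K) ^ (1 / 2 : ℝ) ≤
      (∫⁻ ω, ‖stochIntegral F hT hC K ω‖ₑ ^ 2 ∂P) ^ (1 / 2 : ℝ) +
        varMoment P F T C (D k) ^ (1 / 2 : ℝ) := by
    intro k
    rw [← hS.lintegral_stochIntegral_sq_of_bound (measurable_truncate hK k)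
          (abs_truncate_le k K) (fun ω => by simp [truncate, h0]), ← eLpNorm_two_eq,
      ← eLpNorm_two_eq]
    have heq : stochIntegral F hT hC (truncate k K) =ᵐ[P]
        stochIntegral F hT hC K - stochIntegral F hT hC (D k) := by
      filter_upwards [ae_integrable_of_absMoment hF hKm hi,
        ae_integrable_of_absMoment hF (hDm k) (hDi k)] with ω h1 h2
      simp only [Pi.sub_apply, stochIntegral]
      rw [← integral_sub h1 h2]
      refine integral_congr_ae (ae_of_all _ fun y => ?_)
      simp only [D]
      ring
    rw [eLpNorm_congr_ae heq]
    refine (eLpNorm_sub_le (measurable_stochIntegral hF hKm).aestronglyMeasurable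
      (measurable_stochIntegral hF (hDm k)).aestronglyMeasurable (by norm_num)).trans ?_
    gcongr
    rw [eLpNorm_two_eq]
    gcongr
    exact hS.lintegral_stochIntegral_sq_le (hD k) (fun ω => by simp [D, truncate, h0]) (hDi k)
  have hhalf : (0 : ℝ) < 1 / 2 := by norm_num
  have hr := (ENNReal.continuous_rpow_const (y := (1 / 2 : ℝ))).tendsto
  have h1 := (hr _).comp hVk
  have h2 := ((hr _).comp hD0).const_add ((∫⁻ ω, ‖stochIntegral F hT hC K ω‖ₑ ^ 2 ∂P) ^ (1 / 2 : ℝ))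
  rw [ENNReal.zero_rpow_of_pos hhalf, add_zero] at h2
  exact (ENNReal.rpow_le_rpow_iff hhalf).1 (le_of_tendsto_of_tendsto' h1 h2 hle)

lemma measurable_jumpAt_obsFiltration (i : Fin n) (t : ℝ≥0) :
    Measurable[obsFiltration P T C hT hC t] fun ω => jumpAt F T C i t ω := by
  have h1 : MeasurableSet[obsFiltration P T C hT hC t] {ω | obsTime T C i ω < t ∧ ω ∈ univ} :=
    measurable_prodMk_left_predictable t (measurableSet_predictable_lt
      (measurableSet_obsFiltration_obsTime (P := P) (hT := hT) (hC := hC) i))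
  have h2 := measurableSet_obsFiltration_uncensored (P := P) (hT := hT) (hC := hC) i t
  unfold jumpAt
  refine (Measurable.ite ?_ measurable_const measurable_const).sub
    (measurable_const.mul (Measurable.ite ?_ measurable_const measurable_const))
  · convert h2.diff h1 using 1
    ext ω
    simp only [mem_ofPred_eq, mem_sdiff, mem_univ, and_true, not_lt]
    constructor
    · rintro ⟨h, h'⟩
      exact ⟨⟨h.le, h'⟩, h.ge⟩
    · rintro ⟨⟨h, h'⟩, h''⟩
      exact ⟨le_antisymm h h'', h'⟩
  · convert h1.compl using 1
    ext ω
    simp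

/-- The integral over (0,t) is the inner integral of the two-time process K(x), constant in y,
evaluated at y = t; inner integrals are predictable. -/
lemma IsSample.measurable_stochIntegral_Ioo (hS : IsSample P F G T C) {K : ℝ≥0 × Ω → ℝ}
    (hK : Measurable[(obsFiltration P T C hT hC).predictable] K) (t : ℝ≥0) :
    Measurable[obsFiltration P T C hT hC t]
      (stochIntegral F hT hC ((Ioo 0 t ×ˢ univ).indicator K)) := by
  have hH := measurable_inner_predictable (F := F) hS (measurable_orderedPairs_fst hK)
    fun q hq => indicator_of_notMem hq _
  have h1 := hH.comp (measurable_prodMk_left_predictable t)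
  convert h1 using 1
  ext ω
  refine integral_congr_ae (ae_of_all _ fun x => ?_)
  simp [indicator_apply, orderedPairs]

/-- The running integral of a predictable process is adapted. -/
lemma IsSample.measurable_stochIntegral_Ioc (hS : IsSample P F G T C) {K : ℝ≥0 × Ω → ℝ}
    (hK : Measurable[(obsFiltration P T C hT hC).predictable] K) {t : ℝ≥0}
    (hi : absMoment P F hT hC ((Ioc 0 t ×ˢ univ).indicator K) < ∞) :
    Measurable[obsFiltration P T C hT hC t]
      (stochIntegral F hT hC ((Ioc 0 t ×ˢ univ).indicator K)) := by
  have hF := hS.hF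
  have hKt := measurable_indicator_Ioc_predictable (s := 0) (t := t)
    (@MeasurableSet.univ Ω (obsFiltration P T C hT hC 0)) hK
  have hKm := hKt.mono predictable_le_prod le_rfl
  rcases eq_or_ne t 0 with rfl | ht
  · have : stochIntegral F hT hC ((Ioc 0 0 ×ˢ univ).indicator K) = fun _ => 0 := by
      ext ω
      simp [stochIntegral]
    rw [this]
    exact measurable_const
  have h1 := hS.measurable_stochIntegral_Ioo hK t
  have h2 : Measurable[obsFiltration P T C hT hC t] fun ω => K (t, ω) :=
    hK.comp (measurable_prodMk_left_predictable t)
  have h3 : Measurable[obsFiltration P T C hT hC t] fun ω => ∑ i, jumpAt F T C i t ω :=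
    Finset.measurable_sum _ fun i _ => measurable_jumpAt_obsFiltration i t
  -- The endpoint is split off: the integral over (0,t] is the one over (0,t) plus K(t) ΔM(t). This
  -- holds almost surely, which suffices because the filtration is complete.
  refine measurable_obsFiltration_congr (h1.add (h2.mul h3)) (measurable_stochIntegral hF hKm) ?_
  filter_upwards [hS.ae_finitePaths, ae_integrable_of_absMoment hF hKm hi] with ω hω hint
  have e1 : ∀ y, (Ioc 0 t ×ˢ univ).indicator K (y, ω) * signDensity F T C y ω =
      (Ioo 0 t ×ˢ univ).indicator K (y, ω) * signDensity F T C y ω +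
        ({t} : Set ℝ≥0).indicator (fun y => K (y, ω) * signDensity F T C y ω) y := by
    intro y
    rcases lt_trichotomy y t with h | h | h
    · simp [indicator_apply, h, h.le, h.ne]
    · subst h
      simp [pos_iff_ne_zero.2 ht]
    · simp [h.not_ge, h.ne', h.not_gt]
  have i2 : Integrable (({t} : Set ℝ≥0).indicator fun y => K (y, ω) * signDensity F T C y ω)
      (baseKernel F hT hC ω) := by
    refine (integrable_indicator_iff (measurableSet_singleton t)).2 ?_
    exact integrableOn_singleton enorm_ne_top (measure_lt_top _ _)
  have i1 : Integrable (fun y => (Ioo 0 t ×ˢ univ).indicator K (y, ω) * signDensity F T C y ω) (baseKernel F hT hC ω) :=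
    (hint.sub i2).congr (ae_of_all _ fun y => by
      simp only [Pi.sub_apply, e1]
      ring)
  simp only [Pi.add_apply, Pi.mul_apply, stochIntegral, e1]
  rw [integral_add i1 i2, integral_indicator (measurableSet_singleton t), integral_singleton,
    ← baseKernel_singleton_mul (hT := hT) (hC := hC) hF hω t, smul_eq_mul]
  ring

end Isometry

/-! ### Running integrals as martingales -/

section Running

set_option linter.unusedSectionVars false

variable {Ω : Type*} {mΩ : MeasurableSpace Ω} {n : ℕ} {P : Measure Ω} [IsProbabilityMeasure P]
  {F G : Measure ℝ≥0} [IsProbabilityMeasure F] [IsProbabilityMeasure G] {T C : Fin n → Ω → ℝ≥0}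
  {hT : ∀ i, Measurable (T i)} {hC : ∀ i, Measurable (C i)}

lemma abs_indicator_le_of_subset {S S' : Set (ℝ≥0 × Ω)} (h : S ⊆ S') (K : ℝ≥0 × Ω → ℝ)
    (p : ℝ≥0 × Ω) : |S.indicator K p| ≤ |S'.indicator K p| := by
  by_cases hp : p ∈ S
  · rw [indicator_of_mem hp, indicator_of_mem (h hp)]
  · rw [indicator_of_notMem hp]
    simp

lemma Ioc_prod_subset (s t : ℝ≥0) (A : Set Ω) :
    Ioc s t ×ˢ A ⊆ Ioc 0 t ×ˢ (univ : Set Ω) := fun _ hp =>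
  ⟨⟨(zero_le (a := s)).trans_lt hp.1.1, hp.1.2⟩, mem_univ _⟩

/-- `W` is a measurable version of the running integral `∫_{(0,t]} H dM`, and `E ∫_{(0,t]} |H| |dM|`
is finite. -/
structure IsRunningIntegral (P : Measure Ω) (F : Measure ℝ≥0) [IsFiniteMeasure F]
    (hT : ∀ i, Measurable (T i)) (hC : ∀ i, Measurable (C i)) (H : ℝ≥0 × Ω → ℝ)
    (W : ℝ≥0 → Ω → ℝ) : Prop where
  predictable : Measurable[(obsFiltration P T C hT hC).predictable] H
  absMoment : ∀ t, absMoment P F hT hC ((Ioc 0 t ×ˢ univ).indicator H) < ∞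
  measurable : ∀ t, Measurable (W t)
  ae_eq : ∀ t, W t =ᵐ[P] stochIntegral F hT hC ((Ioc 0 t ×ˢ univ).indicator H)

variable {H : ℝ≥0 × Ω → ℝ} {W : ℝ≥0 → Ω → ℝ}

lemma IsRunningIntegral.measurable_indicator (hW : IsRunningIntegral P F hT hC H W) {s t : ℝ≥0}
    {A : Set Ω} (hA : MeasurableSet[obsFiltration P T C hT hC s] A) :
    Measurable[(obsFiltration P T C hT hC).predictable] ((Ioc s t ×ˢ A).indicator H) :=
  measurable_indicator_Ioc_predictable hA hW.predictable

lemma IsRunningIntegral.absMoment_indicator (hW : IsRunningIntegral P F hT hC H W) (s t : ℝ≥0)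
    (A : Set Ω) : Censored.absMoment P F hT hC ((Ioc s t ×ˢ A).indicator H) < ∞ :=
  (absMoment_mono (abs_indicator_le_of_subset (Ioc_prod_subset s t A) H)).trans_lt (hW.absMoment t)

/-- The increment of the running integral on a set of the past. -/
lemma IsRunningIntegral.indicator_sub_ae_eq (hW : IsRunningIntegral P F hT hC H W)
    (hF : F {0} = 0) {s t : ℝ≥0} (hst : s ≤ t) (A : Set Ω) :
    (A.indicator fun ω => W t ω - W s ω) =ᵐ[P]
      stochIntegral F hT hC ((Ioc s t ×ˢ A).indicator H) := by
  have hm : ∀ t, Measurable ((Ioc 0 t ×ˢ univ).indicator H) := fun t =>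
    (hW.measurable_indicator (s := 0) (A := univ)
      (@MeasurableSet.univ Ω (obsFiltration P T C hT hC 0))).mono predictable_le_prod le_rfl
  filter_upwards [hW.ae_eq t, hW.ae_eq s, ae_integrable_of_absMoment hF (hm t) (hW.absMoment t),
    ae_integrable_of_absMoment hF (hm s) (hW.absMoment s)] with ω h1 h2 h3 h4
  by_cases hω : ω ∈ A
  · rw [indicator_of_mem hω, h1, h2, stochIntegral, stochIntegral, ← integral_sub h3 h4]
    refine integral_congr_ae (ae_of_all _ fun y => ?_)
    dsimp only
    rw [← sub_mul]
    congr 1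
    by_cases hy0 : 0 < y
    · by_cases hys : y ≤ s
      · simp [indicator_apply, hys, hys.trans hst, not_lt.2 hys]
      · by_cases hyt : y ≤ t
        · simp [hys, hyt, hω, not_le.1 hys, hy0]
        · simp [hys, hyt]
    · have : y = 0 := by simpa using hy0
      simp [this]
  · rw [indicator_of_notMem hω]
    simp [stochIntegral, hω]

lemma IsRunningIntegral.integrable (hW : IsRunningIntegral P F hT hC H W) (hF : F {0} = 0)
    (t : ℝ≥0) : Integrable (W t) P := by
  have hm := (hW.measurable_indicator (s := 0) (t := t) (A := univ)
      (@MeasurableSet.univ Ω (obsFiltration P T C hT hC 0))).mono predictable_le_prod le_rfl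
  exact (integrable_stochIntegral hF hm (hW.absMoment t)).congr (hW.ae_eq t).symm

lemma IsRunningIntegral.measurable_obsFiltration (hW : IsRunningIntegral P F hT hC H W)
    (hS : IsSample P F G T C) (t : ℝ≥0) : Measurable[obsFiltration P T C hT hC t] (W t) :=
  measurable_obsFiltration_congr (hS.measurable_stochIntegral_Ioc hW.predictable (hW.absMoment t))
    (hW.measurable t) (hW.ae_eq t).symm

/-- Running integrals of predictable processes against `dM` are martingales. -/
lemma IsRunningIntegral.martingale (hW : IsRunningIntegral P F hT hC H W)
    (hS : IsSample P F G T C) : Martingale W (obsFiltration P T C hT hC) P := by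
  refine martingale_of_setIntegral_eq
    (fun t => (hW.measurable_obsFiltration hS t).stronglyMeasurable)
    (hW.integrable hS.hF) fun s t hst A hA => ?_
  rw [← integral_indicator ((obsFiltration P T C hT hC).le s A hA),
    integral_congr_ae (hW.indicator_sub_ae_eq hS.hF hst A)]
  exact hS.integral_stochIntegral_eq_zero (hW.measurable_indicator hA)
    (hW.absMoment_indicator s t A)

/-- The process `∫_{(0,t]} H² d⟨M⟩`. -/
def runningVariation (F : Measure ℝ≥0) (T C : Fin n → Ω → ℝ≥0) (H : ℝ≥0 × Ω → ℝ) (t : ℝ≥0)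
    (ω : Ω) : ℝ :=
  (∫⁻ y in Ioc 0 t, ‖H (y, ω)‖ₑ ^ 2 ∂(varM F T C ω)).toReal

lemma setLIntegral_varM (hF : F {0} = 0) (ω : Ω) {g : ℝ≥0 → ℝ≥0∞} (hg : Measurable g) {s : Set ℝ≥0}
    (hs : MeasurableSet s) :
    ∫⁻ y in s, g y ∂(varM F T C ω) =
      ∫⁻ y in s, (F (Ici y))⁻¹ * ((1 - hazard F {y}) * atRisk T C y ω * g y) ∂F := by
  have h3 : Measurable fun y => (1 - hazard F {y}) * (atRisk T C y ω : ℝ≥0∞) :=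
    (measurable_const.sub (measurable_hazard_singleton hF)).mul (measurable_atRisk_path ω)
  have h4 : Measurable fun y => (1 - hazard F {y}) * (atRisk T C y ω : ℝ≥0∞) * g y := h3.mul hg
  rw [varM, setLIntegral_withDensity_eq_setLIntegral_mul _ h3 hg hs,
    ← setLIntegral_hazard hF h4 hs]
  rfl

lemma measurable_lintegral_varM_predictable (hF : F {0} = 0)
    (hH : Measurable[(obsFiltration P T C hT hC).predictable] H) :
    Measurable[(obsFiltration P T C hT hC).predictable] fun p : ℝ≥0 × Ω =>
      ∫⁻ y in Ioc 0 p.1, ‖H (y, p.2)‖ₑ ^ 2 ∂(varM F T C p.2) := by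
  have hY : Measurable[(obsFiltration P T C hT hC).predictable] fun p : ℝ≥0 × Ω =>
      (atRisk T C p.1 p.2 : ℝ≥0∞) := by
    simp only [atRisk, Nat.cast_sum, Nat.cast_ite, Nat.cast_one, Nat.cast_zero]
    exact Finset.measurable_sum _ fun i _ => measurable_atRisk_predictable i
  have hsq : Measurable fun r : ℝ => ‖r‖ₑ ^ 2 := measurable_enorm.pow_const 2
  have hw : Measurable[(obsFiltration P T C hT hC).predictable] fun p : ℝ≥0 × Ω =>
      (F (Ici p.1))⁻¹ * ((1 - hazard F {p.1}) * atRisk T C p.1 p.2 * ‖H p‖ₑ ^ 2) :=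
    ((measurable_measure_Ici F).inv.comp measurable_fst_predictable).mul
      (((measurable_const.sub ((measurable_hazard_singleton hF).comp
        measurable_fst_predictable)).mul hY).mul (hsq.comp hH))
  convert measurable_lintegral_Ioc_predictable F hw using 2 with p
  have hm : Measurable fun y => ‖H (y, p.2)‖ₑ ^ 2 :=
    (hH.comp (measurable_prodMk_predictable p.2)).enorm.pow_const 2
  exact setLIntegral_varM hF p.2 hm measurableSet_Ioc

lemma measurable_lintegral_varM_obsFiltration (hF : F {0} = 0)
    (hH : Measurable[(obsFiltration P T C hT hC).predictable] H) (t : ℝ≥0) :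
    Measurable[obsFiltration P T C hT hC t] fun ω =>
      ∫⁻ y in Ioc 0 t, ‖H (y, ω)‖ₑ ^ 2 ∂(varM F T C ω) := by
  have h := (measurable_lintegral_varM_predictable hF hH).comp (measurable_prodMk_left_predictable t)
  exact h

lemma varMoment_indicator (H : ℝ≥0 × Ω → ℝ) (s t : ℝ≥0) {A : Set Ω} (hA : MeasurableSet A) :
    varMoment P F T C ((Ioc s t ×ˢ A).indicator H) =
      ∫⁻ ω in A, ∫⁻ y in Ioc s t, ‖H (y, ω)‖ₑ ^ 2 ∂(varM F T C ω) ∂P := by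
  rw [varMoment, ← lintegral_indicator hA]
  refine lintegral_congr fun ω => ?_
  by_cases hω : ω ∈ A
  · rw [indicator_of_mem hω, ← lintegral_indicator measurableSet_Ioc]
    refine lintegral_congr fun y => ?_
    by_cases hy : y ∈ Ioc s t
    · rw [indicator_of_mem hy, indicator_of_mem (show (y, ω) ∈ Ioc s t ×ˢ A from ⟨hy, hω⟩)]
    · rw [indicator_of_notMem hy,
        indicator_of_notMem (show (y, ω) ∉ Ioc s t ×ˢ A from fun h => hy h.1)]
      simp
  · rw [indicator_of_notMem hω]
    simp [hω]

/-- Running integrals of square integrable predictable processes, and their predictable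
variation. -/
lemma IsRunningIntegral.isPredictableVariation (hW : IsRunningIntegral P F hT hC H W)
    (hS : IsSample P F G T C)
    (hv : ∀ t, ∫⁻ ω, ∫⁻ y in Ioc 0 t, ‖H (y, ω)‖ₑ ^ 2 ∂(varM F T C ω) ∂P < ∞) :
    IsSquareIntegrableMartingale (obsFiltration P T C hT hC) P W ∧
      IsPredictableVariation (obsFiltration P T C hT hC) P W (runningVariation F T C H) := by
  have hF := hS.hF
  have hle := (obsFiltration P T C hT hC).le
  have hvI : ∀ s t (A : Set Ω), varMoment P F T C ((Ioc s t ×ˢ A).indicator H) < ∞ := by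
    intro s t A
    refine (varMoment_mono (abs_indicator_le_of_subset (Ioc_prod_subset s t A) H)).trans_lt ?_
    rw [varMoment_indicator H 0 t MeasurableSet.univ, Measure.restrict_univ]
    exact hv t
  -- The isometry for 1_{(s,t]×A} H, with A in the past of s, is the conditional form of the
  -- isometry for increments.
  have hiso : ∀ s t (A : Set Ω), MeasurableSet[obsFiltration P T C hT hC s] A →
      ∫⁻ ω, ‖stochIntegral F hT hC ((Ioc s t ×ˢ A).indicator H) ω‖ₑ ^ 2 ∂P =
        ∫⁻ ω in A, ∫⁻ y in Ioc s t, ‖H (y, ω)‖ₑ ^ 2 ∂(varM F T C ω) ∂P := by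
    intro s t A hA
    rw [hS.lintegral_stochIntegral_sq (hW.measurable_indicator hA) (fun ω => by simp)
      (hW.absMoment_indicator s t A) (hvI s t A), varMoment_indicator H s t (hle s A hA)]
  have hL2 : ∀ t, MemLp (W t) 2 P := by
    intro t
    refine ⟨(hW.measurable t).aestronglyMeasurable, ?_⟩
    rw [eLpNorm_congr_ae (hW.ae_eq t), eLpNorm_two_eq,
      hiso 0 t univ (@MeasurableSet.univ Ω (obsFiltration P T C hT hC 0)), Measure.restrict_univ]
    exact ENNReal.rpow_lt_top_of_nonneg (by norm_num) (hv t).ne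
  have hmart := hW.martingale hS
  have hVp := measurable_lintegral_varM_predictable hF hW.predictable
  have hVt := measurable_lintegral_varM_obsFiltration hF hW.predictable
  have hVm : ∀ t, Measurable fun ω => ∫⁻ y in Ioc 0 t, ‖H (y, ω)‖ₑ ^ 2 ∂(varM F T C ω) := fun t =>
    (hVt t).mono (hle t) le_rfl
  have hVi : ∀ t, Integrable (runningVariation F T C H t) P := fun t =>
    integrable_toReal_of_lintegral_ne_top (hVm t).aemeasurable (hv t).ne
  -- Integer times suffice by monotonicity, which gives a single null set for all t.
  have hfin : ∀ᵐ ω ∂P, ∀ t, ∫⁻ y in Ioc 0 t, ‖H (y, ω)‖ₑ ^ 2 ∂(varM F T C ω) < ∞ := by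
    have : ∀ᵐ ω ∂P, ∀ k : ℕ, ∫⁻ y in Ioc 0 (k : ℝ≥0), ‖H (y, ω)‖ₑ ^ 2 ∂(varM F T C ω) < ∞ :=
      ae_all_iff.2 fun k => ae_lt_top (hVm k) (hv k).ne
    filter_upwards [this] with ω hω t
    obtain ⟨k, hk⟩ := exists_nat_ge t
    exact (lintegral_mono_set (Ioc_subset_Ioc_right hk)).trans_lt (hω k)
  have hHω : ∀ ω, Measurable fun y => ‖H (y, ω)‖ₑ ^ 2 := fun ω =>
    (hW.predictable.comp (measurable_prodMk_predictable ω)).enorm.pow_const 2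
  have hνeq : ∀ ω t, runningVariation F T C H t ω =
      (((varM F T C ω).withDensity fun y => ‖H (y, ω)‖ₑ ^ 2) (Ioc 0 t)).toReal := fun ω t => by
    rw [withDensity_apply _ measurableSet_Ioc, runningVariation]
  have hsq : ∀ t, Integrable (fun ω => W t ω ^ 2) P := fun t => (hL2 t).integrable_sq
  have hinc : ∀ s t, s ≤ t → ∀ A, MeasurableSet[obsFiltration P T C hT hC s] A →
      ∫ ω in A, (W t ω - W s ω) ^ 2 ∂P =
        ∫ ω in A, (runningVariation F T C H t ω - runningVariation F T C H s ω) ∂P := by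
    intro s t hst A hA
    have hA' := hle s A hA
    have hi1 : ∫⁻ ω in A, ENNReal.ofReal ((W t ω - W s ω) ^ 2) ∂P =
        ∫⁻ ω in A, ∫⁻ y in Ioc s t, ‖H (y, ω)‖ₑ ^ 2 ∂(varM F T C ω) ∂P := by
      rw [← hiso s t A hA, ← lintegral_indicator hA']
      refine lintegral_congr_ae ?_
      filter_upwards [hW.indicator_sub_ae_eq hF hst A] with ω hω
      rw [← hω]
      by_cases h : ω ∈ A
      · rw [indicator_of_mem h, indicator_of_mem h, Real.enorm_eq_ofReal_abs,
          ← ENNReal.ofReal_pow (abs_nonneg _), sq_abs]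
      · rw [indicator_of_notMem h, indicator_of_notMem h]
        simp
    have hi2 : ∀ᵐ ω ∂P, ENNReal.ofReal
        (runningVariation F T C H t ω - runningVariation F T C H s ω) =
          ∫⁻ y in Ioc s t, ‖H (y, ω)‖ₑ ^ 2 ∂(varM F T C ω) := by
      filter_upwards [hfin] with ω hω
      have hsplit : ∫⁻ y in Ioc 0 t, ‖H (y, ω)‖ₑ ^ 2 ∂(varM F T C ω) =
          ∫⁻ y in Ioc 0 s, ‖H (y, ω)‖ₑ ^ 2 ∂(varM F T C ω) +
            ∫⁻ y in Ioc s t, ‖H (y, ω)‖ₑ ^ 2 ∂(varM F T C ω) := by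
        rw [← lintegral_union measurableSet_Ioc (Ioc_disjoint_Ioc_of_le le_rfl),
          Ioc_union_Ioc_eq_Ioc zero_le hst]
      have hst' : ∫⁻ y in Ioc s t, ‖H (y, ω)‖ₑ ^ 2 ∂(varM F T C ω) ≠ ∞ :=
        ne_top_of_le_ne_top (hω t).ne (hsplit ▸ le_add_self)
      rw [runningVariation, runningVariation, hsplit, ENNReal.toReal_add (hω s).ne hst',
        add_sub_cancel_left, ENNReal.ofReal_toReal hst']
    have hnn : ∀ᵐ ω ∂P, 0 ≤ runningVariation F T C H t ω - runningVariation F T C H s ω := by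
      filter_upwards [hfin] with ω hω
      exact sub_nonneg.2 (ENNReal.toReal_mono (hω t).ne
        (lintegral_mono_set (Ioc_subset_Ioc_right hst)))
    have hWm : Measurable fun ω => (W t ω - W s ω) ^ 2 :=
      ((hW.measurable t).sub (hW.measurable s)).pow_const 2
    rw [integral_eq_lintegral_of_nonneg_ae (ae_of_all _ fun ω => sq_nonneg _)
        hWm.aestronglyMeasurable,
      integral_eq_lintegral_of_nonneg_ae (ae_restrict_of_ae hnn)
        ((hVi t).sub (hVi s)).aestronglyMeasurable.restrict, hi1,
      lintegral_congr_ae (ae_restrict_of_ae hi2)]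
  refine ⟨⟨hmart, hL2⟩, ?_, ?_, ?_, ?_, ?_⟩
  · exact (hVp.ennreal_toReal).stronglyMeasurable
  · exact ae_of_all _ fun ω => by simp [runningVariation]
  · filter_upwards [hfin] with ω hω
    simp only [hνeq]
    exact measure_Ioc_monotone fun t => by
      rw [withDensity_apply _ measurableSet_Ioc]
      exact (hω t).ne
  · filter_upwards [hfin] with ω hω t
    simp only [hνeq]
    exact measure_Ioc_rightCont (fun t => by
      rw [withDensity_apply _ measurableSet_Ioc]
      exact (hω t).ne) t
  · refine martingale_of_setIntegral_eq (fun t => ?_) (fun t => (hsq t).sub (hVi t))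
      fun s t hst A hA => ?_
    · exact (((hW.measurable_obsFiltration hS t).pow_const 2).sub
        (hVt t).ennreal_toReal).stronglyMeasurable
    · have hA' := hle s A hA
      have hcm : Integrable (fun ω => W s ω * (W t ω - W s ω)) P :=
        (hL2 s).integrable_mul ((hL2 t).sub (hL2 s))
      have hcross : ∫ ω in A, W s ω * (W t ω - W s ω) ∂P = 0 := by
        have hfm : StronglyMeasurable[obsFiltration P T C hT hC s] (A.indicator (W s)) :=
          ((hW.measurable_obsFiltration hS s).indicator hA).stronglyMeasurable
        have e : ∀ ω, A.indicator (fun ω => W s ω * (W t ω - W s ω)) ω =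
            A.indicator (W s) ω * (W t ω - W s ω) := fun ω => by
          by_cases h : ω ∈ A <;> simp [h]
        rw [← integral_indicator hA', integral_congr_ae (ae_of_all _ e)]
        refine Martingale.integral_mul_sub_eq_zero hmart hst hfm ?_
        exact (hcm.indicator hA').congr (ae_of_all _ e)
      have hdiff : Integrable (fun ω => (W t ω - W s ω) ^ 2) P :=
        ((hL2 t).sub (hL2 s)).integrable_sq
      have hVd : Integrable
          (fun ω => runningVariation F T C H t ω - runningVariation F T C H s ω) P :=
        (hVi t).sub (hVi s)
      -- The increment of W² is (W(t) - W(s))² plus a cross term, which integrates to 0 over `A` by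
      -- the martingale property.
      have e : ∀ ω, W t ω ^ 2 - runningVariation F T C H t ω -
          (W s ω ^ 2 - runningVariation F T C H s ω) =
          ((W t ω - W s ω) ^ 2 - (runningVariation F T C H t ω - runningVariation F T C H s ω)) +
            2 * (W s ω * (W t ω - W s ω)) := fun ω => by ring
      have hd1 : Integrable (fun ω => (W t ω - W s ω) ^ 2 -
          (runningVariation F T C H t ω - runningVariation F T C H s ω)) (P.restrict A) :=
        (hdiff.sub hVd).integrableOn
      rw [integral_congr_ae (ae_of_all _ e), integral_add hd1 (hcm.const_mul 2).integrableOn,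
        integral_sub hdiff.integrableOn hVd.integrableOn, hinc s t hst A hA, integral_const_mul,
        hcross]
      ring

end Running

/-! ### The martingale `M` and the double integral as running integrals -/

section Main

set_option linter.unusedSectionVars false

variable {Ω : Type*} {mΩ : MeasurableSpace Ω} {n : ℕ} {P : Measure Ω} [IsProbabilityMeasure P]
  {F G : Measure ℝ≥0} [IsProbabilityMeasure F] [IsProbabilityMeasure G] {T C : Fin n → Ω → ℝ≥0}
  {hT : ∀ i, Measurable (T i)} {hC : ∀ i, Measurable (C i)}

lemma measurable_pooledM (hT : ∀ i, Measurable (T i)) (hC : ∀ i, Measurable (C i)) (t : ℝ≥0) :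
    Measurable (pooledM F T C t) := by
  have h1 : Measurable fun ω => (counting T C t ω : ℝ) := by
    refine (measurable_from_top (f := fun k : ℕ => (k : ℝ))).comp ?_
    unfold counting
    refine Finset.measurable_sum _ fun i _ => Measurable.ite ?_ measurable_const measurable_const
    exact (measurableSet_le (measurable_obsTime hT hC i) measurable_const).inter
      (measurableSet_uncensored hT hC i)
  have h2 : Measurable fun q : Ω × ℝ≥0 => (atRisk T C q.2 q.1 : ℝ) :=
    (measurable_from_top (f := fun k : ℕ => (k : ℝ))).comp (measurable_atRisk hT hC)
  exact h1.sub (h2.stronglyMeasurable.integral_prod_right'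
    (ν := (hazard F).restrict (Ioc 0 t))).measurable

/-- M is the integral of the constant 1, so its martingale property and ⟨M⟩ are instances of the
general result. -/
lemma IsSample.isRunningIntegral_pooledM (hS : IsSample P F G T C) :
    IsRunningIntegral P F hT hC (fun _ => 1) (pooledM F T C) where
  predictable := measurable_const
  absMoment t := hS.absMoment_lt_top_of_bound (c := 1) fun p => by
    by_cases hp : p ∈ Ioc 0 t ×ˢ (univ : Set Ω)
    · simp [indicator_of_mem hp]
    · simp [indicator_of_notMem hp]
  measurable := measurable_pooledM hT hC
  ae_eq t := by
    filter_upwards [hS.ae_finitePaths, ae_all_iff.2 hS.ae_obsTime_pos] with ω hω hpos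
    have hρ := integrable_signDensity hS.hF hT hC (baseKernel F hT hC ω) ω
    -- `dM_Iic` includes the time 0; almost surely dM has no mass there, since all X_i are positive
    -- and Λ({0}) = 0.
    have h0 : ∫ y in {0}, signDensity F T C y ω ∂(baseKernel F hT hC ω) = 0 := by
      rw [setIntegral_signDensity hS.hF hT hC hω (measurableSet_singleton 0),
        countingMeasure_singleton, compensatorMeasure_singleton, hazard_zero]
      simp [atomCount, fun i => (hpos i).ne']
    have hU : Iic t = {0} ∪ Ioc 0 t := by
      ext y
      simp only [mem_Iic, mem_union, mem_singleton_iff, mem_Ioc]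
      rcases eq_or_ne y 0 with rfl | hy
      · simp
      · simp [hy, pos_iff_ne_zero.2 hy]
    rw [← dM_Iic F T C ω hω t, dM_eq hS.hF hT hC, withDensityᵥ_apply hρ measurableSet_Iic, hU,
      setIntegral_union (by simp) measurableSet_Ioc hρ.integrableOn hρ.integrableOn, h0, zero_add,
      ← integral_indicator measurableSet_Ioc]
    refine integral_congr_ae (ae_of_all _ fun y => ?_)
    by_cases hy : y ∈ Ioc 0 t
    · simp [mem_prod, hy.1, hy.2]
    · simp only [indicator_apply, mem_prod, hy, false_and, if_false, zero_mul]

lemma IsSample.lintegral_varM_lt_top (hS : IsSample P F G T C) :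
    ∫⁻ ω, varM F T C ω univ ∂P < ∞ := by
  calc ∫⁻ ω, varM F T C ω univ ∂P
      ≤ ∫⁻ ω, ∑ j, hazard F (Iic (obsTime T C j ω)) ∂P := by
        refine lintegral_mono fun ω => ?_
        rw [← lintegral_one, lintegral_varM hS.hF ω measurable_const]
        refine (lintegral_mono (g := fun _ => 1) fun y => ?_).trans ?_
        · simp
        · rw [lintegral_compensatorMeasure]
          simp
    _ = ∑ j, ∫⁻ ω, hazard F (Iic (obsTime T C j ω)) ∂P :=
        lintegral_finsetSum _ fun j _ =>
          (measurable_hazard_Iic F).comp (measurable_obsTime hS.hT hS.hC j)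
    _ < ∞ := ENNReal.sum_lt_top.2 fun j _ =>
        (hS.lintegral_hazard_Iic_le j).trans_lt ENNReal.one_lt_top

/-- `M` is a square integrable martingale with predictable variation `(1 - ΔΛ) Y dΛ`. -/
lemma IsSample.isPredictableVariation_pooledM (hS : IsSample P F G T C) :
    IsSquareIntegrableMartingale (obsFiltration P T C hT hC) P (pooledM F T C) ∧
      IsPredictableVariation (obsFiltration P T C hT hC) P (pooledM F T C)
        fun t ω => (varM F T C ω).real (Ioc 0 t) := by
  have h := (hS.isRunningIntegral_pooledM (hT := hT) (hC := hC)).isPredictableVariation hS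
    fun t => by
      refine lt_of_le_of_lt (lintegral_mono fun ω => ?_) hS.lintegral_varM_lt_top
      simpa using measure_mono (subset_univ _)
  convert h using 2
  ext t ω
  simp [runningVariation, measureReal_def]

/-- A two-time process, extended by `0` off its index domain. -/
def zeroExtend (h : ℝ≥0 → ℝ≥0 → Ω → ℝ) : ℝ≥0 × ℝ≥0 × Ω → ℝ :=
  (orderedPairs Ω).indicator fun q => h q.1 q.2.1 q.2.2

/-- The inner integral `∫_{(0,y)} h(x, y) dM(x)`. -/
def innerIntegral (F : Measure ℝ≥0) [IsFiniteMeasure F] (hT : ∀ i, Measurable (T i))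
    (hC : ∀ i, Measurable (C i)) (h : ℝ≥0 → ℝ≥0 → Ω → ℝ) (p : ℝ≥0 × Ω) : ℝ :=
  ∫ x, zeroExtend h (x, p) * signDensity F T C x p.2 ∂(baseKernel F hT hC p.2)

variable {h : ℝ≥0 → ℝ≥0 → Ω → ℝ}

lemma measurable_zeroExtend (hh : IsTwoTimePredictable (obsFiltration P T C hT hC) h) :
    Measurable (zeroExtend h) :=
  hh.measurable_indicator.mono twoTimePredictable_le_prod le_rfl

lemma indicator_Ioo_eq (y : ℝ≥0) (ω : Ω) (x : ℝ≥0) :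
    (Ioo 0 y).indicator (fun x => h x y ω) x = zeroExtend h (x, y, ω) := rfl

lemma measurable_signDensity_path (hF : F {0} = 0) (hT : ∀ i, Measurable (T i))
    (hC : ∀ i, Measurable (C i)) (ω : Ω) : Measurable fun y => signDensity F T C y ω :=
  (measurable_signDensity hF hT hC).comp measurable_prodMk_right

lemma integral_Ioo_dM (hF : F {0} = 0) (hh : IsTwoTimePredictable (obsFiltration P T C hT hC) h)
    (y : ℝ≥0) (ω : Ω) :
    ∫ᵛ x in Ioo 0 y, h x y ω ∂•(dM F T C ω) = innerIntegral F hT hC h (y, ω) := by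
  have hm : Measurable fun x => zeroExtend h (x, y, ω) :=
    (measurable_zeroExtend hh).comp measurable_prodMk_right
  rw [← VectorMeasure.integral_indicator measurableSet_Ioo]
  simp_rw [indicator_Ioo_eq]
  rw [dM_eq hF hT hC, integral_lsmul_withDensityᵥ (measurable_signDensity_path hF hT hC ω)
    (integrable_signDensity hF hT hC _ ω) hm]
  rfl

/-- Through this bound the second-moment condition, stated with |h| and |dM|, controls E ∫ H² d⟨M⟩.
-/
lemma enorm_innerIntegral_le (hF : F {0} = 0)
    (hh : IsTwoTimePredictable (obsFiltration P T C hT hC) h) (y : ℝ≥0) (ω : Ω) :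
    ‖innerIntegral F hT hC h (y, ω)‖ₑ ≤ ∫⁻ x in Ioo 0 y, ‖h x y ω‖ₑ ∂(dM F T C ω).variation := by
  have hm : Measurable fun x => zeroExtend h (x, y, ω) :=
    (measurable_zeroExtend hh).comp measurable_prodMk_right
  refine (enorm_integral_le_lintegral_enorm _).trans (le_of_eq ?_)
  rw [variation_dM hF hT hC, ← lintegral_indicator measurableSet_Ioo]
  have e : ∀ x, (Ioo 0 y).indicator (fun x => ‖h x y ω‖ₑ) x = ‖zeroExtend h (x, y, ω)‖ₑ := fun x => by
    rw [← indicator_Ioo_eq, enorm_indicator_eq_indicator_enorm]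
  simp_rw [e]
  rw [lintegral_withDensity_eq_lintegral_mul _ (measurable_signDensity_path hF hT hC ω).enorm
    hm.enorm]
  refine lintegral_congr fun x => ?_
  rw [enorm_mul, mul_comm]
  rfl

/-- The integrand of the double integral over `C_t`. -/
def truncatedIntegrand (F : Measure ℝ≥0) (T C : Fin n → Ω → ℝ≥0) (h : ℝ≥0 → ℝ≥0 → Ω → ℝ) (t : ℝ≥0)
    (ω : Ω) (p : ℝ≥0 × ℝ≥0) : ℝ :=
  (domC t).indicator (fun p => h p.1 p.2 ω) p * (signDensity F T C p.1 ω * signDensity F T C p.2 ω)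

lemma measurableSet_domC (t : ℝ≥0) : MeasurableSet (domC t) :=
  (measurableSet_lt measurable_const measurable_fst).inter
    ((measurableSet_lt measurable_fst measurable_snd).inter
      (measurableSet_le (f := fun p : ℝ≥0 × ℝ≥0 => p.2) measurable_snd measurable_const))

lemma indicator_domC_eq (t : ℝ≥0) (ω : Ω) (p : ℝ≥0 × ℝ≥0) :
    (domC t).indicator (fun p => h p.1 p.2 ω) p =
      if p.2 ≤ t then zeroExtend h (p.1, p.2, ω) else 0 := by
  by_cases h1 : 0 < p.1 <;> by_cases h2 : p.1 < p.2 <;> by_cases h3 : p.2 ≤ t <;>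
    simp [zeroExtend, domC, orderedPairs, h1, h2, h3]

lemma measurable_indicator_domC (hh : IsTwoTimePredictable (obsFiltration P T C hT hC) h)
    (t : ℝ≥0) : Measurable fun q : Ω × ℝ≥0 × ℝ≥0 =>
      (domC t).indicator (fun p => h p.1 p.2 q.1) q.2 := by
  simp_rw [indicator_domC_eq]
  refine Measurable.ite (measurableSet_le measurable_snd.snd measurable_const) ?_ measurable_const
  exact (measurable_zeroExtend hh).comp
    (measurable_snd.fst.prodMk (measurable_snd.snd.prodMk measurable_fst))

lemma measurable_truncatedIntegrand (hF : F {0} = 0)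
    (hh : IsTwoTimePredictable (obsFiltration P T C hT hC) h) (t : ℝ≥0) :
    Measurable fun q : Ω × ℝ≥0 × ℝ≥0 => truncatedIntegrand F T C h t q.1 q.2 := by
  have h1 : Measurable fun q : Ω × ℝ≥0 × ℝ≥0 => signDensity F T C q.2.1 q.1 :=
    (measurable_signDensity hF hT hC).comp (measurable_snd.fst.prodMk measurable_fst)
  have h2 : Measurable fun q : Ω × ℝ≥0 × ℝ≥0 => signDensity F T C q.2.2 q.1 :=
    (measurable_signDensity hF hT hC).comp (measurable_snd.snd.prodMk measurable_fst)
  exact (measurable_indicator_domC hh t).mul (h1.mul h2)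

lemma doubleIntegral_eq (hF : F {0} = 0) (hh : IsTwoTimePredictable (obsFiltration P T C hT hC) h)
    (t : ℝ≥0) (ω : Ω) :
    doubleIntegral F T C h t ω = ∫ p, truncatedIntegrand F T C h t ω p
      ∂((baseKernel F hT hC ω).prod (baseKernel F hT hC ω)) := by
  have hρ := measurable_signDensity_path (F := F) hF hT hC ω
  have hρi := integrable_signDensity hF hT hC (baseKernel F hT hC ω) ω
  have hm : Measurable fun p => (domC t).indicator (fun p => h p.1 p.2 ω) p :=
    (measurable_indicator_domC hh t).comp measurable_prodMk_left
  have hρρ : Measurable fun p : ℝ≥0 × ℝ≥0 => signDensity F T C p.1 ω * signDensity F T C p.2 ω :=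
    (hρ.comp measurable_fst).mul (hρ.comp measurable_snd)
  rw [doubleIntegral, ← VectorMeasure.integral_indicator (measurableSet_domC t),
    dM_eq hF hT hC, prod_withDensityᵥ hρi, integral_lsmul_withDensityᵥ hρρ (hρi.mul_prod hρi) hm]
  rfl

lemma lintegral_variation_prod (hF : F {0} = 0)
    (hh : IsTwoTimePredictable (obsFiltration P T C hT hC) h) (t : ℝ≥0) (ω : Ω) :
    ∫⁻ p in domC t, ‖h p.1 p.2 ω‖ₑ ∂((dM F T C ω).variation.prod (dM F T C ω).variation) =
      ∫⁻ p, ‖truncatedIntegrand F T C h t ω p‖ₑ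
        ∂((baseKernel F hT hC ω).prod (baseKernel F hT hC ω)) := by
  have hρ := (measurable_signDensity_path (F := F) hF hT hC ω).enorm
  have hm : Measurable fun p => (domC t).indicator (fun p => h p.1 p.2 ω) p :=
    (measurable_indicator_domC hh t).comp measurable_prodMk_left
  have hρρ : Measurable fun p : ℝ≥0 × ℝ≥0 =>
      ‖signDensity F T C p.1 ω‖ₑ * ‖signDensity F T C p.2 ω‖ₑ :=
    (hρ.comp measurable_fst).mul (hρ.comp measurable_snd)
  rw [variation_dM hF hT hC, prod_withDensity hρ hρ, ← lintegral_indicator (measurableSet_domC t)]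
  have e : ∀ p, (domC t).indicator (fun p => ‖h p.1 p.2 ω‖ₑ) p =
      ‖(domC t).indicator (fun p => h p.1 p.2 ω) p‖ₑ := fun p => by
    rw [enorm_indicator_eq_indicator_enorm]
  simp_rw [e]
  rw [lintegral_withDensity_eq_lintegral_mul _ hρρ hm.enorm]
  refine lintegral_congr fun p => ?_
  simp only [truncatedIntegrand, enorm_mul, Pi.mul_apply]
  ring

/-- Separates a factor depending on y alone, so that integrating out x leaves the inner integral. At
y = 0 both sides vanish because no x lies below 0. -/
lemma truncatedIntegrand_eq (t : ℝ≥0) (ω : Ω) (x y : ℝ≥0) :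
    truncatedIntegrand F T C h t ω (x, y) =
      zeroExtend h (x, y, ω) * signDensity F T C x ω *
        ((Ioc 0 t).indicator 1 y * signDensity F T C y ω) := by
  simp only [truncatedIntegrand, indicator_domC_eq]
  by_cases hy : y ≤ t
  · rcases eq_or_ne y 0 with rfl | hy0
    · have : zeroExtend h (x, 0, ω) = 0 :=
        indicator_of_notMem (fun hq => not_lt_zero hq.2) _
      simp [this]
    · simp [hy, pos_iff_ne_zero.2 hy0]
      ring
  · simp [hy]

lemma integral_truncatedIntegrand (t : ℝ≥0) (ω : Ω) (y : ℝ≥0) :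
    ∫ x, truncatedIntegrand F T C h t ω (x, y) ∂(baseKernel F hT hC ω) =
      (Ioc 0 t ×ˢ univ).indicator (innerIntegral F hT hC h) (y, ω) * signDensity F T C y ω := by
  simp_rw [truncatedIntegrand_eq]
  rw [integral_mul_const]
  by_cases hy : y ∈ Ioc 0 t
  · rw [indicator_of_mem hy, indicator_of_mem (show (y, ω) ∈ Ioc 0 t ×ˢ univ from ⟨hy, mem_univ _⟩)]
    simp [innerIntegral]
  · rw [indicator_of_notMem hy,
      indicator_of_notMem (show (y, ω) ∉ Ioc 0 t ×ˢ univ from fun h => hy h.1)]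
    simp

/-- The absolute moment condition serves twice: it justifies Fubini on almost every path, and by the
triangle inequality for the inner integral it bounds E ∫ |H| |dM|. -/
lemma IsSample.isRunningIntegral_doubleIntegral (hS : IsSample P F G T C)
    (hh : IsTwoTimePredictable (obsFiltration P T C hT hC) h)
    (hint : ∀ t, ∫⁻ ω, ∫⁻ p in domC t, ‖h p.1 p.2 ω‖ₑ
      ∂((dM F T C ω).variation.prod (dM F T C ω).variation) ∂P < ∞) :
    IsRunningIntegral P F hT hC (innerIntegral F hT hC h) (doubleIntegral F T C h) := by
  have hF := hS.hF
  have hD := fun t => measurable_truncatedIntegrand hF hh t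
  have hDω : ∀ t ω, Measurable (truncatedIntegrand F T C h t ω) := fun t ω =>
    (hD t).comp measurable_prodMk_left
  simp_rw [lintegral_variation_prod hF hh] at hint
  refine ⟨?_, fun t => ?_, fun t => ?_, fun t => ?_⟩
  · exact measurable_inner_predictable hS hh.measurable_indicator fun q hq =>
      indicator_of_notMem hq _
  · refine lt_of_le_of_lt (lintegral_mono fun ω => ?_) (hint t)
    rw [lintegral_prod_symm _ (hDω t ω).enorm.aemeasurable]
    refine lintegral_mono fun y => ?_
    rw [← integral_truncatedIntegrand]
    exact enorm_integral_le_lintegral_enorm _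
  · have := ((hD t).stronglyMeasurable.integral_kernel_prod_right'
      (κ := baseKernel F hT hC ×ₖ baseKernel F hT hC)).measurable
    convert this using 1
    ext ω
    rw [doubleIntegral_eq hF hh, Kernel.prod_apply]
  · have hm : Measurable fun ω => ∫⁻ p, ‖truncatedIntegrand F T C h t ω p‖ₑ
        ∂((baseKernel F hT hC ω).prod (baseKernel F hT hC ω)) := by
      have := (hD t).enorm.lintegral_kernel_prod_right'
        (κ := baseKernel F hT hC ×ₖ baseKernel F hT hC)
      convert this using 1
      ext ω
      rw [Kernel.prod_apply]
    filter_upwards [ae_lt_top hm (hint t).ne] with ω hω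
    have hi : Integrable (truncatedIntegrand F T C h t ω)
        ((baseKernel F hT hC ω).prod (baseKernel F hT hC ω)) :=
      ⟨(hDω t ω).aestronglyMeasurable, by rwa [hasFiniteIntegral_iff_enorm]⟩
    rw [doubleIntegral_eq hF hh, integral_prod_symm _ hi]
    simp_rw [integral_truncatedIntegrand]
    rfl

lemma one_sub_hazard_singleton (hF : F {0} = 0) {y : ℝ≥0} (hy : F (Ici y) ≠ 0) :
    1 - hazard F {y} = F (Ioi y) * (F (Ici y))⁻¹ := by
  have hsplit : F (Ici y) = F (Ioi y) + F {y} := by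
    rw [← measure_union (by simp) (measurableSet_singleton y), union_comm, singleton_union,
      Ioi_insert]
  have hle := ne_top_of_le_ne_top ENNReal.one_ne_top (hazard_singleton_le_one hF y)
  refine ENNReal.sub_eq_of_eq_add hle ?_
  rw [hazard_singleton hF, ← add_mul, ← hsplit,
    ENNReal.mul_inv_cancel hy (measure_ne_top _ _)]

/-- At F-almost every y one has S(y-) > 0, so 1 - ΔΛ(y) = S(y)/S(y-), and dΛ = dF/S(y-) supplies the
second factor S(y-). -/
lemma doubleVariation_eq (hF : F {0} = 0)
    (hh : IsTwoTimePredictable (obsFiltration P T C hT hC) h)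
    (hH : Measurable (innerIntegral F hT hC h)) :
    doubleVariation F T C h = runningVariation F T C (innerIntegral F hT hC h) := by
  ext t ω
  have hHω : Measurable fun y => innerIntegral F hT hC h (y, ω) := hH.comp measurable_prodMk_right
  have hS1 : Measurable fun y => survival F y :=
    Antitone.measurable fun a b hab => measureReal_mono (Ioi_subset_Ioi hab)
  have hS2 : Measurable fun y => survivalLeft F y :=
    Antitone.measurable fun a b hab => measureReal_mono (Ici_subset_Ici.2 hab)
  have hY : Measurable fun y => (atRisk T C y ω : ℝ) := by
    simpa using (measurable_atRisk_path (T := T) (C := C) ω).ennreal_toReal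
  have hm : Measurable fun y => innerIntegral F hT hC h (y, ω) ^ 2 *
      ((atRisk T C y ω : ℝ) * survival F y / survivalLeft F y ^ 2) :=
    (hHω.pow_const 2).mul ((hY.mul hS1).div (hS2.pow_const 2))
  have h1 : ∀ y, 0 ≤ survival F y := fun y => measureReal_nonneg
  simp_rw [doubleVariation, integral_Ioo_dM hF hh]
  rw [integral_eq_lintegral_of_nonneg_ae (ae_of_all _ fun y => ?_) hm.aestronglyMeasurable,
    runningVariation, setLIntegral_varM hF ω (hHω.enorm.pow_const 2) measurableSet_Ioc]
  · congr 1
    refine lintegral_congr_ae (ae_restrict_of_ae ?_)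
    filter_upwards [ae_measure_Ici_ne_zero F] with y hy
    have hpos : 0 < survivalLeft F y := ENNReal.toReal_pos hy (measure_ne_top _ _)
    have e1 : ENNReal.ofReal (survival F y) = F (Ioi y) := ENNReal.ofReal_toReal (measure_ne_top _ _)
    have e2 : ENNReal.ofReal (survivalLeft F y) = F (Ici y) :=
      ENNReal.ofReal_toReal (measure_ne_top _ _)
    rw [one_sub_hazard_singleton hF hy, ENNReal.ofReal_mul (sq_nonneg _),
      ENNReal.ofReal_div_of_pos (by positivity), ENNReal.ofReal_mul (Nat.cast_nonneg _), e1,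
      ENNReal.ofReal_pow hpos.le, e2, ENNReal.ofReal_natCast, Real.enorm_eq_ofReal_abs,
      ← ENNReal.ofReal_pow (abs_nonneg _), sq_abs, div_eq_mul_inv, ENNReal.inv_pow]
    ring
  · have := h1 y
    positivity

end Main

end Censored

end

theorem mainTheorem8 {Ω : Type*} {mΩ : MeasurableSpace Ω} (P : Measure Ω) [IsProbabilityMeasure P]
    (F G : Measure ℝ≥0) [IsProbabilityMeasure F] [IsProbabilityMeasure G]
    (hF : F {0} = 0) (hG : G {0} = 0)
    {n : ℕ} (T C : Fin n → Ω → ℝ≥0)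
    (hT : ∀ i, Measurable (T i)) (hC : ∀ i, Measurable (C i))
    (hTF : ∀ i, P.map (T i) = F) (hCG : ∀ i, P.map (C i) = G)
    (hTind : iIndepFun T P) (hCind : iIndepFun C P)
    (hTC : IndepFun (fun ω i => T i ω) (fun ω i => C i ω) P)
    (h : ℝ≥0 → ℝ≥0 → Ω → ℝ)
    (hh : Censored.IsTwoTimePredictable (Censored.obsFiltration P T C hT hC) h)
    (hint : ∀ t, ∫⁻ ω, ∫⁻ p in Censored.domC t, ‖h p.1 p.2 ω‖ₑ
      ∂((Censored.dM F T C ω).variation.prod (Censored.dM F T C ω).variation) ∂P < ∞) :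
    -- the recalled description of `M` and of `⟨M⟩`, which enters the second-moment condition
    (Censored.IsSquareIntegrableMartingale (Censored.obsFiltration P T C hT hC) P
        (Censored.pooledM F T C) ∧
      Censored.IsPredictableVariation (Censored.obsFiltration P T C hT hC) P
        (Censored.pooledM F T C) (fun t ω => (Censored.varM F T C ω).real (Ioc 0 t))) ∧
    Martingale (Censored.doubleIntegral F T C h) (Censored.obsFiltration P T C hT hC) P ∧
    ((∀ t, ∫⁻ ω, ∫⁻ y in Ioc 0 t,
        (∫⁻ x in Ioo 0 y, ‖h x y ω‖ₑ ∂(Censored.dM F T C ω).variation) ^ 2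
          ∂(Censored.varM F T C ω) ∂P < ∞) →
      Censored.IsSquareIntegrableMartingale (Censored.obsFiltration P T C hT hC) P
        (Censored.doubleIntegral F T C h) ∧
      Censored.IsPredictableVariation (Censored.obsFiltration P T C hT hC) P
        (Censored.doubleIntegral F T C h) (Censored.doubleVariation F T C h)) := by
  have hS : Censored.IsSample P F G T C := ⟨hF, hG, hT, hC, hTF, hCG, hTind, hCind, hTC⟩
  have hW := hS.isRunningIntegral_doubleIntegral hh hint
  refine ⟨hS.isPredictableVariation_pooledM, hW.martingale hS, fun hsq => ?_⟩
  rw [Censored.doubleVariation_eq hF hh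
    (hW.predictable.mono Censored.predictable_le_prod le_rfl)]
  refine hW.isPredictableVariation hS fun t => ?_
  refine lt_of_le_of_lt (lintegral_mono fun ω => lintegral_mono fun y => ?_) (hsq t)
  gcongr
  exact Censored.enorm_innerIntegral_le hF hh y ω
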